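/- **Conventions.** For a space $X$ with a metric, $\dim_{mc}X\le k$ means that there are a simplicial complex $K$ of dimension at most $k$ and a continuous map $g\colon X\to K$ such that the diameters of the sets $g^{-1}(y)$, $y\in K$, have a common finite bound; $\dim_{mc}X$ is the least such $k$. A homotopy $H\colon X\times[0,1]\to Y$ into a metric space is *bounded* if the diameters of the tracks $H(\{x\}\times[0,1])$, $x\in X$, have a common finite bound. A metric on the base of a covering is lifted to the covering space by taking the infimum of the lengths of the projections of paths. **Theorem.** Let $M$ be a closed connected $n$-manifold with a geodesic metric, with universal covering $p_M\colon\widetilde M\to M$ and fundamental group $\pi$; $M$ is called *md-small* if $\dim_{mc}\widetilde M<n$ for the lifted metric. Let $B\pi$ be a locally finite CW complex that is a $K(\pi,1)$ and admits a proper geodesic metric inducing its topology, let $p\colon E\pi\to B\pi$ be its universal covering, with the induced CW structure and with the lifts of the metrics of $B\pi$. Let $f\colon M\to B\pi$ be a classifying map, that is, a continuous map that induces an isomorphism of fundamental groups, and let $\widetilde f\colon\widetilde M\to E\pi$ be a lift of $f$. The following conditions are equivalent: 1. $M$ is md-small; 2. there is a homotopy $H\colon\widetilde M\times[0,1]\to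 E\pi$ from $\widetilde f$ to a map with image in the skeleton $E\pi^{(n-1)}$ that is bounded for every proper geodesic metric on $B\pi$; 3. for every proper geodesic metric on $B\pi$ there is a bounded homotopy from $\widetilde f$ to a map with image in $E\pi^{(n-1)}$; 4. for some proper geodesic metric on $B\pi$ there is a bounded homotopy from $\widetilde f$ to a map with image in $E\pi^{(n-1)}$. Moreover, if $M$ is md-small, then for every CW structure on $M$ for which $f$ is cellular, the homotopy $H$ in 2 can be chosen cellular with respect to the CW structure on $\widetilde M\times[0,1]$ that is the product of the induced structure on $\widetilde M$ and the structure on $[0,1]$ with vertices $0,1$ and one $1$-cell. -/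

import Mathlib

open Set Topology
open scoped ENNReal unitInterval

namespace MacroDim

universe u v

/-- The closed simplex spanned by a finite set `s` of vertices, in barycentric coordinates. -/
def closedSimplex {V : Type u} (s : Finset V) : Set (V → ℝ) :=
  {w | (∀ v, 0 ≤ w v) ∧ (∀ v, v ∉ s → w v = 0) ∧ ∑ v ∈ s, w v = 1}

/-- The geometric realization of an abstract simplicial complex: the union of its closed
simplices. -/
def Realization {V : Type u} (K : PreAbstractSimplicialComplex V) : Type u :=
  {w : V → ℝ // ∃ s ∈ K.faces, w ∈ closedSimplex s}

/-- The inclusion of a closed simplex in the realization. -/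
def simplexInclusion {V : Type u} (K : PreAbstractSimplicialComplex V) (s : K.faces) :
    closedSimplex s.1 → Realization K :=
  fun w => ⟨w.1, s.1, s.2, w.2⟩

/-- The realization carries the weak topology: a set is closed if and only if its intersection
with every closed simplex is closed in the Euclidean topology of that simplex. -/
instance {V : Type u} (K : PreAbstractSimplicialComplex V) : TopologicalSpace (Realization K) :=
  ⨆ s : K.faces, TopologicalSpace.coinduced (simplexInclusion K s) inferInstance

/-- `dim_mc X ≤ k` for a space `X` with distance `e`: there are a simplicial complex `K` of
dimension at most `k` and a continuous map `g : X → |K|` such that the diameters of the point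
preimages of `g` have a common finite bound. -/
def MacroDimLE (X : Type u) [TopologicalSpace X] (e : X → X → ℝ≥0∞) (k : ℕ) : Prop :=
  ∃ (V : Type u) (K : PreAbstractSimplicialComplex V) (g : C(X, Realization K)) (b : ℝ),
    (∀ s ∈ K.faces, s.card ≤ k + 1) ∧ ∀ x y, g x = g y → e x y ≤ ENNReal.ofReal b

/-- The macroscopic dimension `dim_mc X` (equal to `⊤` if no `k` bounds it). -/
noncomputable def macroDim (X : Type u) [TopologicalSpace X] (e : X → X → ℝ≥0∞) : ℕ∞ :=
  ⨅ (k : ℕ) (_ : MacroDimLE X e k), (k : ℕ∞)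

/-- A proper geodesic metric that induces the given topology. -/
structure ProperGeodesicMetric (B : Type u) [t : TopologicalSpace B] where
  metric : MetricSpace B
  topology_eq : metric.toPseudoMetricSpace.toUniformSpace.toTopologicalSpace = t
  isCompact_closedBall : ∀ (x : B) (r : ℝ), IsCompact {y | metric.dist y x ≤ r}
  geodesic : ∀ x y : B, ∃ γ : ℝ → B, γ 0 = x ∧ γ (metric.dist x y) = y ∧
    ∀ s ∈ Icc 0 (metric.dist x y), ∀ t ∈ Icc 0 (metric.dist x y),
      metric.dist (γ s) (γ t) = |s - t|

/-- The metric lifted along `p : E → B`: the distance of two points of `E` is the infimum, over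
all paths in `E` that join them, of the length of the projection of the path to `B`. -/
noncomputable def ProperGeodesicMetric.lift {B : Type u} [TopologicalSpace B]
    (d : ProperGeodesicMetric B) {E : Type v} [TopologicalSpace E] (p : E → B) (x y : E) : ℝ≥0∞ :=
  letI := d.metric
  ⨅ γ : Path x y, eVariationOn (fun t => p (γ t)) univ

/-- A homotopy is bounded if the diameters of its tracks have a common finite bound. -/
def IsBoundedHomotopy {X : Type u} [TopologicalSpace X] {E : Type v} [TopologicalSpace E]
    (e : E → E → ℝ≥0∞) (H : C(X × I, E)) : Prop :=
  ∃ b : ℝ, ∀ x s t, e (H (x, s)) (H (x, t)) ≤ ENNReal.ofReal b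

/-- `H` deforms `f` to a map with image in `S`. -/
def IsDeformationInto {X : Type u} [TopologicalSpace X] {E : Type v} [TopologicalSpace E]
    (f : C(X, E)) (S : Set E) (H : C(X × I, E)) : Prop :=
  (∀ x, H (x, 0) = f x) ∧ ∀ x, H (x, 1) ∈ S

/-- The union of the cells of dimension `< k`, that is, the `(k - 1)`-skeleton. -/
def skel {B : Type u} [TopologicalSpace B] [T2Space B] (cw : CWComplex (univ : Set B)) (k : ℕ) :
    Set B :=
  letI := cw
  (CWComplex.skeletonLT (univ : Set B) (k : ℕ∞) : Set B)

/-- Every point has a neighbourhood that meets only finitely many closed cells. -/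
def IsLocallyFiniteCW {B : Type u} [TopologicalSpace B] (cw : CWComplex (univ : Set B)) : Prop :=
  letI := cw
  LocallyFinite fun c : (Σ n, RelCWComplex.cell (univ : Set B) n) =>
    CWComplex.closedCell (C := (univ : Set B)) c.1 c.2

/-- The `(k - 1)`-skeleton of the CW structure that a covering `p : E → B` induces on `E`: the
preimage of the `(k - 1)`-skeleton of `B` (see `skel_eq_liftedSkel`). -/
def liftedSkel {B : Type u} [TopologicalSpace B] [T2Space B] {E : Type v} (p : E → B)
    (cw : CWComplex (univ : Set B)) (k : ℕ) : Set E :=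
  p ⁻¹' skel cw k

/-- Agreement with the skeleta of the induced CW structure: if every characteristic map of a CW
structure on `E` is a lift of a characteristic map of `B`, its skeleta are the sets
`liftedSkel`. -/
theorem skel_eq_liftedSkel {B : Type u} [TopologicalSpace B] [T2Space B] {E : Type v}
    [TopologicalSpace E] [T2Space E] (p : E → B) (cB : CWComplex (univ : Set B))
    (cE : CWComplex (univ : Set E))
    (h : ∀ (n : ℕ) (i : cE.cell n), ∃ j : cB.cell n,
      EqOn (fun z => p (cE.map n i z)) (cB.map n j) (Metric.closedBall 0 1)) (k : ℕ) :
    skel cE k = liftedSkel p cB k := by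
  have key : ∀ (n : ℕ) (i : cE.cell n), ∃ j : cB.cell n, ∀ x ∈ CWComplex.openCell
      (C := (univ : Set E)) n i, p x ∈ CWComplex.openCell (C := (univ : Set B)) n j := by
    intro n i
    obtain ⟨j, hj⟩ := h n i
    refine ⟨j, ?_⟩
    rintro _ ⟨z, hz, rfl⟩
    exact ⟨z, hz, (hj (Metric.ball_subset_closedBall hz)).symm⟩
  ext x
  simp only [skel, liftedSkel, mem_preimage, SetLike.mem_coe, CWComplex.mem_skeletonLT_iff]
  constructor
  · rintro ⟨m, hm, i, hx⟩
    obtain ⟨j, hj⟩ := key m i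
    exact ⟨m, hm, j, hj x hx⟩
  · rintro ⟨m, hm, j, hx⟩
    have hx' : x ∈ (CWComplex.skeletonLT (univ : Set E) ⊤ : Set E) := by simp
    rw [SetLike.mem_coe, CWComplex.mem_skeletonLT_iff] at hx'
    obtain ⟨m', -, i', hi'⟩ := hx'
    obtain ⟨j', hj'⟩ := key m' i'
    have hmm : m' = m := by
      by_contra hne
      refine Set.disjoint_left.1 (CWComplex.disjoint_openCell_of_ne (C := (univ : Set B))
        (i := j') (j := j) ?_) (hj' x hi') hx
      intro heq
      exact hne (congrArg Sigma.fst heq)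
    subst hmm
    exact ⟨m', hm, i', hi'⟩

/-- `f` maps every skeleton of the source into the skeleton of the same dimension. -/
def IsCellularMap {M B : Type*} [TopologicalSpace M] [T2Space M] [TopologicalSpace B] [T2Space B]
    (cM : CWComplex (univ : Set M)) (cB : CWComplex (univ : Set B)) (f : M → B) : Prop :=
  ∀ k, MapsTo f (skel cM k) (skel cB k)

/-- For the skeleta `S k` (cells of dimension `< k`) of a CW structure on `X`, the corresponding
skeleta of the product CW structure on `X × [0,1]`, where `[0,1]` has the vertices `0`, `1` and one
`1`-cell: the cells of dimension `< k + 1` are the `c × {0}` and `c × {1}` with `dim c < k + 1`, and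
the `c × (0,1)` with `dim c < k`. -/
def cylinderSkel {X : Type u} (S : ℕ → Set X) : ℕ → Set (X × I)
  | 0 => S 0 ×ˢ {0, 1}
  | k + 1 => S (k + 1) ×ˢ {0, 1} ∪ S k ×ˢ univ

/-- The homotopy `H` is cellular for the product CW structure on `X × [0,1]` and the induced CW
structures on the covering spaces `X` of `M` and `E` of `B`. -/
def IsCellularHomotopy {M B X E : Type*} [TopologicalSpace M] [T2Space M] [TopologicalSpace B]
    [T2Space B] [TopologicalSpace X] [TopologicalSpace E] (pM : X → M) (p : E → B)
    (cM : CWComplex (univ : Set M)) (cB : CWComplex (univ : Set B)) (H : C(X × I, E)) : Prop :=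
  ∀ k, MapsTo H (cylinderSkel (liftedSkel pM cM) k) (liftedSkel p cB k)

end MacroDim

/-!
The lift `f'` of the classifying map takes translates to translates under deck transformations
(`exists_deck_comp_eq`), and the translates of a compact set cover the universal covering of `M`,
so every statement about the behaviour of `f'` near a point can be translated into one about a
fixed compact subset of `E`. Since `E` is contractible, this makes all extension problems in `E`
uniformly controlled (`exists_extension_near`): a map of the boundary of a disc that stays within
`r` of `f' x` extends to the disc within a distance `r'` that depends only on `r`, and by cellular
approximation the extension of a `d`-disc stays in the cells of dimension less than `k` if `d < k`
and the given map does. "Bounded" therefore means the same for all proper geodesic metrics on `B`: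
each track is moved into one compact set by a deck transformation
(`exists_isCompact_of_forall_liftEDist_le`, `isBoundedHomotopy_of_isCompact`).

Small macroscopic dimension yields a bounded homotopy. If `dim_mc X < n`, then `X` has an open
cover by sets of bounded diameter in which no point lies in more than `n` sets
(`MacroDimLE.exists_cover`; the point preimages of a map to a complex are bounded, but it need not
be proper, so covers of larger and larger balls have to be merged). The nerve of the cover has
dimension less than `n`, hence it can be mapped, simplex by simplex and with control, into the
cells of `E` of dimension less than `n` (`exists_nerve_extension`). This gives a map at a bounded
distance from `f'` (`exists_map_skel_near`), and two maps at a bounded distance are homotopic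
through such maps: contracting successively, with the weights of the partition of unity, towards
points that depend only on the partition deforms both of them to the same map
(`exists_fold_homotopy`, `exists_homotopy_near`).

Conversely (`macroDim_lt_of_bounded`), let `h` be a map with values in the cells of dimension less
than `n` at a bounded distance from `f'`. Each of these cells has an open neighbourhood such that
the neighbourhoods of different cells of the same dimension are disjoint. Their preimages under
`h` form a cover of order at most `n`, and they are bounded because `f'` is proper and
equivariant; this is where the injectivity of `f` on fundamental groups enters
(`exists_liftEDist_le_of_lift`). The map to the nerve of this cover shows that `dim_mc X < n`.

For a cell structure on `M`, the map to the skeleton and the homotopy are made cellular cell by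
cell over the cells of `X` (`exists_cellular_map_near`, `exists_cellular_homotopy_near`), which
fall into finitely many classes modulo deck transformations.
-/

namespace MacroDim

universe u v w

/-! ### Covering spaces and geodesics -/

theorem deck_symm {E B : Type*} [TopologicalSpace E] {p : E → B} {τ : E ≃ₜ E}
    (h : ∀ z, p (τ z) = p z) (z : E) : p (τ.symm z) = p z := by
  rw [← h (τ.symm z), τ.apply_symm_apply]

section Covering

variable {E B : Type*} [TopologicalSpace E] [TopologicalSpace B] {p : E → B}

/-- The deck transformations of a simply connected covering space act transitively on the fibres. -/
theorem exists_deck [SimplyConnectedSpace E] [LocallyPathConnectedSpace E]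
    (hp : IsCoveringMap p) {x y : E} (h : p x = p y) :
    ∃ τ : E ≃ₜ E, (∀ z, p (τ z) = p z) ∧ τ x = y := by
  have key : ∀ x y : E, p x = p y → ∃ F : C(E, E), F x = y ∧ p ∘ F = p := by
    intro x y h
    obtain ⟨F, hF, -⟩ := hp.existsUnique_continuousMap_lifts ⟨p, hp.continuous⟩ x y h.symm
    exact ⟨F, hF⟩
  have key2 : ∀ (x y : E) (F G : C(E, E)), F x = y → p ∘ F = p → G y = x → p ∘ G = p →
      ∀ z, G (F z) = z := by
    intro x y F G hF hpF hG hpG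
    have := hp.eq_of_comp_eq (g₁ := G ∘ F) (g₂ := id) (G.continuous.comp F.continuous)
      continuous_id (by rw [← Function.comp_assoc, hpG, hpF]; rfl) x (by simp [hF, hG])
    exact fun z => congrFun this z
  obtain ⟨F, hF, hpF⟩ := key x y h
  obtain ⟨G, hG, hpG⟩ := key y x h.symm
  exact ⟨⟨⟨F, G, key2 x y F G hF hpF hG hpG, key2 y x G F hG hpG hF hpF⟩, F.continuous,
    G.continuous⟩, fun z => congrFun hpF z, hF⟩

theorem t2Space_of_isCoveringMap [T2Space B] (hp : IsCoveringMap p) : T2Space E := by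
  refine ⟨fun x y hxy => ?_⟩
  by_cases h : p x = p y
  · exact hp.isSeparatedMap x y h hxy
  · obtain ⟨u, v, hu, hv, hx, hy, huv⟩ := t2_separation h
    exact ⟨p ⁻¹' u, p ⁻¹' v, hu.preimage hp.continuous, hv.preimage hp.continuous, hx, hy,
      huv.preimage p⟩

theorem locallyPathConnectedSpace_of_isLocalHomeomorph [LocallyPathConnectedSpace B]
    (hp : IsLocalHomeomorph p) : LocallyPathConnectedSpace E := by
  let _ : ChartedSpace B E :=
    { atlas := univ
      chartAt := fun x => (hp x).choose
      mem_chart_source := fun x => (hp x).choose_spec.1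
      chart_mem_atlas := fun x => mem_univ _ }
  exact ChartedSpace.locallyPathConnectedSpace B E

/-- A lift of a map between the bases is equivariant up to a change of the deck transformation. -/
theorem exists_deck_comp_eq {X M : Type*} [TopologicalSpace X] [PreconnectedSpace X] [Nonempty X]
    [SimplyConnectedSpace E] [LocallyPathConnectedSpace E] {pM : X → M} {f : M → B}
    (hp : IsCoveringMap p) (f' : C(X, E)) (hf' : ∀ x, p (f' x) = f (pM x))
    {τ : X ≃ₜ X} (hτ : ∀ z, pM (τ z) = pM z) :
    ∃ θ : E ≃ₜ E, (∀ z, p (θ z) = p z) ∧ ∀ x, f' (τ x) = θ (f' x) := by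
  obtain ⟨x₀⟩ := ‹Nonempty X›
  obtain ⟨θ, hθ, hθx⟩ := exists_deck hp (x := f' x₀) (y := f' (τ x₀)) (by rw [hf', hf', hτ])
  refine ⟨θ, hθ, fun x => ?_⟩
  have := hp.eq_of_comp_eq (g₁ := fun x => f' (τ x)) (g₂ := fun x => θ (f' x))
    (f'.continuous.comp τ.continuous) (θ.continuous.comp f'.continuous)
    (by ext x; simp [hf', hτ, hθ]) x₀ hθx.symm
  exact congrFun this x

end Covering

/-- Every two points are joined by an isometrically embedded interval. -/
def IsGeodesicSpace (B : Type*) [MetricSpace B] : Prop :=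
  ∀ x y : B, ∃ γ : ℝ → B, γ 0 = x ∧ γ (dist x y) = y ∧
    ∀ s ∈ Icc 0 (dist x y), ∀ t ∈ Icc 0 (dist x y), dist (γ s) (γ t) = |s - t|

section Geodesic

variable {B : Type*} [MetricSpace B]

theorem IsGeodesicSpace.exists_path (hB : IsGeodesicSpace B) (x y : B) :
    ∃ γ : Path x y, (∀ t, dist x (γ t) ≤ dist x y) ∧ eVariationOn γ univ ≤ edist x y := by
  obtain ⟨γ, h0, h1, hγ⟩ := hB x y
  have hmem : ∀ t : I, (t : ℝ) * dist x y ∈ Icc 0 (dist x y) := fun t =>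
    ⟨mul_nonneg t.2.1 dist_nonneg, mul_le_of_le_one_left dist_nonneg t.2.2⟩
  have hd : ∀ s t : I, dist (γ (s * dist x y)) (γ (t * dist x y)) = dist x y * dist s t := by
    intro s t
    rw [hγ _ (hmem s) _ (hmem t), ← sub_mul, abs_mul, abs_of_nonneg dist_nonneg, mul_comm,
      Subtype.dist_eq, Real.dist_eq]
  have hlip : LipschitzWith (nndist x y) (fun t : I => γ (t * dist x y)) :=
    LipschitzWith.of_dist_le_mul fun s t => (hd s t).le
  refine ⟨⟨⟨fun t => γ (t * dist x y), hlip.continuous⟩, by simp [h0], by simp [h1]⟩, ?_, ?_⟩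
  · intro t
    have := hd 0 t
    simp only [Icc.coe_zero, zero_mul, h0] at this
    change dist x (γ (t * dist x y)) ≤ _
    rw [this]
    refine mul_le_of_le_one_right dist_nonneg ?_
    rw [Subtype.dist_eq, Real.dist_eq]
    simpa [abs_of_nonneg t.2.1] using t.2.2
  · change eVariationOn (fun t : I => γ (t * dist x y)) univ ≤ _
    refine iSup_le ?_
    rintro ⟨n, u, hu, -⟩
    have hsum : ∑ i ∈ Finset.range n, edist (u (i + 1)) (u i) ≤ 1 := by
      have h2 : ∀ i, edist (u (i + 1)) (u i) = ENNReal.ofReal ((u (i + 1) : ℝ) - u i) := by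
        intro i
        rw [edist_dist, Subtype.dist_eq, Real.dist_eq, abs_of_nonneg]
        exact sub_nonneg.2 (hu (Nat.le_succ i))
      simp_rw [h2]
      rw [← ENNReal.ofReal_sum_of_nonneg (fun i _ => sub_nonneg.2 (hu (Nat.le_succ i))),
        Finset.sum_range_sub (fun i => (u i : ℝ))]
      rw [ENNReal.ofReal_le_one]
      linarith [(u n).2.2, (u 0).2.1]
    calc ∑ i ∈ Finset.range n, edist (γ (u (i + 1) * dist x y)) (γ (u i * dist x y))
        ≤ ∑ i ∈ Finset.range n, (nndist x y : ℝ≥0∞) * edist (u (i + 1)) (u i) :=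
          Finset.sum_le_sum fun i _ => hlip _ _
      _ = nndist x y * ∑ i ∈ Finset.range n, edist (u (i + 1)) (u i) := by
          rw [Finset.mul_sum]
      _ ≤ nndist x y * 1 := by gcongr
      _ = edist x y := by rw [mul_one, edist_nndist]

theorem IsGeodesicSpace.locallyPathConnectedSpace (hB : IsGeodesicSpace B) :
    LocallyPathConnectedSpace B := by
  refine LocallyPathConnectedSpace.of_bases (fun x => Metric.nhds_basis_ball (x := x)) ?_
  intro x r hr
  refine ⟨x, Metric.mem_ball_self hr, fun {y} hy => ?_⟩
  obtain ⟨γ, hγ, -⟩ := hB.exists_path x y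
  exact ⟨γ, fun t => Metric.mem_ball'.2 ((hγ t).trans_lt (Metric.mem_ball'.1 hy))⟩

end Geodesic

/-! ### The lifted metric -/

/-- The distance lifted along `p`: the infimum of the lengths of the projections of paths. -/
noncomputable def liftEDist {E B : Type*} [TopologicalSpace E] [PseudoEMetricSpace B] (p : E → B)
    (x y : E) : ℝ≥0∞ :=
  ⨅ γ : Path x y, eVariationOn (fun t => p (γ t)) univ

section PathLength

variable {E B : Type*} [TopologicalSpace E] [PseudoEMetricSpace B] (p : E → B)

theorem liftEDist_self (x : E) : liftEDist p x x = 0 := by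
  refine le_antisymm ((iInf_le _ (Path.refl x)).trans (le_of_eq ?_)) bot_le
  exact eVariationOn.constant_on (by
    rintro _ ⟨s, -, rfl⟩ _ ⟨t, -, rfl⟩
    rfl)

theorem liftEDist_comm_le (x y : E) : liftEDist p y x ≤ liftEDist p x y := by
  refine le_iInf fun γ => (iInf_le _ γ.symm).trans ?_
  exact eVariationOn.comp_le_of_antitoneOn (fun t => p (γ t)) unitInterval.symm
    (fun a _ b _ h => unitInterval.symm_le_symm.2 h) (mapsTo_univ _ _)

theorem liftEDist_comm (x y : E) : liftEDist p x y = liftEDist p y x :=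
  le_antisymm (liftEDist_comm_le p y x) (liftEDist_comm_le p x y)

theorem liftEDist_triangle (x y z : E) :
    liftEDist p x z ≤ liftEDist p x y + liftEDist p y z := by
  refine ENNReal.le_iInf_add_iInf fun γ δ => (iInf_le _ (γ.trans δ)).trans ?_
  have h2 : (1 / 2 : ℝ) ∈ I := by constructor <;> norm_num
  have hu : eVariationOn (fun t => p ((γ.trans δ) t)) univ =
      eVariationOn (fun t => p ((γ.trans δ) t)) (Iic ⟨1 / 2, h2⟩) +
      eVariationOn (fun t => p ((γ.trans δ) t)) (Ici ⟨1 / 2, h2⟩) := by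
    rw [← eVariationOn.union _ isGreatest_Iic isLeast_Ici, Iic_union_Ici]
  rw [hu]
  refine add_le_add ?_ ?_
  · refine (le_of_eq (eVariationOn.congr ?_)).trans
      (eVariationOn.comp_le_of_monotoneOn (fun t => p (γ t))
      (fun t : I => projIcc (0 : ℝ) 1 zero_le_one (2 * t)) (t := Iic ⟨1 / 2, h2⟩)
      (s := univ) ?_ (mapsTo_univ _ _))
    · intro t ht
      have ht' : (t : ℝ) ≤ 1 / 2 := ht
      simp only [Path.trans_apply, ht', dif_pos, Function.comp]
      congr 2
      rw [projIcc_of_mem]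
    · intro a _ b _ h
      exact monotone_projIcc _ (by have : (a : ℝ) ≤ b := h; linarith)
  · refine (le_of_eq (eVariationOn.congr ?_)).trans
      (eVariationOn.comp_le_of_monotoneOn (fun t => p (δ t))
      (fun t : I => projIcc (0 : ℝ) 1 zero_le_one (2 * t - 1)) (t := Ici ⟨1 / 2, h2⟩)
      (s := univ) ?_ (mapsTo_univ _ _))
    · intro t ht
      have ht' : (1 / 2 : ℝ) ≤ t := ht
      simp only [Path.trans_apply, Function.comp]
      split_ifs with h
      · have : (t : ℝ) = 1 / 2 := le_antisymm h ht'
        have e1 : γ ⟨2 * t, (unitInterval.mul_pos_mem_iff zero_lt_two).2 ⟨t.2.1, h⟩⟩ = y := by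
          convert! γ.target
          rw [this]; norm_num
        have e2 : δ (projIcc (0 : ℝ) 1 zero_le_one (2 * t - 1)) = y := by
          convert! δ.source
          rw [this]; norm_num
        rw [e1, e2]
      · congr 2
        rw [projIcc_of_mem]
    · intro a _ b _ h
      exact monotone_projIcc _ (by have : (a : ℝ) ≤ b := h; linarith)

theorem edist_le_liftEDist (x y : E) : edist (p x) (p y) ≤ liftEDist p x y := by
  refine le_iInf fun γ => ?_
  simpa using eVariationOn.edist_le (fun t => p (γ t)) (mem_univ 0) (mem_univ 1)

theorem liftEDist_deck_le {τ : E → E} (hc : Continuous τ) (hτ : ∀ z, p (τ z) = p z) (x y : E) :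
    liftEDist p (τ x) (τ y) ≤ liftEDist p x y := by
  refine le_iInf fun γ => (iInf_le _ (γ.map hc)).trans (le_of_eq ?_)
  congr 1
  ext t
  exact hτ _

theorem liftEDist_deck {τ : E ≃ₜ E} (hτ : ∀ z, p (τ z) = p z) (x y : E) :
    liftEDist p (τ x) (τ y) = liftEDist p x y := by
  refine le_antisymm (liftEDist_deck_le p τ.continuous hτ x y) ?_
  simpa using liftEDist_deck_le p τ.symm.continuous (deck_symm hτ) (τ x) (τ y)

theorem liftEDist_le_left {x y : E} (γ : Path x y) (t : I) :
    liftEDist p x (γ t) ≤ eVariationOn (fun s => p (γ s)) (Iic t) := by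
  let δ : Path x (γ t) :=
    ⟨⟨fun s => γ (s * t), by fun_prop⟩, by simp, by simp⟩
  refine (iInf_le _ δ).trans ?_
  refine eVariationOn.comp_le_of_monotoneOn (fun s => p (γ s)) (fun s : I => s * t) ?_ ?_
  · intro a _ b _ h
    exact mul_le_mul_left h t
  · intro s _
    exact unitInterval.mul_le_right

theorem liftEDist_le_right {x y : E} (γ : Path x y) (t : I) :
    liftEDist p (γ t) y ≤ eVariationOn (fun s => p (γ s)) (Ici t) := by
  let δ : Path (γ t) y :=
    ⟨⟨fun s => γ (unitInterval.symm (unitInterval.symm s * unitInterval.symm t)), by fun_prop⟩,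
      by simp, by simp⟩
  refine (iInf_le _ δ).trans ?_
  refine eVariationOn.comp_le_of_monotoneOn (fun s => p (γ s))
    (fun s : I => unitInterval.symm (unitInterval.symm s * unitInterval.symm t)) ?_ ?_
  · intro a _ b _ h
    exact unitInterval.symm_le_symm.2 (mul_le_mul_left (unitInterval.symm_le_symm.2 h) _)
  · intro s _
    change t ≤ _
    rw [← unitInterval.symm_symm t]
    refine unitInterval.symm_le_symm.2 ?_
    rw [unitInterval.symm_symm]
    exact unitInterval.mul_le_right

/-- In the length metric, distances can be divided. -/
theorem exists_liftEDist_split (hcont : ∀ x, Continuous (liftEDist p x)) {x y : E} {a r : ℝ≥0∞}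
    (ha : a ≤ liftEDist p x y) (hr : liftEDist p x y < r) :
    ∃ z, liftEDist p x z = a ∧ a + liftEDist p z y < r := by
  obtain ⟨γ, hγ⟩ := iInf_lt_iff.1 hr
  have h := intermediate_value_univ (0 : I) 1
    (f := fun t => liftEDist p x (γ t)) ((hcont x).comp γ.continuous)
  obtain ⟨t, ht⟩ := h (show a ∈ Icc _ _ by simpa [liftEDist_self] using ha)
  refine ⟨γ t, ht, lt_of_le_of_lt ?_ hγ⟩
  rw [← Iic_union_Ici (a := t), eVariationOn.union (x := t) _ isGreatest_Iic isLeast_Ici]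
  exact add_le_add (ht.symm.le.trans (liftEDist_le_left p γ t)) (liftEDist_le_right p γ t)

end PathLength

section LiftedMetric

variable {E B : Type*} [TopologicalSpace E] [MetricSpace B] {p : E → B}

/-- Over the points of a compact set, local sections exist on balls of a uniform radius. -/
theorem exists_uniform_section (hp : IsCoveringMap p) {C : Set B} (hC : IsCompact C) :
    ∃ δ > 0, ∀ x, p x ∈ C → ∃ s : B → E, ContinuousOn s (Metric.ball (p x) δ) ∧ s (p x) = x ∧
      ∀ b ∈ Metric.ball (p x) δ, p (s b) = b := by
  classical
  choose hd U hmem hopen hopen' H hH using hp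
  obtain ⟨δ, hδ, hsub⟩ := lebesgue_number_lemma_of_metric hC hopen
    (fun b _ => mem_iUnion.2 ⟨b, hmem b⟩)
  refine ⟨δ, hδ, fun x hx => ?_⟩
  obtain ⟨c, hc⟩ := hsub _ hx
  have hxU : x ∈ p ⁻¹' U c := hc (Metric.mem_ball_self hδ)
  refine ⟨fun b => if h : b ∈ U c then ((H c).symm (⟨b, h⟩, (H c ⟨x, hxU⟩).2)).1 else x,
    ?_, ?_, ?_⟩
  · refine ContinuousOn.mono ?_ hc
    rw [continuousOn_iff_continuous_domRestrict]
    have : (U c).domRestrict (fun b => if h : b ∈ U c then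
        ((H c).symm (⟨b, h⟩, (H c ⟨x, hxU⟩).2)).1 else x) =
        fun b => ((H c).symm (b, (H c ⟨x, hxU⟩).2)).1 := by
      ext b
      simp [Set.domRestrict]
    rw [this]
    exact continuous_subtype_val.comp ((H c).symm.continuous.comp
      (continuous_id.prodMk continuous_const))
  · have hxU' : p x ∈ U c := hxU
    simp only [hxU', dif_pos]
    have : ((⟨p x, hxU'⟩ : U c), (H c ⟨x, hxU⟩).2) = H c ⟨x, hxU⟩ := by
      refine Prod.ext (Subtype.ext ?_) rfl
      exact (hH c ⟨x, hxU⟩).symm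
    rw [this, Homeomorph.symm_apply_apply]
  · intro b hb
    have hbU := hc hb
    simp only [hbU, dif_pos]
    have := hH c ((H c).symm (⟨b, hbU⟩, (H c ⟨x, hxU⟩).2))
    rw [Homeomorph.apply_symm_apply] at this
    exact this.symm

/-- A point near `x` in the lifted metric lies on the local section through `x`. -/
theorem eq_section_of_liftEDist_lt (hp : IsCoveringMap p) {x y : E} {δ : ℝ} (hδ : 0 < δ)
    {s : B → E}
    (hs : ContinuousOn s (Metric.ball (p x) δ)) (hsx : s (p x) = x)
    (hps : ∀ b ∈ Metric.ball (p x) δ, p (s b) = b)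
    (hxy : liftEDist p x y < ENNReal.ofReal δ) : s (p y) = y := by
  obtain ⟨γ, hγ⟩ := iInf_lt_iff.1 hxy
  have hball : ∀ t, p (γ t) ∈ Metric.ball (p x) δ := by
    intro t
    have h1 := (eVariationOn.edist_le (fun t => p (γ t)) (mem_univ t) (mem_univ 0)).trans_lt hγ
    rw [edist_dist, ENNReal.ofReal_lt_ofReal_iff hδ] at h1
    simpa using h1
  have := hp.eq_of_comp_eq (g₁ := fun t => s (p (γ t))) (g₂ := γ)
    (hs.comp_continuous (hp.continuous.comp γ.continuous) hball) γ.continuous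
    (by ext t; exact hps _ (hball t)) 0 (by simp [hsx])
  simpa using congrFun this 1

theorem liftEDist_section_le (hB : IsGeodesicSpace B) {x : E} {δ : ℝ} {s : B → E}
    (hs : ContinuousOn s (Metric.ball (p x) δ)) (hsx : s (p x) = x)
    (hps : ∀ b ∈ Metric.ball (p x) δ, p (s b) = b) {b : B} (hb : b ∈ Metric.ball (p x) δ) :
    liftEDist p x (s b) ≤ edist (p x) b := by
  obtain ⟨γ, hγ, hv⟩ := hB.exists_path (p x) b
  have hball : ∀ t, γ t ∈ Metric.ball (p x) δ := fun t =>
    Metric.mem_ball'.2 ((hγ t).trans_lt (Metric.mem_ball'.1 hb))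
  let Γ : Path x (s b) :=
    ⟨⟨fun t => s (γ t), hs.comp_continuous γ.continuous hball⟩, by simp [hsx], by simp⟩
  refine (iInf_le _ Γ).trans (le_trans (le_of_eq ?_) hv)
  congr 1
  ext t
  exact hps _ (hball t)

theorem eventually_eq_section (hp : IsCoveringMap p) {x : E} {δ : ℝ} (hδ : 0 < δ) {s : B → E}
    (hs : ContinuousOn s (Metric.ball (p x) δ)) (hsx : s (p x) = x)
    (hps : ∀ b ∈ Metric.ball (p x) δ, p (s b) = b) : ∀ᶠ y in 𝓝 x, s (p y) = y := by
  obtain ⟨W, hxW, hW⟩ : ∃ W ∈ 𝓝 x, InjOn p W := by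
    obtain ⟨e, hxe, rfl⟩ := hp.isLocalHomeomorph x
    exact ⟨e.source, e.open_source.mem_nhds hxe, e.injOn⟩
  have hc : ContinuousAt (fun y => s (p y)) x :=
    ((hs.continuousAt (Metric.ball_mem_nhds _ hδ)).comp hp.continuous.continuousAt)
  have h1 : ∀ᶠ y in 𝓝 x, s (p y) ∈ W := hc.eventually (by simpa [hsx] using hxW)
  have h2 : ∀ᶠ y in 𝓝 x, p y ∈ Metric.ball (p x) δ :=
    hp.continuous.continuousAt.eventually (Metric.ball_mem_nhds _ hδ)
  filter_upwards [h1, h2, hxW] with y hy1 hy2 hy3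
  exact hW hy1 hy3 (hps _ hy2)

theorem eq_of_liftEDist_eq_zero (hp : IsCoveringMap p) {x y : E} (h : liftEDist p x y = 0) :
    x = y := by
  obtain ⟨δ, hδ, hs⟩ := exists_uniform_section hp (isCompact_singleton (x := p x))
  obtain ⟨s, hs, hsx, hps⟩ := hs x rfl
  have h1 := eq_section_of_liftEDist_lt (y := y) hp hδ hs hsx hps (by rw [h]; simpa using hδ)
  have h2 : p x = p y := by
    have := edist_le_liftEDist p x y
    rw [h] at this
    simpa using this
  rw [← h1, ← h2, hsx]

theorem hasBasis_nhds_liftEDist (hp : IsCoveringMap p) (hB : IsGeodesicSpace B) (x : E) :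
    (𝓝 x).HasBasis (fun ε : ℝ≥0∞ => 0 < ε) (fun ε => {y | liftEDist p y x < ε}) := by
  obtain ⟨δ, hδ, hs⟩ := exists_uniform_section hp (isCompact_singleton (x := p x))
  obtain ⟨s, hs, hsx, hps⟩ := hs x rfl
  refine ⟨fun t => ⟨fun ht => ?_, fun ⟨ε, hε, hsub⟩ => ?_⟩⟩
  · have hc : ContinuousAt s (p x) := hs.continuousAt (Metric.ball_mem_nhds _ hδ)
    have ht' : s ⁻¹' t ∈ 𝓝 (p x) := hc (by simpa [hsx] using ht)
    obtain ⟨η, hη, hsub⟩ := Metric.mem_nhds_iff.1 ht'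
    refine ⟨ENNReal.ofReal (min δ η), by simp [hδ, hη], fun y hy => ?_⟩
    have hy' : liftEDist p x y < ENNReal.ofReal (min δ η) := by rw [liftEDist_comm]; exact hy
    rw [← eq_section_of_liftEDist_lt hp hδ hs hsx hps
      (hy'.trans_le (ENNReal.ofReal_le_ofReal (min_le_left _ _)))]
    refine hsub ?_
    have h1 := (edist_le_liftEDist p y x).trans_lt hy
    rw [edist_dist, ENNReal.ofReal_lt_ofReal_iff (by positivity)] at h1
    exact h1.trans_le (min_le_right _ _)
  · have h1 := eventually_eq_section hp hδ hs hsx hps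
    have h2 : ∀ᶠ y in 𝓝 x, p y ∈ Metric.ball (p x) δ :=
      hp.continuous.continuousAt.eventually (Metric.ball_mem_nhds _ hδ)
    have h3 : ∀ᶠ y in 𝓝 x, edist (p y) (p x) < ε :=
      hp.continuous.continuousAt.eventually (Metric.eball_mem_nhds _ hε)
    filter_upwards [h1, h2, h3] with y hy1 hy2 hy3
    apply hsub
    change liftEDist p y x < ε
    rw [liftEDist_comm, ← hy1]
    refine (liftEDist_section_le hB hs hsx hps hy2).trans_lt ?_
    rwa [edist_comm]

/-- The extended metric on a covering space obtained by lifting a geodesic metric; its topology is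
definitionally the given one. -/
@[reducible] noncomputable def liftEMetricSpace (hp : IsCoveringMap p) (hB : IsGeodesicSpace B) :
    EMetricSpace E :=
  let m : EMetricSpace E :=
    { edist := liftEDist p
      edist_self := liftEDist_self p
      edist_comm := liftEDist_comm p
      edist_triangle := liftEDist_triangle p
      eq_of_edist_eq_zero := eq_of_liftEDist_eq_zero hp }
  m.replaceTopology (TopologicalSpace.ext_nhds fun x => by
    refine (hasBasis_nhds_liftEDist hp hB x).eq_of_same_basis ?_
    exact @Metric.nhds_basis_eball E m.toPseudoEMetricSpace x)

theorem continuous_liftEDist (hp : IsCoveringMap p) (hB : IsGeodesicSpace B) :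
    Continuous fun q : E × E => liftEDist p q.1 q.2 := by
  let _ := liftEMetricSpace hp hB
  exact continuous_edist

theorem liftEDist_lt_top [PathConnectedSpace E] (hp : IsCoveringMap p) (hB : IsGeodesicSpace B)
    (x y : E) : liftEDist p x y < ⊤ := by
  have hc : Continuous (liftEDist p x) :=
    (continuous_liftEDist hp hB).comp (Continuous.prodMk_right x)
  have hopen : IsOpen {y | liftEDist p x y < ⊤} := isOpen_lt hc continuous_const
  have hclosed : IsClosed {y | liftEDist p x y < ⊤} := by
    rw [← isOpen_compl_iff, isOpen_iff_mem_nhds]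
    intro z hz
    filter_upwards [(hasBasis_nhds_liftEDist hp hB z).mem_of_mem (i := 1) one_pos] with w hw hw'
    refine hz ((liftEDist_triangle p x w z).trans_lt ?_)
    exact ENNReal.add_lt_top.2 ⟨hw', lt_trans hw ENNReal.one_lt_top⟩
  have := IsClopen.eq_univ ⟨hclosed, hopen⟩ ⟨x, by simp [liftEDist_self]⟩
  exact (this.symm ▸ mem_univ y : y ∈ {y | liftEDist p x y < ⊤})

/-- The lifted metric is bounded on compact sets. -/
theorem exists_liftEDist_le [PathConnectedSpace E] (hp : IsCoveringMap p)
    (hB : IsGeodesicSpace B) {K L : Set E} (hK : IsCompact K) (hL : IsCompact L) :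
    ∃ b : ℝ, ∀ x ∈ K, ∀ y ∈ L, liftEDist p x y ≤ ENNReal.ofReal b := by
  rcases (K ×ˢ L).eq_empty_or_nonempty with h | h
  · refine ⟨0, fun x hx y hy => ?_⟩
    have : (x, y) ∈ K ×ˢ L := ⟨hx, hy⟩
    simp [h] at this
  · obtain ⟨⟨a, b⟩, -, hab⟩ := (hK.prod hL).exists_isMaxOn h
      (continuous_liftEDist hp hB).continuousOn
    refine ⟨(liftEDist p a b).toReal, fun x hx y hy => ?_⟩
    rw [ENNReal.ofReal_toReal (liftEDist_lt_top hp hB a b).ne]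
    exact hab (show (x, y) ∈ K ×ˢ L from ⟨hx, hy⟩)

/-- Neighbourhoods of compact sets for the lift of a proper geodesic metric are relatively
compact (a form of the Hopf–Rinow theorem). -/
theorem exists_isCompact_liftEDist_le [PathConnectedSpace E] [ProperSpace B]
    (hp : IsCoveringMap p) (hB : IsGeodesicSpace B) {L : Set E} (hL : IsCompact L) (r : ℝ) :
    ∃ K, IsCompact K ∧ ∀ x ∈ L, ∀ y, liftEDist p x y ≤ ENNReal.ofReal r → y ∈ K := by
  let _ := liftEMetricSpace hp hB
  have hed : ∀ x y : E, edist x y = liftEDist p x y := fun _ _ => rfl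
  set C := Metric.cthickening (|r| + 2) (p '' L) with hCdef
  have hLC : p '' L ⊆ C := Metric.self_subset_cthickening _
  have hC : IsCompact C := (hL.image hp.continuous).cthickening
  have hCmem : ∀ x ∈ L, ∀ y, liftEDist p x y < ENNReal.ofReal (|r| + 1) → p y ∈ C := by
    intro x hx y hxy
    have h1 := (edist_le_liftEDist p x y).trans_lt hxy
    rw [edist_dist, ENNReal.ofReal_lt_ofReal_iff (by positivity), dist_comm] at h1
    exact Metric.mem_cthickening_of_dist_le _ _ _ _ (mem_image_of_mem p hx) (by linarith)
  obtain ⟨δ, hδ, hs⟩ := exists_uniform_section hp hC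
  choose! s hsc hsx hps using hs
  have hsub : ∀ x, p x ∈ C → ∀ y, liftEDist p x y ≤ ENNReal.ofReal (δ / 2) →
      y ∈ s x '' Metric.closedBall (p x) (δ / 2) := by
    intro x hx y hxy
    refine ⟨p y, ?_, eq_section_of_liftEDist_lt hp hδ (hsc x hx) (hsx x hx) (hps x hx)
      (hxy.trans_lt ((ENNReal.ofReal_lt_ofReal_iff hδ).2 (by linarith)))⟩
    have h1 := (edist_le_liftEDist p x y).trans hxy
    rw [edist_dist, ENNReal.ofReal_le_ofReal_iff (by positivity), dist_comm] at h1
    exact h1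
  have hcomp : ∀ x, p x ∈ C → IsCompact (s x '' Metric.closedBall (p x) (δ / 2)) := fun x hx =>
    (isCompact_closedBall _ _).image_of_continuousOn
      ((hsc x hx).mono (Metric.closedBall_subset_ball (by linarith)))
  set a := ENNReal.ofReal (δ / 4) with ha
  have ha0 : 0 < a := by simp [ha, hδ]
  have haa : a + a = ENNReal.ofReal (δ / 2) := by
    rw [ha, ← ENNReal.ofReal_add (by positivity) (by positivity)]
    congr 1; ring
  -- a compact set over `C` can be thickened by the fixed amount `a`
  have hthick : ∀ K, IsCompact K → ∃ K', IsCompact K' ∧ ∀ x ∈ K, p x ∈ C → ∀ y,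
      liftEDist p x y ≤ a → y ∈ K' := by
    intro K hK
    have hK2 : IsCompact (K ∩ p ⁻¹' C) := hK.inter_right (hC.isClosed.preimage hp.continuous)
    obtain ⟨t, ht, htf, hcov⟩ := hK2.elim_finite_subcover_image (b := K ∩ p ⁻¹' C)
      (c := fun x => Metric.eball x a) (fun x _ => Metric.isOpen_eball)
      (fun x hx => mem_biUnion hx (Metric.mem_eball_self ha0))
    refine ⟨⋃ x ∈ t, s x '' Metric.closedBall (p x) (δ / 2),
      htf.isCompact_biUnion fun x hx => hcomp x (ht hx).2, fun x hx hxC y hxy => ?_⟩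
    obtain ⟨z, hz, hxz⟩ := mem_iUnion₂.1 (hcov ⟨hx, hxC⟩)
    refine mem_biUnion hz (hsub z (ht hz).2 y ?_)
    refine (liftEDist_triangle p z x y).trans ?_
    rw [← haa]
    exact add_le_add ((liftEDist_comm p z x).trans_le (le_of_lt hxz)) hxy
  have key : ∀ N : ℕ, ∃ K, IsCompact K ∧ ∀ x ∈ L, ∀ y, liftEDist p x y < N * a →
      liftEDist p x y < ENNReal.ofReal (|r| + 1) → y ∈ K := by
    intro N
    induction N with
    | zero => exact ⟨∅, isCompact_empty, fun x _ y h => by simp at h⟩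
    | succ N ih =>
      obtain ⟨K, hK, hKy⟩ := ih
      obtain ⟨K', hK', hKy'⟩ := hthick (K ∪ L) (hK.union hL)
      refine ⟨K', hK', fun x hx y hxy hxy' => ?_⟩
      rcases le_total (liftEDist p x y) a with h | h
      · exact hKy' x (.inr hx) (hLC (mem_image_of_mem p hx)) y h
      · rw [liftEDist_comm] at h hxy hxy'
        obtain ⟨z, hz1, hz2⟩ := exists_liftEDist_split p
          (fun x => (continuous_liftEDist hp hB).comp (Continuous.prodMk_right x)) h
          (lt_min hxy hxy')
        have hz3 := hz2.trans_le (min_le_left _ _)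
        have hz4 := (le_add_self.trans_lt hz2).trans_le (min_le_right _ _)
        rw [liftEDist_comm] at hz3 hz4
        refine hKy' z (.inl (hKy x hx z ?_ hz4)) (hCmem x hx z hz4) y ?_
        · rw [Nat.cast_succ, add_mul, one_mul, add_comm] at hz3
          exact lt_of_add_lt_add_right hz3
        · rw [liftEDist_comm, hz1]
  obtain ⟨N, hN⟩ := exists_nat_gt ((|r| + 1) / (δ / 4))
  obtain ⟨K, hK, hKy⟩ := key N
  refine ⟨K, hK, fun x hx y hxy => ?_⟩
  have h1 : liftEDist p x y < ENNReal.ofReal (|r| + 1) :=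
    hxy.trans_lt ((ENNReal.ofReal_lt_ofReal_iff (by positivity)).2 (by linarith [le_abs_self r]))
  refine hKy x hx y (h1.trans_le ?_) h1
  rw [ha, ← ENNReal.ofReal_natCast, ← ENNReal.ofReal_mul (by positivity)]
  refine ENNReal.ofReal_le_ofReal ?_
  rw [div_lt_iff₀ (by positivity)] at hN
  exact hN.le

end LiftedMetric

/-! ### Locally finite cell structures -/

/-- A locally finite CW structure on a space, with all cells in one index type: the open cells
`map c '' ball 0 1` partition the space, and the boundary of a cell is covered by open cells of
smaller dimension. For a locally finite family of closed cells, closure finiteness and the weak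
topology are automatic. -/
structure CellStructure (Y : Type u) [TopologicalSpace Y] where
  ι : Type w
  dim : ι → ℕ
  map : ∀ c, (Fin (dim c) → ℝ) → Y
  continuousOn : ∀ c, ContinuousOn (map c) (Metric.closedBall 0 1)
  injOn : ∀ c, InjOn (map c) (Metric.ball 0 1)
  eq_of_map_eq : ∀ {c c' z z'}, z ∈ Metric.ball 0 1 → z' ∈ Metric.ball 0 1 →
    map c z = map c' z' → c = c'
  exists_map_eq : ∀ y, ∃ c, ∃ z ∈ Metric.ball 0 1, map c z = y
  exists_lt_dim : ∀ c, ∀ z ∈ Metric.sphere 0 1, ∃ c', dim c' < dim c ∧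
    ∃ z' ∈ Metric.ball 0 1, map c' z' = map c z
  locallyFinite : LocallyFinite fun c => map c '' Metric.closedBall 0 1

namespace CellStructure

section Basic

variable {Y : Type*} [TopologicalSpace Y] (K : CellStructure Y)

/-- The open cells. -/
def openCell (c : K.ι) : Set Y := K.map c '' Metric.ball 0 1

/-- The closed cells. -/
def closedCell (c : K.ι) : Set Y := K.map c '' Metric.closedBall 0 1

/-- The union of the cells of dimension less than `k`. -/
def skel (k : ℕ) : Set Y := {y | ∃ c, K.dim c < k ∧ y ∈ K.openCell c}

theorem skel_mono {k l : ℕ} (h : k ≤ l) : K.skel k ⊆ K.skel l :=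
  fun _ ⟨c, hc, hy⟩ => ⟨c, hc.trans_le h, hy⟩

theorem openCell_subset_closedCell (c : K.ι) : K.openCell c ⊆ K.closedCell c :=
  image_mono Metric.ball_subset_closedBall

theorem isCompact_closedCell (c : K.ι) : IsCompact (K.closedCell c) :=
  (isCompact_closedBall _ _).image_of_continuousOn (K.continuousOn c)

theorem eq_of_mem_openCell {c c' : K.ι} {y : Y} (h : y ∈ K.openCell c) (h' : y ∈ K.openCell c') :
    c = c' := by
  obtain ⟨z, hz, rfl⟩ := h
  obtain ⟨z', hz', h⟩ := h'
  exact (K.eq_of_map_eq hz' hz h).symm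

theorem exists_mem_openCell (y : Y) : ∃ c, y ∈ K.openCell c := K.exists_map_eq y

theorem map_mem_of_mem_closedBall {c : K.ι} {z : Fin (K.dim c) → ℝ}
    (hz : z ∈ Metric.closedBall 0 1) :
    z ∈ Metric.ball 0 1 ∨ K.map c z ∈ K.skel (K.dim c) := by
  rcases (Metric.mem_closedBall.1 hz).lt_or_eq with h | h
  · exact .inl h
  · exact .inr (K.exists_lt_dim c z h)

theorem mem_closedCell {c : K.ι} {y : Y} (hy : y ∈ K.closedCell c) :
    y ∈ K.openCell c ∨ y ∈ K.skel (K.dim c) := by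
  obtain ⟨z, hz, rfl⟩ := hy
  exact (K.map_mem_of_mem_closedBall hz).imp (fun h => ⟨z, h, rfl⟩) id

theorem closedCell_subset_skel {c : K.ι} {k : ℕ} (h : K.dim c < k) : K.closedCell c ⊆ K.skel k := by
  intro y hy
  rcases K.mem_closedCell hy with h' | h'
  · exact ⟨c, h, h'⟩
  · exact K.skel_mono h.le h'

theorem mem_skel_iff_of_mem_openCell {c : K.ι} {y : Y} (hy : y ∈ K.openCell c) {k : ℕ} :
    y ∈ K.skel k ↔ K.dim c < k := by
  refine ⟨fun ⟨c', hc', hy'⟩ => ?_, fun h => ⟨c, h, hy⟩⟩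
  rwa [K.eq_of_mem_openCell hy hy']

theorem isClosed_biUnion_closedCell [T2Space Y] (S : Set K.ι) :
    IsClosed (⋃ c ∈ S, K.closedCell c) := by
  rw [biUnion_eq_iUnion]
  exact (K.locallyFinite.comp_injective (Subtype.val_injective (p := (· ∈ S)))).isClosed_iUnion
    fun c => (K.isCompact_closedCell c).isClosed

theorem skel_eq_biUnion (k : ℕ) : K.skel k = ⋃ c ∈ {c | K.dim c < k}, K.closedCell c := by
  ext y
  simp only [mem_iUnion, exists_prop]
  exact ⟨fun ⟨c, hc, hy⟩ => ⟨c, hc, K.openCell_subset_closedCell c hy⟩,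
    fun ⟨c, hc, hy⟩ => K.closedCell_subset_skel hc hy⟩

theorem isClosed_skel [T2Space Y] (k : ℕ) : IsClosed (K.skel k) := by
  rw [skel_eq_biUnion]
  exact K.isClosed_biUnion_closedCell _

theorem finite_inter_nonempty {L : Set Y} (hL : IsCompact L) :
    {c | (K.closedCell c ∩ L).Nonempty}.Finite :=
  K.locallyFinite.finite_nonempty_inter_compact hL

end Basic

end CellStructure

/-- The cell structure of a locally finite CW complex. -/
noncomputable def cellStructureOfCW {B : Type u} [TopologicalSpace B] [T2Space B]
    (cw : CWComplex (univ : Set B)) (h : IsLocallyFiniteCW cw) : CellStructure B where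
  ι := Σ n, cw.cell n
  dim c := c.1
  map c := cw.map c.1 c.2
  continuousOn c := cw.continuousOn c.1 c.2
  injOn c := by
    rw [← cw.source_eq c.1 c.2]
    exact (cw.map c.1 c.2).injOn
  eq_of_map_eq {c c' z z'} hz hz' hzz' := by
    by_contra hne
    exact Set.disjoint_left.1 (cw.pairwiseDisjoint' (mem_univ c) (mem_univ c') hne)
      ⟨z, hz, rfl⟩ ⟨z', hz', hzz'.symm⟩
  exists_map_eq y := by
    have h : y ∈ (univ : Set B) := mem_univ y
    rw [← CWComplex.iUnion_openCell_eq_complex (C := (univ : Set B))] at h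
    simp only [mem_iUnion] at h
    obtain ⟨n, i, z, hz, hy⟩ := h
    exact ⟨⟨n, i⟩, z, hz, hy⟩
  exists_lt_dim c z hz := by
    have h := CWComplex.cellFrontier_subset_skeletonLT (C := (univ : Set B)) c.1 c.2
      (mem_image_of_mem _ hz)
    rw [SetLike.mem_coe, CWComplex.mem_skeletonLT_iff] at h
    obtain ⟨m, hm, j, z', hz', h⟩ := h
    exact ⟨⟨m, j⟩, by exact_mod_cast hm, z', hz', h⟩
  locallyFinite := h

theorem skel_cellStructureOfCW {B : Type u} [TopologicalSpace B] [T2Space B]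
    (cw : CWComplex (univ : Set B)) (h : IsLocallyFiniteCW cw) (k : ℕ) :
    (cellStructureOfCW cw h).skel k = skel cw k := by
  ext y
  simp only [skel, SetLike.mem_coe, CWComplex.mem_skeletonLT_iff]
  constructor
  · rintro ⟨⟨n, i⟩, hn, hy⟩
    exact ⟨n, by exact_mod_cast hn, i, hy⟩
  · rintro ⟨n, hn, i, hy⟩
    exact ⟨⟨n, i⟩, by exact_mod_cast hn, hy⟩

/-- A CW complex whose space is compact has finitely many cells: a choice of one point in each open
cell is a closed discrete set. -/
theorem isLocallyFiniteCW_of_compactSpace {M : Type u} [TopologicalSpace M] [T2Space M]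
    [CompactSpace M] (cw : CWComplex (univ : Set M)) : IsLocallyFiniteCW cw := by
  have hfin : Finite (Σ n, cw.cell n) := by
    -- the centres of the cells
    let x : (Σ n, cw.cell n) → M := fun c => cw.map c.1 c.2 0
    have hx : ∀ c : (Σ n, cw.cell n),
        x c ∈ CWComplex.openCell (C := (univ : Set M)) c.1 c.2 := fun c =>
      CWComplex.map_zero_mem_openCell (C := (univ : Set M)) c.1 c.2
    have hinj : Function.Injective x := by
      intro c c' hcc
      by_contra hne
      exact Set.disjoint_left.1 (cw.pairwiseDisjoint' (mem_univ c) (mem_univ c') hne)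
        (hx c) (hcc ▸ hx c')
    have hmeet : ∀ c : (Σ n, cw.cell n), (range x ∩ cw.map c.1 c.2 '' Metric.closedBall 0
      1).Finite := by
      rintro ⟨n, i⟩
      obtain ⟨J, hJ⟩ := CWComplex.cellFrontier_subset_finite_openCell (C := (univ : Set M)) n i
      have : range x ∩ cw.map n i '' Metric.closedBall 0 1 ⊆
          {x ⟨n, i⟩} ∪ ⋃ m ∈ Finset.range n, (fun j => x ⟨m, j⟩) '' (J m : Set (cw.cell m)) := by
        rintro _ ⟨⟨c, rfl⟩, hc⟩
        have h1 : x c ∈ CWComplex.closedCell (C := (univ : Set M)) n i := hc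
        rw [← CWComplex.cellFrontier_union_openCell_eq_closedCell] at h1
        rcases h1 with h1 | h1
        · have h2 := hJ h1
          simp only [mem_iUnion, exists_prop] at h2
          obtain ⟨m, hm, j, hj, h3⟩ := h2
          have : c = ⟨m, j⟩ := by
            by_contra hne
            exact Set.disjoint_left.1 (cw.pairwiseDisjoint' (mem_univ c) (mem_univ _) hne) (hx c) h3
          subst this
          exact .inr (mem_biUnion (Finset.mem_coe.2 (Finset.mem_range.2 hm)) ⟨j, hj, rfl⟩)
        · have : c = ⟨n, i⟩ := by
            by_contra hne
            exact Set.disjoint_left.1 (cw.pairwiseDisjoint' (mem_univ c) (mem_univ _) hne) (hx c) h1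
          exact .inl (by rw [this]; rfl)
      exact ((finite_singleton _).union ((Finset.range n).finite_toSet.biUnion fun m _ =>
        (J m).finite_toSet.image _)).subset this
    have hclosed : ∀ S ⊆ range x, IsClosed S := by
      intro S hS
      refine cw.closed' S (subset_univ _) fun n j => ?_
      exact ((hmeet ⟨n, j⟩).subset (inter_subset_inter_left _ hS)).isClosed
    have hdisc : DiscreteTopology (range x) := by
      refine discreteTopology_iff_isOpen_singleton.2 fun y => ?_
      rw [← isClosed_compl_iff]
      have : IsClosed (Subtype.val '' ({y}ᶜ : Set (range x))) :=
        hclosed _ (by rintro _ ⟨z, -, rfl⟩; exact z.2)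
      have h2 := this.preimage (continuous_subtype_val (p := (· ∈ range x)))
      rwa [preimage_image_eq _ Subtype.val_injective] at h2
    have hcpt : CompactSpace (range x) := isCompact_iff_compactSpace.1 (hclosed _ le_rfl).isCompact
    have : Finite (range x) := finite_of_compact_of_discrete
    exact Finite.of_injective (fun c => (⟨x c, c, rfl⟩ : range x)) fun c c' h =>
      hinj (congrArg Subtype.val h)
  exact locallyFinite_of_finite _

/-! ### Cell structures on covering spaces -/

/-- The retraction of `ℝⁿ` to the unit ball of the sup norm. -/
def clamp {d : ℕ} (z : Fin d → ℝ) : Fin d → ℝ := fun i => max (-1) (min 1 (z i))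

theorem continuous_clamp {d : ℕ} : Continuous (clamp (d := d)) := by
  unfold clamp; fun_prop

theorem clamp_mem {d : ℕ} (z : Fin d → ℝ) : clamp z ∈ Metric.closedBall (0 : Fin d → ℝ) 1 := by
  rw [mem_closedBall_zero_iff, pi_norm_le_iff_of_nonneg zero_le_one]
  intro i
  rw [Real.norm_eq_abs, abs_le]
  exact ⟨le_max_left _ _, max_le (by norm_num) (min_le_left _ _)⟩

theorem clamp_of_mem {d : ℕ} {z : Fin d → ℝ} (hz : z ∈ Metric.closedBall (0 : Fin d → ℝ) 1) :
    clamp z = z := by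
  rw [mem_closedBall_zero_iff, pi_norm_le_iff_of_nonneg zero_le_one] at hz
  ext i
  have := abs_le.1 (hz i)
  rw [clamp, min_eq_right this.2, max_eq_right this.1]

namespace CellStructure

section Lift

variable {E : Type*} {B : Type*} [TopologicalSpace E] [TopologicalSpace B] (K : CellStructure B)

/-- A characteristic map, extended to the whole Euclidean space. -/
def extMap (c : K.ι) : C(Fin (K.dim c) → ℝ, B) :=
  ⟨fun z => K.map c (clamp z), (K.continuousOn c).comp_continuous continuous_clamp clamp_mem⟩

theorem extMap_of_mem (c : K.ι) {z : Fin (K.dim c) → ℝ} (hz : z ∈ Metric.closedBall 0 1) :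
    K.extMap c z = K.map c z := congrArg _ (clamp_of_mem hz)

variable {p : E → B} (hp : IsCoveringMap p)

include hp in
theorem exists_lift (c : K.ι) {z : Fin (K.dim c) → ℝ} {y : E} (h : p y = K.extMap c z) :
    ∃ F : C(Fin (K.dim c) → ℝ, E), F z = y ∧ p ∘ F = K.extMap c :=
  (hp.existsUnique_continuousMap_lifts (K.extMap c) z y h).exists

include hp in
theorem lift_unique (c : K.ι) {F G : C(Fin (K.dim c) → ℝ, E)} (hF : p ∘ F = K.extMap c)
    (hG : p ∘ G = K.extMap c) {z : Fin (K.dim c) → ℝ} (h : F z = G z) : F = G :=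
  DFunLike.coe_injective (hp.eq_of_comp_eq F.continuous G.continuous (hF.trans hG.symm) z h)

/-- The index type of the cells of the covering space: a cell of the base and a lift of its
characteristic map. -/
def LiftIndex (_ : IsCoveringMap p) : Type _ :=
  Σ c : K.ι, {F : C(Fin (K.dim c) → ℝ, E) // p ∘ F = K.extMap c}

include hp in
theorem finite_lifts_meeting [T2Space B] (c : K.ι) (y₀ : E) :
    ∃ N ∈ 𝓝 y₀, {F : C(Fin (K.dim c) → ℝ, E) | p ∘ F = K.extMap c ∧
      ∃ z ∈ Metric.closedBall 0 1, F z ∈ N}.Finite := by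
  refine (isCompact_closedBall (0 : Fin (K.dim c) → ℝ) 1).induction_on
    (p := fun s => ∃ N ∈ 𝓝 y₀, {F : C(Fin (K.dim c) → ℝ, E) | p ∘ F = K.extMap c ∧
      ∃ z ∈ s, F z ∈ N}.Finite) ⟨univ, Filter.univ_mem, by simp⟩ ?_ ?_ ?_
  · rintro s t hst ⟨N, hN, hfin⟩
    exact ⟨N, hN, hfin.subset fun F ⟨hF, z, hz, hzN⟩ => ⟨hF, z, hst hz, hzN⟩⟩
  · rintro s t ⟨N, hN, hfin⟩ ⟨N', hN', hfin'⟩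
    refine ⟨N ∩ N', Filter.inter_mem hN hN', (hfin.union hfin').subset ?_⟩
    rintro F ⟨hF, z, hz | hz, hzN⟩
    · exact .inl ⟨hF, z, hz, hzN.1⟩
    · exact .inr ⟨hF, z, hz, hzN.2⟩
  · intro z _
    by_cases hz : p y₀ = K.extMap c z
    · obtain ⟨F, hFz, hF⟩ := K.exists_lift hp c hz
      obtain ⟨W, hW, hinj⟩ : ∃ W ∈ 𝓝 y₀, InjOn p W := by
        obtain ⟨e, hxe, rfl⟩ := hp.isLocalHomeomorph y₀
        exact ⟨e.source, e.open_source.mem_nhds hxe, e.injOn⟩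
      refine ⟨F ⁻¹' W, mem_nhdsWithin_of_mem_nhds (F.continuous.continuousAt (by rwa [hFz])), W, hW,
        (finite_singleton F).subset ?_⟩
      rintro G ⟨hG, w, hw, hwW⟩
      refine K.lift_unique hp c hG hF (z := w) (hinj hwW hw ?_)
      exact (congrFun hG w).trans (congrFun hF w).symm
    · obtain ⟨u, v, hu, hv, hyu, hzv, huv⟩ := t2_separation hz
      refine ⟨K.extMap c ⁻¹' v, mem_nhdsWithin_of_mem_nhds
        ((hv.preimage (K.extMap c).continuous).mem_nhds hzv), p ⁻¹' u,
        (hu.preimage hp.continuous).mem_nhds hyu, finite_empty.subset ?_⟩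
      rintro G ⟨hG, w, hw, hwW⟩
      have : p (G w) = K.extMap c w := congrFun hG w
      exact Set.disjoint_left.1 huv hwW (this ▸ hw)

/-- The cell structure induced on a covering space; its characteristic maps are the lifts of the
characteristic maps of the base. -/
def lift [T2Space B] : CellStructure E where
  ι := K.LiftIndex hp
  dim c := K.dim c.1
  map c := c.2.1
  continuousOn c := c.2.1.continuous.continuousOn
  injOn c z hz z' hz' h := by
    refine K.injOn c.1 hz hz' ?_
    rw [← K.extMap_of_mem _ (Metric.ball_subset_closedBall hz),
      ← K.extMap_of_mem _ (Metric.ball_subset_closedBall hz'), ← c.2.2, Function.comp, h]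
    rfl
  eq_of_map_eq {c c' z z'} hz hz' h := by
    obtain ⟨c, F, hF⟩ := c
    obtain ⟨c', G, hG⟩ := c'
    have h1 : K.map c z = K.map c' z' := by
      rw [← K.extMap_of_mem _ (Metric.ball_subset_closedBall hz),
        ← K.extMap_of_mem _ (Metric.ball_subset_closedBall hz'), ← hF, ← hG]
      exact congrArg p h
    obtain rfl := K.eq_of_map_eq hz hz' h1
    obtain rfl := K.injOn c hz hz' h1
    have := K.lift_unique hp c hF hG h
    subst this
    rfl
  exists_map_eq y := by
    obtain ⟨c, z, hz, h⟩ := K.exists_map_eq (p y)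
    obtain ⟨F, hFz, hF⟩ := K.exists_lift hp c (z := z) (y := y)
      (by rw [K.extMap_of_mem _ (Metric.ball_subset_closedBall hz), h])
    exact ⟨⟨c, F, hF⟩, z, hz, hFz⟩
  exists_lt_dim c z hz := by
    obtain ⟨c', hlt, z', hz', h⟩ := K.exists_lt_dim c.1 z hz
    have h1 : p (c.2.1 z) = K.extMap c' z' := by
      rw [K.extMap_of_mem _ (Metric.ball_subset_closedBall hz'), h,
        ← K.extMap_of_mem _ (Metric.sphere_subset_closedBall hz)]
      exact congrFun c.2.2 z
    obtain ⟨F, hFz, hF⟩ := K.exists_lift hp c' h1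
    exact ⟨⟨c', F, hF⟩, hlt, z', hz', hFz⟩
  locallyFinite y₀ := by
    obtain ⟨V, hV, hfin⟩ := K.locallyFinite (p y₀)
    choose N hN hNfin using fun c => K.finite_lifts_meeting hp c y₀
    refine ⟨p ⁻¹' V ∩ ⋂ c ∈ {c | (K.map c '' Metric.closedBall 0 1 ∩ V).Nonempty}, N c,
      Filter.inter_mem (hp.continuous.continuousAt hV)
        ((Filter.biInter_mem hfin).2 fun c _ => hN c), ?_⟩
    refine ((hfin.biUnion fun c _ => (hNfin c).image fun F =>
      (⟨c, F⟩ : Σ c, C(Fin (K.dim c) → ℝ, E))).preimage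
      (f := fun c : K.LiftIndex hp => (⟨c.1, c.2.1⟩ : Σ c, C(Fin (K.dim c) → ℝ, E))) ?_).subset ?_
    · rintro ⟨c, F, hF⟩ - ⟨c', F', hF'⟩ - h
      obtain ⟨rfl, h⟩ := Sigma.mk.inj h
      obtain rfl := eq_of_heq h
      rfl
    · rintro ⟨c, F, hF⟩ ⟨_, ⟨z, hz, rfl⟩, hzV, hzN⟩
      have h1 : (K.map c '' Metric.closedBall 0 1 ∩ V).Nonempty := by
        refine ⟨K.map c z, ⟨z, hz, rfl⟩, ?_⟩
        rw [← K.extMap_of_mem _ hz, ← hF]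
        exact hzV
      exact mem_biUnion (show c ∈ {c | (K.map c '' Metric.closedBall 0 1 ∩ V).Nonempty} from h1)
        ⟨F, ⟨hF, z, hz, mem_iInter₂.1 hzN c h1⟩, rfl⟩

theorem skel_lift [T2Space B] (k : ℕ) : (K.lift hp).skel k = p ⁻¹' K.skel k := by
  ext y
  obtain ⟨⟨c, F, hF⟩, z, hz, rfl⟩ := (K.lift hp).exists_map_eq y
  rw [(K.lift hp).mem_skel_iff_of_mem_openCell ⟨z, hz, rfl⟩, mem_preimage,
    K.mem_skel_iff_of_mem_openCell (c := c)]
  · rfl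
  · refine ⟨z, hz, ?_⟩
    rw [← K.extMap_of_mem _ (Metric.ball_subset_closedBall hz)]
    exact (congrFun hF z).symm

end Lift

end CellStructure

/-! ### Finite subcomplexes and radial coordinates in a cell -/

/-- Gluing along the level `φ = a` of a real function. -/
theorem continuousOn_ite_le {X Z : Type*} [TopologicalSpace X] [TopologicalSpace Z] {S : Set X}
    {φ : X → ℝ} {a : ℝ} {f g : X → Z} (hφ : ContinuousOn φ S)
    (hf : ContinuousOn f {x ∈ S | φ x ≤ a}) (hg : ContinuousOn g {x ∈ S | a ≤ φ x})
    (hfg : ∀ x ∈ S, φ x = a → f x = g x) :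
    ContinuousOn (fun x => if φ x ≤ a then f x else g x) S := by
  rw [continuousOn_iff_continuous_domRestrict] at hφ ⊢
  refine continuous_if_le hφ continuous_const ?_ ?_ fun x hx => hfg x x.2 hx
  · exact hf.comp continuous_subtype_val.continuousOn fun x hx => ⟨x.2, hx⟩
  · exact hg.comp continuous_subtype_val.continuousOn fun x hx => ⟨x.2, hx⟩

/-- Gluing along a map of a compact set. -/
theorem continuousOn_union_image {Y Z F : Type*} [TopologicalSpace Y] [T2Space Y]
    [TopologicalSpace Z] [TopologicalSpace F] {A : Set Y} (hA : IsClosed A) {D : Set F}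
    (hD : IsCompact D) {Φ : F → Y} (hΦ : ContinuousOn Φ D) {g : Y → Z} (hgA : ContinuousOn g A)
    (hgD : ContinuousOn (g ∘ Φ) D) : ContinuousOn g (A ∪ Φ '' D) := by
  refine hgA.union_of_isClosed ?_ hA (hD.image_of_continuousOn hΦ).isClosed
  rw [continuousOn_iff_isClosed]
  intro t ht
  obtain ⟨u, hu, hut⟩ := continuousOn_iff_isClosed.1 hgD t ht
  refine ⟨Φ '' (u ∩ D), ((hD.inter_left hu).image_of_continuousOn
    (hΦ.mono inter_subset_right)).isClosed, ?_⟩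
  ext y
  constructor
  · rintro ⟨hy, z, hz, rfl⟩
    have : z ∈ (g ∘ Φ) ⁻¹' t ∩ D := ⟨hy, hz⟩
    rw [hut] at this
    exact ⟨⟨z, this, rfl⟩, z, hz, rfl⟩
  · rintro ⟨⟨z, hz, rfl⟩, hy⟩
    rw [← hut] at hz
    exact ⟨hz.1, hy⟩

namespace CellStructure

variable {Y : Type*} [TopologicalSpace Y] (K : CellStructure Y)

/-- A set of cells that contains every cell whose interior meets one of its closed cells. -/
def IsSubcomplex (T : Set K.ι) : Prop :=
  ∀ c ∈ T, ∀ c' y, y ∈ K.closedCell c → y ∈ K.openCell c' → c' ∈ T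

/-- The union of a set of closed cells. -/
def carrier (T : Set K.ι) : Set Y := ⋃ c ∈ T, K.closedCell c

variable {K}

theorem IsSubcomplex.mem_of_mem_carrier {T : Set K.ι} (hT : K.IsSubcomplex T) {c : K.ι} {y : Y}
    (hy : y ∈ K.carrier T) (hc : y ∈ K.openCell c) : c ∈ T := by
  obtain ⟨c', hc', hy'⟩ := mem_iUnion₂.1 hy
  exact hT c' hc' c y hy' hc

theorem mem_carrier_of_mem {T : Set K.ι} {c : K.ι} (hc : c ∈ T) {y : Y}
    (hy : y ∈ K.closedCell c) : y ∈ K.carrier T :=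
  mem_biUnion hc hy

variable (K) in
theorem exists_finite_isSubcomplex_mem (d : ℕ) : ∀ c, K.dim c < d →
    ∃ T : Set K.ι, T.Finite ∧ K.IsSubcomplex T ∧ c ∈ T := by
  induction d with
  | zero => intro c hc; omega
  | succ d ih =>
    intro c hc
    choose! T hTf hTs hTm using ih
    set J := {c' | (K.closedCell c' ∩ K.closedCell c).Nonempty} with hJ
    have hJf : J.Finite := K.finite_inter_nonempty (K.isCompact_closedCell c)
    refine ⟨{c} ∪ ⋃ c' ∈ J ∩ {c' | K.dim c' < K.dim c}, T c', ?_, ?_, .inl rfl⟩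
    · refine (finite_singleton c).union ((hJf.inter_of_left _).biUnion fun c' hc' => ?_)
      exact hTf c' (by have := hc'.2; simp only [mem_ofPred_eq] at this; omega)
    · rintro a (rfl | ha) c' y hy hc'
      · rcases K.mem_closedCell hy with h | h
        · exact .inl (K.eq_of_mem_openCell hc' h)
        · have hlt := (K.mem_skel_iff_of_mem_openCell hc').1 h
          exact .inr (mem_biUnion ⟨⟨y, K.openCell_subset_closedCell _ hc', hy⟩, hlt⟩
            (hTm c' (by omega)))
      · obtain ⟨b, hb, hab⟩ := mem_iUnion₂.1 ha
        have hbd : K.dim b < d := by have := hb.2; simp only [mem_ofPred_eq] at this; omega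
        exact .inr (mem_biUnion hb (hTs b hbd a hab c' y hy hc'))

variable (K) in
theorem exists_finite_isSubcomplex {L : Set Y} (hL : IsCompact L) :
    ∃ T : Set K.ι, T.Finite ∧ K.IsSubcomplex T ∧ L ⊆ K.carrier T := by
  choose T hTf hTs hTm using fun c => K.exists_finite_isSubcomplex_mem (K.dim c + 1) c (by omega)
  refine ⟨⋃ c ∈ {c | (K.closedCell c ∩ L).Nonempty}, T c,
    (K.finite_inter_nonempty hL).biUnion fun c _ => hTf c, ?_, ?_⟩
  · intro a ha c' y hy hc'
    obtain ⟨b, hb, hab⟩ := mem_iUnion₂.1 ha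
    exact mem_biUnion hb (hTs b a hab c' y hy hc')
  · intro y hy
    obtain ⟨c, hc⟩ := K.exists_mem_openCell y
    have hc' := K.openCell_subset_closedCell c hc
    exact mem_carrier_of_mem (mem_biUnion (show c ∈ {c | (K.closedCell c ∩ L).Nonempty} from
      ⟨y, hc', hy⟩) (hTm c)) hc'

theorem isCompact_carrier {T : Set K.ι} (hT : T.Finite) : IsCompact (K.carrier T) :=
  hT.isCompact_biUnion fun c _ => K.isCompact_closedCell c

/-- `c` is a cell of largest dimension of the subcomplex `T`. -/
structure IsTop (T : Set K.ι) (c : K.ι) : Prop where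
  isSubcomplex : K.IsSubcomplex T
  mem : c ∈ T
  dim_le : ∀ c' ∈ T, K.dim c' ≤ K.dim c

namespace IsTop

variable {T : Set K.ι} {c : K.ι} (h : IsTop T c)

include h

theorem isSubcomplex_diff : K.IsSubcomplex (T \ {c}) := by
  rintro a ⟨haT, hac⟩ c' y hy hc'
  refine ⟨h.isSubcomplex a haT c' y hy hc', ?_⟩
  rintro rfl
  rcases K.mem_closedCell hy with h1 | h1
  · exact hac (K.eq_of_mem_openCell h1 hc')
  · have := (K.mem_skel_iff_of_mem_openCell hc').1 h1
    have := h.dim_le a haT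
    omega

theorem disjoint : Disjoint (K.carrier (T \ {c})) (K.openCell c) :=
  Set.disjoint_left.2 fun _ hy hc => (h.isSubcomplex_diff.mem_of_mem_carrier hy hc).2 rfl

theorem map_mem_of_norm_eq {z : Fin (K.dim c) → ℝ} (hz : ‖z‖ = 1) :
    K.map c z ∈ K.carrier (T \ {c}) := by
  obtain ⟨c', hlt, hy⟩ := K.exists_lt_dim c z (mem_sphere_zero_iff_norm.2 hz)
  have hy' : K.map c z ∈ K.openCell c' := hy
  have hcl : K.map c z ∈ K.closedCell c := ⟨z, mem_closedBall_zero_iff.2 hz.le, rfl⟩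
  have hne : c' ≠ c := by
    rintro rfl
    exact lt_irrefl _ hlt
  have hmem : c' ∈ T \ {c} := ⟨h.isSubcomplex c h.mem c' _ hcl hy', hne⟩
  exact mem_carrier_of_mem hmem (K.openCell_subset_closedCell c' hy')

theorem carrier_eq : K.carrier T = K.carrier (T \ {c}) ∪ K.closedCell c := by
  rw [carrier, carrier, ← biUnion_singleton c (fun c => K.closedCell c), ← biUnion_union,
    sdiff_union_of_subset (singleton_subset_iff.2 h.mem)]

end IsTop

theorem exists_isTop {T : Set K.ι} (hT : K.IsSubcomplex T) (hTf : T.Finite) (hne : T.Nonempty) :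
    ∃ c, IsTop T c := by
  obtain ⟨c, hc, hmax⟩ := hTf.exists_maximalFor K.dim T hne
  exact ⟨c, hT, hc, fun c' hc' => (le_total _ _).elim id fun hle => hmax hc' hle⟩

/-! #### Functions defined in terms of the coordinate of a cell -/

open Classical in
/-- The function that is `gD` in the coordinate of the open cell `c` and `gA` elsewhere. -/
noncomputable def patch {Z : Type*} (c : K.ι) (gD : (Fin (K.dim c) → ℝ) → Z) (gA : Y → Z) (y : Y) :
    Z :=
  if y ∈ K.openCell c then gD (Function.invFunOn (K.map c) (Metric.ball 0 1) y) else gA y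

section Patch

variable {Z : Type*} {c : K.ι} {gD : (Fin (K.dim c) → ℝ) → Z} {gA : Y → Z}

theorem patch_of_notMem {y : Y} (hy : y ∉ K.openCell c) : patch c gD gA y = gA y := if_neg hy

theorem patch_map_of_lt {z : Fin (K.dim c) → ℝ} (hz : ‖z‖ < 1) :
    patch c gD gA (K.map c z) = gD z := by
  have hz' : z ∈ Metric.ball (0 : Fin (K.dim c) → ℝ) 1 := mem_ball_zero_iff.2 hz
  rw [patch, if_pos ⟨z, hz', rfl⟩]
  congr 1
  exact (K.injOn c).leftInvOn_invFunOn hz'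

theorem map_notMem_openCell {z : Fin (K.dim c) → ℝ} (hz : ‖z‖ = 1) :
    K.map c z ∉ K.openCell c := by
  intro hmem
  obtain ⟨c', hlt, hy⟩ := K.exists_lt_dim c z (mem_sphere_zero_iff_norm.2 hz)
  obtain rfl := K.eq_of_mem_openCell hmem hy
  exact lt_irrefl _ hlt

theorem patch_map {z : Fin (K.dim c) → ℝ} (hz : ‖z‖ ≤ 1) (h : ‖z‖ = 1 → gD z = gA (K.map c z)) :
    patch c gD gA (K.map c z) = gD z := by
  rcases hz.lt_or_eq with h1 | h1
  · exact patch_map_of_lt h1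
  · rw [patch_of_notMem (map_notMem_openCell h1), h h1]

theorem continuousOn_patch [T2Space Y] [TopologicalSpace Z] {A : Set Y} (hA : IsClosed A)
    (hAc : Disjoint A (K.openCell c)) {D : Set (Fin (K.dim c) → ℝ)} (hD : IsCompact D)
    (hD1 : D ⊆ Metric.closedBall 0 1) (hgA : ContinuousOn gA A) (hgD : ContinuousOn gD D)
    (h : ∀ z ∈ D, ‖z‖ = 1 → gD z = gA (K.map c z)) :
    ContinuousOn (patch c gD gA) (A ∪ K.map c '' D) := by
  refine continuousOn_union_image hA hD ((K.continuousOn c).mono hD1) ?_ ?_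
  · exact hgA.congr fun y hy => patch_of_notMem (Set.disjoint_left.1 hAc hy)
  · exact hgD.congr fun z hz => patch_map (mem_closedBall_zero_iff.1 (hD1 hz)) (h z hz)

end Patch

/-- The radius of a point in the cell `c`, equal to `1` outside of the open cell. -/
noncomputable def radius (c : K.ι) : Y → ℝ := patch c (fun z => ‖z‖) (fun _ => 1)

/-- The coordinate of a point in the cell `c`, multiplied by a cut-off function. -/
noncomputable def coord (c : K.ι) : Y → Fin (K.dim c) → ℝ :=
  patch c (fun z => min 1 (4 * (1 - ‖z‖)) • z) (fun _ => 0)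

/-- The radial projection of the punctured cell `c` to its boundary. -/
noncomputable def radialProj (c : K.ι) : Y → Y :=
  patch c (fun z => K.map c (‖z‖⁻¹ • z)) id

section Radial

variable {c : K.ι}

theorem radius_map {z : Fin (K.dim c) → ℝ} (hz : ‖z‖ ≤ 1) : radius c (K.map c z) = ‖z‖ :=
  patch_map hz id

theorem coord_map {z : Fin (K.dim c) → ℝ} (hz : ‖z‖ ≤ 3 / 4) : coord c (K.map c z) = z := by
  rw [coord, patch_map_of_lt (by linarith), min_eq_left (by linarith), one_smul]

theorem radialProj_map {z : Fin (K.dim c) → ℝ} (hz : ‖z‖ ≤ 1) :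
    radialProj c (K.map c z) = K.map c (‖z‖⁻¹ • z) :=
  patch_map hz fun h => by simp [h]

theorem radius_of_notMem {y : Y} (hy : y ∉ K.openCell c) : radius c y = 1 := patch_of_notMem hy

theorem radialProj_of_notMem {y : Y} (hy : y ∉ K.openCell c) : radialProj c y = y :=
  patch_of_notMem hy

theorem exists_of_radius_lt {y : Y} (hy : radius c y < 1) :
    ∃ z : Fin (K.dim c) → ℝ, ‖z‖ = radius c y ∧ K.map c z = y := by
  by_cases h : y ∈ K.openCell c
  · obtain ⟨z, hz, rfl⟩ := h
    exact ⟨z, (radius_map (mem_ball_zero_iff.1 hz).le).symm, rfl⟩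
  · rw [radius_of_notMem h] at hy
    exact absurd hy (lt_irrefl _)

theorem norm_coord {y : Y} (hy : radius c y ≤ 3 / 4) : ‖coord c y‖ = radius c y := by
  obtain ⟨z, hz, rfl⟩ := exists_of_radius_lt (hy.trans_lt (by norm_num))
  rw [coord_map (hz.trans_le hy), hz]

theorem radialProj_eq {y : Y} (hy : radius c y ≤ 3 / 4) :
    radialProj c y = K.map c ((radius c y)⁻¹ • coord c y) := by
  obtain ⟨z, hz, rfl⟩ := exists_of_radius_lt (hy.trans_lt (by norm_num))
  rw [coord_map (hz.trans_le hy), ← hz, radialProj_map (by linarith)]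

theorem norm_inv_smul {F : Type*} [NormedAddCommGroup F] [NormedSpace ℝ F] {z : F} (hz : z ≠ 0) :
    ‖‖z‖⁻¹ • z‖ = 1 := by
  rw [norm_smul, norm_inv, norm_norm, inv_mul_cancel₀ (norm_ne_zero_iff.2 hz)]

variable {T : Set K.ι} (h : IsTop T c)

include h

theorem IsTop.radialProj_mem {y : Y} (hy : y ∈ K.carrier T) (hy0 : 0 < radius c y) :
    radialProj c y ∈ K.carrier (T \ {c}) := by
  rw [h.carrier_eq] at hy
  rcases hy with hy | ⟨z, hz, rfl⟩
  · rwa [radialProj_of_notMem (Set.disjoint_left.1 h.disjoint hy)]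
  · rw [mem_closedBall_zero_iff] at hz
    rw [radius_map hz] at hy0
    rw [radialProj_map hz]
    exact h.map_mem_of_norm_eq (norm_inv_smul (norm_pos_iff.1 hy0))

theorem IsTop.radius_of_mem {y : Y} (hy : y ∈ K.carrier (T \ {c})) : radius c y = 1 :=
  radius_of_notMem (Set.disjoint_left.1 h.disjoint hy)

variable [T2Space Y]

theorem IsTop.continuousOn_radius : ContinuousOn (radius c) (K.carrier T) := by
  rw [h.carrier_eq]
  exact continuousOn_patch (K.isClosed_biUnion_closedCell _) h.disjoint (isCompact_closedBall _ _)
    le_rfl continuousOn_const continuous_norm.continuousOn fun z _ hz => hz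

theorem IsTop.continuousOn_coord : ContinuousOn (coord c) (K.carrier T) := by
  rw [h.carrier_eq]
  refine continuousOn_patch (K.isClosed_biUnion_closedCell _) h.disjoint (isCompact_closedBall _ _)
    le_rfl continuousOn_const (by fun_prop) fun z _ hz => ?_
  simp [hz]

theorem IsTop.continuousOn_radialProj {a : ℝ} (ha : 0 < a) :
    ContinuousOn (radialProj c) {y ∈ K.carrier T | a ≤ radius c y} := by
  have hD : IsCompact {z : Fin (K.dim c) → ℝ | z ∈ Metric.closedBall 0 1 ∧ a ≤ ‖z‖} :=
    (isCompact_closedBall _ _).inter_right (isClosed_le continuous_const continuous_norm)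
  have hne : ∀ z ∈ {z : Fin (K.dim c) → ℝ | z ∈ Metric.closedBall 0 1 ∧ a ≤ ‖z‖}, z ≠ 0 :=
    fun z hz => norm_pos_iff.1 (ha.trans_le hz.2)
  refine (continuousOn_patch (A := K.carrier (T \ {c})) (K.isClosed_biUnion_closedCell _)
    h.disjoint hD (fun z hz => hz.1) continuousOn_id ?_ ?_).mono ?_
  · refine (K.continuousOn c).comp ?_ fun z hz => ?_
    · exact (continuous_norm.continuousOn.inv₀ fun z hz => norm_ne_zero_iff.2 (hne z hz)).smul
        continuousOn_id
    · rw [mem_closedBall_zero_iff, norm_inv_smul (hne z hz)]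
  · intro z _ hz
    simp [hz]
  · rintro y ⟨hy, hya⟩
    rw [h.carrier_eq] at hy
    rcases hy with hy | ⟨z, hz, rfl⟩
    · exact .inl hy
    · rw [radius_map (mem_closedBall_zero_iff.1 hz)] at hya
      exact .inr ⟨z, ⟨hz, hya⟩, rfl⟩

end Radial

end CellStructure

/-! ### Pushing low-dimensional compact sets off cells -/

/-- A map from a compact set that embeds in `ℝᵈ` to a Euclidean space of larger dimension can be
approximated by maps that avoid the origin. -/
theorem exists_approx_ne_zero {W : Type*} [TopologicalSpace W] {S : Set W} (hS : IsCompact S)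
    {d m : ℕ} (hdm : d < m) {j : W → Fin d → ℝ} (hj : ContinuousOn j S) (hinj : InjOn j S)
    {g : W → Fin m → ℝ} (hg : ContinuousOn g S) {ε : ℝ} (hε : 0 < ε) :
    ∃ v : W → Fin m → ℝ, ContinuousOn v S ∧ ∀ x ∈ S, ‖v x - g x‖ < ε ∧ v x ≠ 0 := by
  have : CompactSpace S := isCompact_iff_compactSpace.1 hS
  -- by the Stone–Weierstrass theorem, `g` is close to a `C¹` function of `j`
  let A : Subalgebra ℝ C(S, ℝ) :=
    { carrier := {φ | ∃ P : (Fin d → ℝ) → ℝ, ContDiff ℝ 1 P ∧ ∀ s : S, φ s = P (j s)}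
      mul_mem' := by
        rintro φ ψ ⟨P, hP, h⟩ ⟨Q, hQ, h'⟩
        exact ⟨fun x => P x * Q x, hP.mul hQ, fun s => by simp [h, h']⟩
      add_mem' := by
        rintro φ ψ ⟨P, hP, h⟩ ⟨Q, hQ, h'⟩
        exact ⟨fun x => P x + Q x, hP.add hQ, fun s => by simp [h, h']⟩
      algebraMap_mem' := fun r => ⟨fun _ => r, contDiff_const, fun s => rfl⟩ }
  have hA : A.SeparatesPoints := by
    intro x y hxy
    have hne : j x ≠ j y := fun h => hxy (Subtype.ext (hinj x.2 y.2 h))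
    obtain ⟨i, hi⟩ := Function.ne_iff.1 hne
    refine ⟨fun s => j s i, ⟨⟨fun s : S => j s i, ?_⟩, ⟨fun z => z i, contDiff_apply ℝ ℝ i,
      fun s => rfl⟩, rfl⟩, hi⟩
    exact (continuous_apply i).comp (continuousOn_iff_continuous_domRestrict.1 hj)
  have happ : ∀ i : Fin m, ∃ P : (Fin d → ℝ) → ℝ, ContDiff ℝ 1 P ∧
      ∀ s : S, ‖P (j s) - g s i‖ < ε / 2 := by
    intro i
    obtain ⟨⟨φ, P, hP, hφ⟩, h⟩ :=
      ContinuousMap.exists_mem_subalgebra_near_continuous_of_separatesPoints A hA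
      (fun s : S => g s i)
      ((continuous_apply i).comp (continuousOn_iff_continuous_domRestrict.1 hg)) (ε / 2)
      (by positivity)
    exact ⟨P, hP, fun s => by rw [← hφ]; exact h s⟩
  choose P hP hPg using happ
  have hPc : ContDiff ℝ 1 (fun z i => P i z) := contDiff_pi.2 hP
  -- the image of a `C¹` map from a space of smaller dimension has a dense complement
  obtain ⟨z₀, hz₀, hz₀'⟩ := (hPc.dense_compl_range_of_finrank_lt_finrank
    (by simpa using hdm)).exists_dist_lt
    (0 : Fin m → ℝ) (half_pos hε)
  refine ⟨fun x => (fun i => P i (j x)) - z₀, (hPc.continuous.comp_continuousOn hj).sub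
    continuousOn_const, fun x hx => ⟨?_, fun h => hz₀ ⟨j x, sub_eq_zero.1 h⟩⟩⟩
  have h1 : ‖(fun i => P i (j x)) - g x‖ < ε / 2 := by
    rw [pi_norm_lt_iff (by positivity)]
    exact fun i => hPg i ⟨x, hx⟩
  have h2 : ‖z₀‖ < ε / 2 := by simpa using hz₀'
  calc ‖(fun i => P i (j x)) - z₀ - g x‖ = ‖((fun i => P i (j x)) - g x) - z₀‖ := by
        congr 1; abel
    _ ≤ ‖(fun i => P i (j x)) - g x‖ + ‖z₀‖ := norm_sub_le _ _
    _ < ε := by linarith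

namespace CellStructure

variable {Y : Type*} [TopologicalSpace Y] {K : CellStructure Y} [T2Space Y]

/-- A map from a set that embeds in `ℝᵈ` can be pushed off a cell of dimension larger than `d`:
first it is perturbed so as to miss the centre of the cell, and then it is projected radially. -/
theorem IsTop.exists_push {T : Set K.ι} {c : K.ι} (h : IsTop T c) {W : Type*} [TopologicalSpace W]
    {S : Set W} (hS : IsCompact S) {d : ℕ} (hd : d < K.dim c) {j : W → Fin d → ℝ}
    (hj : ContinuousOn j S) (hinj : InjOn j S) {u : W → Y} (hu : ContinuousOn u S)
    (huT : MapsTo u S (K.carrier T)) :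
    ∃ u' : W → Y, ContinuousOn u' S ∧ MapsTo u' S (K.carrier (T \ {c})) ∧
      ∀ x ∈ S, u x ∈ K.carrier (T \ {c}) → u' x = u x := by
  have hZ : ContinuousOn (fun x => coord c (u x)) S := h.continuousOn_coord.comp hu huT
  have hR : ContinuousOn (fun x => radius c (u x)) S := h.continuousOn_radius.comp hu huT
  obtain ⟨v, hv, hvS⟩ := exists_approx_ne_zero hS hd hj hinj hZ (ε := 1 / 4) (by norm_num)
  -- the cut-off function for the perturbation
  let lam : ℝ → ℝ := fun r => max 0 (min 1 (4 * (3 / 4 - r)))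
  have hlam : Continuous lam := by fun_prop
  let z' : W → Fin (K.dim c) → ℝ := fun x =>
    coord c (u x) + lam (radius c (u x)) • (v x - coord c (u x))
  have hz' : ContinuousOn z' S :=
    hZ.add ((hlam.comp_continuousOn hR).smul (hv.sub hZ))
  have hz'0 : ∀ x ∈ S, radius c (u x) ≤ 3 / 4 → z' x ≠ 0 := by
    intro x hx hr h0
    have hn : ‖coord c (u x)‖ < 1 / 4 := by
      have h1 : coord c (u x) = - (lam (radius c (u x)) • (v x - coord c (u x))) :=
        eq_neg_of_add_eq_zero_left h0
      rw [h1, norm_neg, norm_smul]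
      have h2 : ‖lam (radius c (u x))‖ ≤ 1 := by
        rw [Real.norm_eq_abs, abs_of_nonneg (le_max_left _ _)]
        exact max_le zero_le_one (min_le_left _ _)
      calc _ ≤ 1 * ‖v x - coord c (u x)‖ := by gcongr
        _ < 1 / 4 := by rw [one_mul]; exact (hvS x hx).1
    rw [norm_coord hr] at hn
    have hl : lam (radius c (u x)) = 1 := by
      simp only [lam]
      rw [min_eq_left (by linarith), max_eq_right zero_le_one]
    have h3 : z' x = v x := by simp only [z', hl, one_smul]; abel
    exact (hvS x hx).2 (h3 ▸ h0)
  refine ⟨fun x => if radius c (u x) ≤ 3 / 4 then K.map c (‖z' x‖⁻¹ • z' x)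
    else radialProj c (u x), continuousOn_ite_le hR ?_ ?_ ?_, ?_, ?_⟩
  · refine (K.continuousOn c).comp ?_ fun x hx => ?_
    · have hz'' := hz'.mono (sep_subset S fun x => radius c (u x) ≤ 3 / 4)
      exact (hz''.norm.inv₀ fun x hx => norm_ne_zero_iff.2 (hz'0 x hx.1 hx.2)).smul hz''
    · rw [mem_closedBall_zero_iff, norm_inv_smul (hz'0 x hx.1 hx.2)]
  · exact (h.continuousOn_radialProj (a := 3 / 4) (by norm_num)).comp
      (hu.mono (sep_subset _ _)) fun x hx => ⟨huT hx.1, hx.2⟩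
  · intro x hx hr
    have hl : lam (radius c (u x)) = 0 := by simp [lam, hr]
    have hz : z' x = coord c (u x) := by simp [z', hl]
    rw [radialProj_eq hr.le, hz, norm_coord hr.le]
  · intro x hx
    simp only
    split_ifs with hr
    · exact h.map_mem_of_norm_eq (norm_inv_smul (hz'0 x hx hr))
    · exact h.radialProj_mem (huT hx) (by linarith)
  · intro x hx hux
    have hr := h.radius_of_mem hux
    simp only [hr]
    rw [if_neg (by norm_num), radialProj_of_notMem (Set.disjoint_left.1 h.disjoint hux)]

/-- Cellular approximation for the maps of `d`-dimensional compact sets into finite subcomplexes. -/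
theorem exists_push_skel {W : Type*} [TopologicalSpace W] {S : Set W} (hS : IsCompact S) {d k : ℕ}
    (hdk : d < k) {j : W → Fin d → ℝ} (hj : ContinuousOn j S) (hinj : InjOn j S) (N : ℕ) :
    ∀ {T : Set K.ι}, T.Finite → K.IsSubcomplex T → T.ncard ≤ N → ∀ {u : W → Y}, ContinuousOn u S →
    MapsTo u S (K.carrier T) → ∃ u' : W → Y, ContinuousOn u' S ∧
      MapsTo u' S (K.carrier T ∩ K.skel k) ∧ ∀ x ∈ S, u x ∈ K.skel k → u' x = u x := by
  induction N with
  | zero =>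
    intro T hTf hT hN u hu huT
    rw [Nat.le_zero, ncard_eq_zero hTf] at hN
    subst hN
    refine ⟨u, hu, fun x hx => absurd (huT hx) (by simp [carrier]), fun _ _ _ => rfl⟩
  | succ N ih =>
    intro T hTf hT hN u hu huT
    by_cases hk : ∀ c ∈ T, K.dim c < k
    · refine ⟨u, hu, fun x hx => ⟨huT hx, ?_⟩, fun _ _ _ => rfl⟩
      obtain ⟨c, hc, hy⟩ := mem_iUnion₂.1 (huT hx)
      exact K.closedCell_subset_skel (hk c hc) hy
    · push Not at hk
      obtain ⟨c₀, hc₀, hkc₀⟩ := hk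
      obtain ⟨c, hc⟩ := exists_isTop hT hTf ⟨c₀, hc₀⟩
      have hkc : k ≤ K.dim c := hkc₀.trans (hc.dim_le c₀ hc₀)
      obtain ⟨u', hu', hu'T, hu'u⟩ := hc.exists_push hS (hdk.trans_le hkc) hj hinj hu huT
      obtain ⟨u'', hu'', hu''T, hu''u⟩ := ih (hTf.sdiff (t := {c})) hc.isSubcomplex_diff
        (by have := ncard_sdiff_singleton_lt_of_mem hc.mem hTf; omega) hu' hu'T
      have hsk : ∀ x ∈ S, u x ∈ K.skel k → u' x = u x := by
        intro x hx hux
        refine hu'u x hx ?_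
        have h1 := huT hx
        rw [hc.carrier_eq] at h1
        rcases h1 with h1 | h1
        · exact h1
        · obtain ⟨z, hz, hzu⟩ := h1
          rcases (mem_closedBall_zero_iff.1 hz).lt_or_eq with h2 | h2
          · have : u x ∈ K.openCell c := ⟨z, mem_ball_zero_iff.2 h2, hzu⟩
            have := (K.mem_skel_iff_of_mem_openCell this).1 hux
            omega
          · rw [← hzu]; exact hc.map_mem_of_norm_eq h2
      refine ⟨u'', hu'', fun x hx => ⟨?_, (hu''T hx).2⟩, fun x hx hux => ?_⟩
      · exact biUnion_subset_biUnion_left sdiff_subset (hu''T hx).1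
      · rw [hu''u x hx (by rwa [hsk x hx hux]), hsk x hx hux]

end CellStructure

/-! ### Discs and the extension of maps into contractible complexes -/

/-- The compact set `D` embeds in `ℝᵈ` and is a cone over its boundary `S`: `μ` is the height in
the cone, and `ρ` projects the complement of the cone point to `S`. -/
def IsDiscPair {W : Type*} [TopologicalSpace W] (D S : Set W) (d : ℕ) : Prop :=
  IsCompact D ∧ IsCompact S ∧ S ⊆ D ∧
  (∃ j : W → Fin d → ℝ, ContinuousOn j D ∧ InjOn j D) ∧
  ∃ (μ : W → ℝ) (ρ : W → W), ContinuousOn μ D ∧ (∀ x ∈ D, μ x ∈ Icc (0 : ℝ) 1) ∧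
    (∀ x ∈ S, μ x = 0) ∧ ContinuousOn ρ {x ∈ D | μ x < 1} ∧
    MapsTo ρ {x ∈ D | μ x < 1} S ∧ ∀ x ∈ S, ρ x = x

theorem isDiscPair_of_homeomorph {W F : Type*} [TopologicalSpace W] [NormedAddCommGroup F]
    [NormedSpace ℝ F] [ProperSpace F] (e : W ≃ₜ F) {d : ℕ} {j : F → Fin d → ℝ} (hj : Continuous j)
    (hinj : Function.Injective j) :
    IsDiscPair (e ⁻¹' Metric.closedBall 0 1) (e ⁻¹' Metric.sphere 0 1) d := by
  have hne : ∀ x, 1 - ‖e x‖ < 1 → e x ≠ 0 := fun x hx h0 => by simp [h0] at hx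
  refine ⟨e.isCompact_preimage.2 (isCompact_closedBall _ _),
    e.isCompact_preimage.2 (isCompact_sphere _ _),
    preimage_mono Metric.sphere_subset_closedBall,
    ⟨j ∘ e, (hj.comp e.continuous).continuousOn, (hinj.comp e.injective).injOn⟩,
    fun x => 1 - ‖e x‖, fun x => e.symm (‖e x‖⁻¹ • e x),
    (continuous_const.sub e.continuous.norm).continuousOn, ?_, ?_, ?_, ?_, ?_⟩
  · intro x hx
    have : ‖e x‖ ≤ 1 := mem_closedBall_zero_iff.1 hx
    exact ⟨by linarith, by linarith [norm_nonneg (e x)]⟩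
  · intro x hx
    have : ‖e x‖ = 1 := mem_sphere_zero_iff_norm.1 hx
    linarith
  · refine e.symm.continuous.comp_continuousOn (ContinuousOn.smul (ContinuousOn.inv₀
      e.continuous.norm.continuousOn fun x hx => ?_) e.continuous.continuousOn)
    exact norm_ne_zero_iff.2 (hne x hx.2)
  · intro x hx
    rw [mem_preimage, mem_sphere_zero_iff_norm, e.apply_symm_apply,
      CellStructure.norm_inv_smul (hne x hx.2)]
  · intro x hx
    have : ‖e x‖ = 1 := mem_sphere_zero_iff_norm.1 hx
    simp [this]

theorem isDiscPair_closedBall (d : ℕ) :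
    IsDiscPair (Metric.closedBall (0 : Fin d → ℝ) 1) (Metric.sphere 0 1) d :=
  isDiscPair_of_homeomorph (Homeomorph.refl _) continuous_id Function.injective_id

/-- The boundary of the cylinder over the unit ball. -/
def cylinderBoundary (d : ℕ) : Set ((Fin d → ℝ) × ℝ) :=
  Metric.sphere 0 1 ×ˢ Icc 0 1 ∪ Metric.closedBall 0 1 ×ˢ {0, 1}

/-- The affine homeomorphism that maps the cylinder over the unit ball to a unit ball. -/
noncomputable def cylinderHomeomorph (d : ℕ) : ((Fin d → ℝ) × ℝ) ≃ₜ ((Fin d → ℝ) × ℝ) where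
  toFun q := (q.1, 2 * q.2 - 1)
  invFun q := (q.1, (q.2 + 1) / 2)
  left_inv q := by ext <;> simp
  right_inv q := by ext <;> simp; ring
  continuous_toFun := by fun_prop
  continuous_invFun := by fun_prop

theorem isDiscPair_cylinder (d : ℕ) :
    IsDiscPair (Metric.closedBall (0 : Fin d → ℝ) 1 ×ˢ Icc (0 : ℝ) 1) (cylinderBoundary d)
      (d + 1) := by
  have h := isDiscPair_of_homeomorph (cylinderHomeomorph d) (d := d + 1)
    (j := fun q => Fin.cons q.2 q.1) (by fun_prop) (by
      intro q q' h
      obtain ⟨h1, h2⟩ := Fin.cons_inj.1 h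
      exact Prod.ext h2 h1)
  have habs : ∀ t : ℝ, |2 * t - 1| ≤ 1 ↔ 0 ≤ t ∧ t ≤ 1 := fun t => by
    rw [abs_le]; constructor <;> rintro ⟨a, b⟩ <;> constructor <;> linarith
  have habs' : ∀ t : ℝ, |2 * t - 1| = 1 ↔ t = 0 ∨ t = 1 := fun t => by
    rw [abs_eq zero_le_one]
    constructor
    · rintro (h | h)
      · right; linarith
      · left; linarith
    · rintro (h | h)
      · right; rw [h]; norm_num
      · left; rw [h]; norm_num
  convert! h using 1
  · ext ⟨z, t⟩
    simp only [mem_prod, mem_closedBall_zero_iff, mem_Icc, mem_preimage, cylinderHomeomorph,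
      Homeomorph.homeomorph_mk_coe, Equiv.coe_fn_mk, Prod.norm_mk, sup_le_iff, Real.norm_eq_abs,
      habs]
  · ext ⟨z, t⟩
    simp only [cylinderBoundary, mem_union, mem_prod, mem_closedBall_zero_iff,
      mem_sphere_zero_iff_norm, mem_Icc, mem_preimage, cylinderHomeomorph, mem_insert_iff,
      mem_singleton_iff, Homeomorph.homeomorph_mk_coe, Equiv.coe_fn_mk, Prod.norm_mk,
      Real.norm_eq_abs]
    rw [← habs, ← habs']
    rcases le_total ‖z‖ |2 * t - 1| with hle | hle
    · rw [max_eq_right hle]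
      constructor
      · rintro (⟨h1, h2⟩ | ⟨h1, h2⟩)
        · exact le_antisymm h2 (h1 ▸ hle)
        · exact h2
      · exact fun h => .inr ⟨hle.trans h.le, h⟩
    · rw [max_eq_left hle]
      constructor
      · rintro (⟨h1, h2⟩ | ⟨h1, h2⟩)
        · exact h1
        · exact le_antisymm h1 (h2 ▸ hle)
      · exact fun h => .inl ⟨h, hle.trans h.le⟩

/-- The boundary of a closed simplex. -/
def simplexBoundary {V : Type*} (s : Finset V) : Set (V → ℝ) :=
  {w ∈ closedSimplex s | ∃ v ∈ s, w v = 0}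

theorem isClosed_closedSimplex {V : Type*} (s : Finset V) : IsClosed (closedSimplex s) := by
  have : closedSimplex s = (⋂ v, {w : V → ℝ | 0 ≤ w v}) ∩
      (⋂ (v : V) (_ : v ∉ s), {w : V → ℝ | w v = 0}) ∩ {w | ∑ v ∈ s, w v = 1} := by
    ext w; simp [closedSimplex, and_assoc]
  rw [this]
  refine ((isClosed_iInter fun v => isClosed_le continuous_const (continuous_apply v)).inter
    (isClosed_biInter fun v _ => isClosed_eq (continuous_apply v) continuous_const)).inter ?_
  exact isClosed_eq (continuous_finsetSum _ fun v _ => continuous_apply v) continuous_const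

theorem le_one_of_mem_closedSimplex {V : Type*} {s : Finset V} {w : V → ℝ}
    (hw : w ∈ closedSimplex s) (v : V) : w v ≤ 1 := by
  by_cases hv : v ∈ s
  · rw [← hw.2.2]
    exact Finset.single_le_sum (fun i _ => hw.1 i) hv
  · rw [hw.2.1 v hv]; exact zero_le_one

theorem isCompact_closedSimplex {V : Type*} (s : Finset V) : IsCompact (closedSimplex s) :=
  (isCompact_univ_pi fun _ : V => isCompact_Icc (a := (0 : ℝ)) (b := 1)).of_isClosed_subset
    (isClosed_closedSimplex s) fun _ hw v _ => ⟨hw.1 v, le_one_of_mem_closedSimplex hw v⟩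

theorem isDiscPair_closedSimplex {V : Type*} {s : Finset V} {d : ℕ} (hs : s.card = d + 1) :
    IsDiscPair (closedSimplex s) (simplexBoundary s) d := by
  classical
  have hne : s.Nonempty := Finset.card_pos.1 (by omega)
  have hcard : (0 : ℝ) < s.card := by rw [hs]; positivity
  obtain ⟨v₀, hv₀⟩ := hne
  let m : (V → ℝ) → ℝ := fun w => s.inf' ⟨v₀, hv₀⟩ w
  have hm : Continuous m := by
    exact Continuous.finset_inf'_apply ⟨v₀, hv₀⟩ fun v _ => continuous_apply v
  have hm_le : ∀ w, ∀ v ∈ s, m w ≤ w v := fun w v hv => Finset.inf'_le w hv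
  have hm_eq : ∀ w, ∃ v ∈ s, w v = m w := fun w => by
    obtain ⟨v, hv, h⟩ := Finset.exists_mem_eq_inf' ⟨v₀, hv₀⟩ w
    exact ⟨v, hv, h.symm⟩
  have hbd : IsClosed (simplexBoundary s) := by
    have : simplexBoundary s = closedSimplex s ∩ ⋃ v ∈ s, {w | w v = 0} := by
      ext w; simp [simplexBoundary]
    rw [this]
    exact (isClosed_closedSimplex s).inter (s.finite_toSet.isClosed_biUnion fun v _ =>
      isClosed_eq (continuous_apply v) continuous_const)
  have hm0 : ∀ w ∈ closedSimplex s, 0 ≤ m w := fun w hw => by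
    obtain ⟨v, -, h⟩ := hm_eq w
    rw [← h]; exact hw.1 v
  -- the scaled minimum of the barycentric coordinates
  let μ : (V → ℝ) → ℝ := fun w => s.card * m w
  -- the barycentre, from which the simplex is projected to its boundary
  let b : V → ℝ := fun v => if v ∈ s then (s.card : ℝ)⁻¹ else 0
  refine ⟨isCompact_closedSimplex s, (isCompact_closedSimplex s).of_isClosed_subset hbd
    (sep_subset _ _), sep_subset _ _, ?_, μ, fun w v => (w v - μ w * b v) / (1 - μ w), ?_, ?_, ?_,
    ?_, ?_, ?_⟩
  · have hc : Fintype.card (s.erase v₀) = Fintype.card (Fin d) := by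
      rw [Fintype.card_coe, Finset.card_erase_of_mem hv₀, hs]; simp
    let e := Fintype.equivOfCardEq hc
    refine ⟨fun w i => w (e.symm i), by fun_prop, fun w hw w' hw' h => ?_⟩
    have h1 : ∀ v ∈ s.erase v₀, w v = w' v := fun v hv => by
      have := congrFun h (e ⟨v, hv⟩)
      simpa using this
    have h2 : w v₀ = w' v₀ := by
      have e1 := hw.2.2
      have e2 := hw'.2.2
      rw [← Finset.add_sum_erase _ _ hv₀] at e1 e2
      rw [Finset.sum_congr rfl h1] at e1
      linarith
    ext v
    by_cases hv : v ∈ s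
    · by_cases hvv : v = v₀
      · rw [hvv, h2]
      · exact h1 v (Finset.mem_erase.2 ⟨hvv, hv⟩)
    · rw [hw.2.1 v hv, hw'.2.1 v hv]
  · exact (continuous_const.mul hm).continuousOn
  · intro w hw
    refine ⟨mul_nonneg hcard.le (hm0 w hw), ?_⟩
    change (s.card : ℝ) * m w ≤ 1
    rw [← hw.2.2, ← nsmul_eq_mul]
    exact Finset.card_nsmul_le_sum _ _ _ (hm_le w)
  · rintro w ⟨hw, v, hv, h⟩
    have : m w = 0 := le_antisymm (h ▸ hm_le w v hv) (hm0 w hw)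
    simp [μ, this]
  · refine continuousOn_pi.2 fun v => ContinuousOn.div ?_ ?_ fun w hw => ?_
    · exact ((continuous_apply v).sub ((continuous_const.mul hm).mul continuous_const)).continuousOn
    · exact (continuous_const.sub (continuous_const.mul hm)).continuousOn
    · exact (sub_pos.2 hw.2).ne'
  · rintro w ⟨hw, hlt⟩
    have hpos : 0 < 1 - μ w := sub_pos.2 hlt
    have hμb : ∀ v ∈ s, μ w * b v = m w := fun v hv => by
      simp only [μ, b, hv, if_true]
      field_simp
    refine ⟨⟨fun v => ?_, fun v hv => ?_, ?_⟩, ?_⟩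
    · refine div_nonneg ?_ hpos.le
      by_cases hv : v ∈ s
      · rw [hμb v hv]; exact sub_nonneg.2 (hm_le w v hv)
      · simp [b, hv, hw.1 v]
    · simp [b, hv, hw.2.1 v hv]
    · rw [← Finset.sum_div, Finset.sum_sub_distrib, hw.2.2, Finset.sum_congr rfl hμb,
        Finset.sum_const, nsmul_eq_mul]
      exact div_self hpos.ne'
    · obtain ⟨v, hv, h⟩ := hm_eq w
      exact ⟨v, hv, by simp only; rw [hμb v hv, h, sub_self, zero_div]⟩
  · rintro w ⟨hw, v, hv, h⟩
    have : m w = 0 := le_antisymm (h ▸ hm_le w v hv) (hm0 w hw)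
    ext v
    simp [μ, this]

/-- In a contractible space, every map of the boundary of a disc that lies in a given compact set
extends to the disc with values in another compact set, which does not depend on the map. -/
theorem exists_extension_of_contraction {E : Type*} [TopologicalSpace E]
    (h : C(I × E, E)) (e₀ : E) (h0 : ∀ y, h (0, y) = y) (h1 : ∀ y, h (1, y) = e₀)
    {W : Type*} [TopologicalSpace W] {D S : Set W} {d : ℕ} (hDS : IsDiscPair D S d)
    {u₀ : W → E} (hu₀ : ContinuousOn u₀ S) :
    ∃ u : W → E, ContinuousOn u D ∧ EqOn u u₀ S ∧
      MapsTo u D (h '' (univ ×ˢ (u₀ '' S)) ∪ {e₀}) := by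
  classical
  obtain ⟨hD, hS, hSD, -, μ, ρ, hμ, hμI, hμS, hρ, hρm, hρS⟩ := hDS
  let μ' : W → I := fun x => projIcc 0 1 zero_le_one (μ x)
  have hμ' : ContinuousOn μ' D := continuous_projIcc.comp_continuousOn hμ
  have hμ'1 : ∀ x, 1 ≤ μ x → μ' x = 1 := fun x hx => projIcc_of_right_le _ hx
  refine ⟨fun x => if μ x < 1 then h (μ' x, u₀ (ρ x)) else e₀, ?_, ?_, ?_⟩
  · intro x hx
    by_cases hlt : μ x < 1
    · have hc : ContinuousOn (fun x => h (μ' x, u₀ (ρ x))) {x ∈ D | μ x < 1} :=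
        h.continuous.comp_continuousOn ((hμ'.mono (sep_subset _ _)).prodMk (hu₀.comp hρ hρm))
      have hev : ∀ᶠ x' in 𝓝[D] x, μ x' < 1 := (hμ x hx).eventually (isOpen_Iio.mem_nhds hlt)
      have hmem : {x ∈ D | μ x < 1} ∈ 𝓝[D] x :=
        Filter.inter_mem self_mem_nhdsWithin hev
      have h2 : ContinuousWithinAt (fun x => h (μ' x, u₀ (ρ x))) D x :=
        (hc x ⟨hx, hlt⟩).mono_of_mem_nhdsWithin hmem
      refine h2.congr_of_eventuallyEq ?_ (if_pos hlt)
      filter_upwards [hev] with x' hx' using if_pos hx'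
    · rw [ContinuousWithinAt, if_neg hlt]
      intro U hU
      obtain ⟨O, hOU, hO, heO⟩ := mem_nhds_iff.1 hU
      obtain ⟨A, A', hA, -, h1A, hSA, hAA⟩ := generalized_tube_lemma
        (isCompact_singleton (x := (1 : I)))
        (hS.image_of_continuousOn hu₀) (hO.preimage h.continuous) (by
          rintro ⟨t, y⟩ ⟨ht, -⟩
          obtain rfl : t = 1 := ht
          change h (1, y) ∈ O
          rwa [h1])
      have hev : ∀ᶠ x' in 𝓝[D] x, μ' x' ∈ A :=
        (hμ' x hx).eventually (hA.mem_nhds (by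
          rw [hμ'1 x (not_lt.1 hlt)]; exact h1A rfl))
      have hev2 : ∀ᶠ x' in 𝓝[D] x, x' ∈ D := self_mem_nhdsWithin
      refine Filter.mem_map.2 ?_
      filter_upwards [hev, hev2] with x' hx' hx'D
      apply hOU
      change (if μ x' < 1 then h (μ' x', u₀ (ρ x')) else e₀) ∈ O
      split_ifs with hlt'
      · exact hAA (show (μ' x', u₀ (ρ x')) ∈ A ×ˢ A' from
          ⟨hx', hSA (mem_image_of_mem _ (hρm ⟨hx'D, hlt'⟩))⟩)
      · exact heO
  · intro x hx
    have h2 : μ' x = 0 := projIcc_of_le_left _ (hμS x hx).le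
    simp only [hμS x hx, zero_lt_one, if_true, hρS x hx, h2, h0]
  · intro x hx
    simp only
    split_ifs with hlt
    · exact .inl ⟨_, ⟨mem_univ _, mem_image_of_mem _ (hρm ⟨hx, hlt⟩)⟩, rfl⟩
    · exact .inr rfl

/-- Controlled extension in a contractible cell complex: a map of the boundary of a `d`-disc with
values in the compact set `L` extends to a map with values in the compact set `L'`, and if `d < k`
and the given map has values in the union of the cells of dimension less than `k`, so has the
extension. -/
theorem CellStructure.exists_controlled_extension {E : Type*} [TopologicalSpace E] [T2Space E]
    [ContractibleSpace E] (K : CellStructure E) {L : Set E} (hL : IsCompact L) :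
    ∃ L', IsCompact L' ∧ L ⊆ L' ∧ ∀ {W : Type w} [TopologicalSpace W] {D S : Set W} {d : ℕ},
      IsDiscPair D S d → ∀ {u₀ : W → E}, ContinuousOn u₀ S → MapsTo u₀ S L →
      (∃ u : W → E, ContinuousOn u D ∧ EqOn u u₀ S ∧ MapsTo u D L') ∧
      ∀ k, d < k → MapsTo u₀ S (K.skel k) →
        ∃ u : W → E, ContinuousOn u D ∧ EqOn u u₀ S ∧ MapsTo u D (L' ∩ K.skel k) := by
  obtain ⟨e₀, ⟨h⟩⟩ := id_nullhomotopic E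
  obtain ⟨T, hTf, hT, hLT⟩ := K.exists_finite_isSubcomplex
    (L := h '' (univ ×ˢ L) ∪ {e₀})
    (((isCompact_univ.prod hL).image h.continuous).union isCompact_singleton)
  refine ⟨K.carrier T, isCompact_carrier hTf, fun y hy => hLT (.inl ⟨(0, y), ⟨mem_univ _, hy⟩,
    by simp⟩), ?_⟩
  intro W _ D S d hDS u₀ hu₀ hu₀L
  obtain ⟨u, hu, huS, hum⟩ := exists_extension_of_contraction h.toContinuousMap e₀
    (fun y => by simp) (fun y => by simp) hDS hu₀
  have hum' : MapsTo u D (K.carrier T) := fun x hx => by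
    refine hLT (Set.union_subset_union_left _ (image_mono (prod_mono le_rfl ?_)) (hum hx))
    exact hu₀L.image_subset
  refine ⟨⟨u, hu, huS, hum'⟩, fun k hk hsk => ?_⟩
  obtain ⟨hD, -, hSD, ⟨j, hj, hinj⟩, -⟩ := hDS
  obtain ⟨u', hu', hu'm, hu'u⟩ := exists_push_skel hD hk hj hinj T.ncard hTf hT le_rfl hu hum'
  refine ⟨u', hu', fun x hx => ?_, hu'm⟩
  rw [hu'u x (hSD hx) (by rw [huS hx]; exact hsk hx), huS hx]

/-! ### Covers of small order -/

section Grid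

variable {Z A : Type*} {u : Z → A → ℝ} {k : ℕ}

/-- The distance of a real number to the nearest integer. -/
noncomputable def intDist (t : ℝ) : ℝ := ‖(t : UnitAddCircle)‖

theorem continuous_intDist : Continuous intDist :=
  continuous_norm.comp (AddCircle.continuous_mk' 1)

theorem intDist_nonneg (t : ℝ) : 0 ≤ intDist t := norm_nonneg _

theorem intDist_intCast (m : ℤ) : intDist m = 0 := by
  simp [intDist, UnitAddCircle.norm_eq]

theorem intDist_eq_zero {t : ℝ} : intDist t = 0 ↔ t = round t := by
  rw [intDist, UnitAddCircle.norm_eq, abs_eq_zero, sub_eq_zero]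

/-- A set of the standard cover of a simplex in which the cube `[0, N]ᴬ` is cut into unit cubes: the
coordinates with index in `S` are farther from the integers than the other ones, they have integral
parts `m`, and the other coordinates are close to the integers `m`. -/
def gridSet (u : Z → A → ℝ) (i : Finset A × (A → ℤ)) : Set Z :=
  {x | (∀ b ∈ i.1, ∀ a ∉ i.1, intDist (u x a) < intDist (u x b)) ∧
    (∀ b ∈ i.1, (i.2 b : ℝ) < u x b ∧ u x b < i.2 b + 1) ∧ ∀ a ∉ i.1, |u x a - i.2 a| < 1 / 2}

theorem isOpen_gridSet [TopologicalSpace Z] [Finite A] (hu : ∀ a, Continuous fun x => u x a)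
    (i : Finset A × (A → ℤ)) : IsOpen (gridSet u i) := by
  have : gridSet u i = (⋂ b ∈ i.1, ⋂ a ∈ (i.1 : Set A)ᶜ,
      {x | intDist (u x a) < intDist (u x b)}) ∩
      ((⋂ b ∈ i.1, {x | (i.2 b : ℝ) < u x b} ∩ {x | u x b < i.2 b + 1}) ∩
        ⋂ a ∈ (i.1 : Set A)ᶜ, {x | |u x a - i.2 a| < 1 / 2}) := by
    ext x; simp [gridSet]
  rw [this]
  refine (i.1.finite_toSet.isOpen_biInter fun b _ => (toFinite _).isOpen_biInter fun a _ =>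
    ?_).inter ((i.1.finite_toSet.isOpen_biInter fun b _ => ?_).inter
      ((toFinite _).isOpen_biInter fun a _ => ?_))
  · exact isOpen_lt (continuous_intDist.comp (hu a)) (continuous_intDist.comp (hu b))
  · exact (isOpen_lt continuous_const (hu b)).inter (isOpen_lt (hu b) continuous_const)
  · exact isOpen_lt ((hu a).sub continuous_const).abs continuous_const

theorem abs_sub_le_of_mem_gridSet {i : Finset A × (A → ℤ)} {x y : Z} (hx : x ∈ gridSet u i)
    (hy : y ∈ gridSet u i) (a : A) : |u x a - u y a| ≤ 1 := by
  rw [abs_le]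
  by_cases h : a ∈ i.1
  · have h1 := hx.2.1 a h
    have h2 := hy.2.1 a h
    constructor <;> linarith
  · have h1 := abs_lt.1 (hx.2.2 a h)
    have h2 := abs_lt.1 (hy.2.2 a h)
    constructor <;> linarith

/-- The sets `gridSet` whose index set does not have exactly one element cover the points whose
coordinates have an integral sum. -/
theorem exists_mem_gridSet [Fintype A] {x : Z} {N : ℕ} (hsum : ∑ a, u x a = N) :
    ∃ i : Finset A × (A → ℤ), i.1.card ≠ 1 ∧ x ∈ gridSet u i := by
  classical
  refine ⟨(Finset.univ.filter fun a => intDist (u x a) ≠ 0, fun a => ⌊u x a⌋), ?_, ?_, ?_, ?_⟩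
  · intro h
    obtain ⟨b, hb⟩ := Finset.card_eq_one.1 h
    have hb' : ∀ a, intDist (u x a) ≠ 0 ↔ a = b := fun a => by
      have : a ∈ Finset.univ.filter (fun a => intDist (u x a) ≠ 0) ↔ a = b := by
        rw [show Finset.univ.filter (fun a => intDist (u x a) ≠ 0) = {b} from hb,
          Finset.mem_singleton]
      simpa using this
    have hr : u x b = ((N - ∑ a ∈ Finset.univ.erase b, round (u x a) : ℤ) : ℝ) := by
      push_cast
      rw [← hsum, ← Finset.add_sum_erase _ _ (Finset.mem_univ b)]
      rw [Finset.sum_congr rfl fun a ha => intDist_eq_zero.1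
        (not_not.1 (mt (hb' a).1 (Finset.ne_of_mem_erase ha)))]
      ring
    exact (hb' b).2 rfl (by rw [hr]; exact intDist_intCast _)
  · intro b hb a ha
    simp only [Finset.mem_filter, Finset.mem_univ, true_and, not_not] at hb ha
    rw [ha]
    exact (intDist_nonneg _).lt_of_ne' hb
  · intro b hb
    simp only [Finset.mem_filter, Finset.mem_univ, true_and] at hb
    refine ⟨(Int.floor_le _).lt_of_ne fun h => hb ?_, Int.lt_floor_add_one _⟩
    rw [← h]; exact intDist_intCast _
  · intro a ha
    simp only [Finset.mem_filter, Finset.mem_univ, true_and, not_not] at ha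
    have h1 := intDist_eq_zero.1 ha
    have h2 : u x a = (⌊u x a⌋ : ℝ) := by
      conv_rhs => rw [h1, Int.floor_intCast]
      exact h1
    rw [← h2]; norm_num

theorem eq_of_mem_gridSet {x : Z} {i j : Finset A × (A → ℤ)} (hi : x ∈ gridSet u i)
    (hj : x ∈ gridSet u j) (hcard : i.1.card = j.1.card) : i = j := by
  have h1 : i.1 = j.1 := by
    by_contra hne
    obtain ⟨a, ha, ha'⟩ := Finset.not_subset.1 fun h : i.1 ⊆ j.1 =>
      hne (Finset.eq_of_subset_of_card_le h hcard.ge)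
    obtain ⟨b, hb, hb'⟩ := Finset.not_subset.1 fun h : j.1 ⊆ i.1 =>
      hne (Finset.eq_of_subset_of_card_le h hcard.le).symm
    exact lt_asymm (hi.1 a ha b hb') (hj.1 b hb a ha')
  refine Prod.ext h1 (funext fun a => ?_)
  by_cases ha : a ∈ i.1
  · have h2 := hi.2.1 a ha
    have h3 := hj.2.1 a (h1 ▸ ha)
    have h4 : (i.2 a : ℝ) < j.2 a + 1 := by linarith
    have h5 : (j.2 a : ℝ) < i.2 a + 1 := by linarith
    norm_cast at h4 h5
    omega
  · have h2 := abs_lt.1 (hi.2.2 a ha)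
    have h3 := abs_lt.1 (hj.2.2 a (h1 ▸ ha))
    have h4 : (i.2 a : ℝ) < j.2 a + 1 := by linarith
    have h5 : (j.2 a : ℝ) < i.2 a + 1 := by linarith
    norm_cast at h4 h5
    omega

/-- A point with at most `k + 1` nonzero coordinates lies in at most `k + 1` sets `gridSet` whose
index set does not have exactly one element, because their index sets have different numbers of
elements. -/
theorem card_gridSet_le [Fintype A] {x : Z} {F : Finset A} (hF : F.card ≤ k + 1)
    (h0 : ∀ a ∉ F, u x a = 0) {s : Finset (Finset A × (A → ℤ))}
    (hs : ∀ i ∈ s, i.1.card ≠ 1 ∧ x ∈ gridSet u i) : s.card ≤ k + 1 := by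
  have hsub : ∀ i ∈ s, i.1.card ≤ k + 1 := by
    intro i hi
    refine (Finset.card_le_card fun b hb => ?_).trans hF
    by_contra hbF
    have := (hs i hi).2.2.1 b hb
    rw [h0 b hbF] at this
    have h1 : (i.2 b : ℝ) < 0 := this.1
    have h2 : (0 : ℝ) < i.2 b + 1 := this.2
    norm_cast at h1 h2
    omega
  have : s.card ≤ ((Finset.range (k + 2)).erase 1).card := by
    refine Finset.card_le_card_of_injOn (fun i => i.1.card) (fun i hi => ?_) ?_
    · have := hsub i hi
      simp only [Finset.coe_erase, Finset.coe_range, mem_sdiff, mem_Iio, mem_singleton_iff]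
      exact ⟨by omega, (hs i hi).1⟩
    · exact fun i hi j hj h => eq_of_mem_gridSet (hs i hi).2 (hs j hj).2 h
  rwa [Finset.card_erase_of_mem (by simp), Finset.card_range] at this

end Grid

section Realization

variable {V : Type u} {K : PreAbstractSimplicialComplex V}

theorem continuous_coe_realization : Continuous fun w : Realization K => w.1 := by
  refine continuous_iSup_dom.2 fun s => continuous_coinduced_dom.2 ?_
  exact continuous_subtype_val

theorem injective_coe_realization : Function.Injective fun w : Realization K => w.1 :=
  fun _ _ h => Subtype.ext h

instance : T2Space (Realization K) :=
  .of_injective_continuous injective_coe_realization continuous_coe_realization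

/-- On a compact set of the realization, finitely many barycentric coordinates suffice to recognize
the members of an open cover. -/
theorem exists_finset_lebesgue {C : Set (Realization K)} (hC : IsCompact C)
    {P : Set (Set (Realization K))} (hP : ∀ O ∈ P, IsOpen O) (hCP : C ⊆ ⋃₀ P) :
    ∃ (F : Finset V) (N : ℕ), 0 < N ∧ ∀ x ∈ C, ∃ O ∈ P, ∀ y ∈ C,
      (∀ a ∈ F, |x.1 a - y.1 a| ≤ (N : ℝ)⁻¹) → y ∈ O := by
  classical
  let f : Realization K → V → ℝ := fun w => w.1
  obtain ⟨U, hU, hUC⟩ := lebesgue_number_lemma_sUnion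
    (S := (fun O => (f '' (C \ O))ᶜ) '' P) (hC.image continuous_coe_realization) (by
      rintro _ ⟨O, hO, rfl⟩
      exact ((IsCompact.diff hC (hP O hO)).image continuous_coe_realization).isClosed.isOpen_compl)
        (by
      rintro _ ⟨x, hx, rfl⟩
      obtain ⟨O, hO, hxO⟩ := hCP hx
      refine ⟨_, mem_image_of_mem _ hO, ?_⟩
      rintro ⟨y, hy, hyx⟩
      obtain rfl := injective_coe_realization hyx
      exact hy.2 hxO)
  rw [Pi.uniformity, Filter.mem_iInf] at hU
  obtain ⟨J, hJ, W, hW, rfl⟩ := hU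
  have hε : ∀ i : J, ∃ n : ℕ, ∀ q : (V → ℝ) × (V → ℝ), |q.1 i - q.2 i| ≤ ((n + 1 : ℕ) : ℝ)⁻¹ →
      q ∈ W i := by
    intro i
    obtain ⟨t, ht, htW⟩ := Filter.mem_comap.1 (hW i)
    obtain ⟨ε, hε, hεt⟩ := Metric.mem_uniformity_dist.1 ht
    obtain ⟨n, hn⟩ := exists_nat_one_div_lt hε
    refine ⟨n, fun q hq => htW (hεt (hq.trans_lt ?_))⟩
    push_cast
    rwa [one_div] at hn
  choose n hn using hε
  have := hJ.fintype
  refine ⟨hJ.toFinset, ∑ i, n i + 1, by omega, fun x hx => ?_⟩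
  obtain ⟨_, ⟨O, hO, rfl⟩, hball⟩ := hUC _ (mem_image_of_mem f hx)
  refine ⟨O, hO, fun y hy hxy => ?_⟩
  by_contra hyO
  have hmem : f y ∈ UniformSpace.ball (f x) (⋂ i, W i) := by
    refine mem_iInter.2 fun i => hn i _ ((hxy i (hJ.mem_toFinset.2 i.2)).trans ?_)
    gcongr
    exact Finset.single_le_sum (f := n) (fun _ _ => Nat.zero_le _) (Finset.mem_univ i)
  exact hball hmem ⟨y, ⟨hy, hyO⟩, rfl⟩

/-- The compact subsets of the realization of a `k`-dimensional complex have covering dimension at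
most `k`. -/
theorem exists_refinement {k : ℕ} (hK : ∀ s ∈ K.faces, s.card ≤ k + 1)
    {C : Set (Realization K)} (hC : IsCompact C)
    {P : Set (Set (Realization K))} (hP : ∀ O ∈ P, IsOpen O) (hCP : C ⊆ ⋃₀ P) :
    ∃ Q : Set (Set (Realization K)), (∀ O ∈ Q, IsOpen O) ∧ C ⊆ ⋃₀ Q ∧
      (∀ O ∈ Q, ∃ O' ∈ P, O ∩ C ⊆ O') ∧
      ∀ (x : Realization K) (s : Finset (Set (Realization K))), (∀ O ∈ s, O ∈ Q ∧ x ∈ O) →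
        s.card ≤ k + 1 := by
  classical
  obtain ⟨F, N, hN, hFN⟩ := exists_finset_lebesgue hC hP hCP
  -- the coordinates in `F`, and the sum of the other ones
  let u : Realization K → Option F → ℝ := fun x a =>
    N * a.elim (1 - ∑ v : F, x.1 v) fun v => x.1 v
  have hx01 : ∀ x : Realization K, (∀ v, 0 ≤ x.1 v) ∧ ∃ s ∈ K.faces, x.1 ∈ closedSimplex s :=
    fun x => by
      obtain ⟨s, hs, hx⟩ := x.2
      exact ⟨hx.1, s, hs, hx⟩
  have hu : ∀ a, Continuous fun x => u x a := by
    have hv : ∀ v : V, Continuous fun x : Realization K => x.1 v := fun v =>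
      (continuous_apply v).comp continuous_coe_realization
    rintro (_ | v)
    · exact continuous_const.mul (continuous_const.sub (continuous_finsetSum _ fun v _ => hv v))
    · exact continuous_const.mul (hv v)
  have hsplit : ∀ (x : Realization K) (s : Finset V), x.1 ∈ closedSimplex s →
      ∑ v : F, x.1 v + ∑ v ∈ s \ F, x.1 v = 1 := by
    intro x s hx
    rw [Finset.sum_coe_sort F (fun v => x.1 v), ← Finset.sum_union Finset.disjoint_sdiff,
      Finset.union_sdiff_self_eq_union, ← hx.2.2]
    exact (Finset.sum_subset Finset.subset_union_right fun v _ hv => hx.2.1 v hv).symm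
  have hle : ∀ x : Realization K, 0 ≤ 1 - ∑ v : F, x.1 v := fun x => by
    obtain ⟨h0, s, hs, hx⟩ := hx01 x
    have := Finset.sum_nonneg fun v (_ : v ∈ s \ F) => h0 v
    linarith [hsplit x s hx]
  have hu0 : ∀ x a, 0 ≤ u x a := by
    rintro x (_ | v)
    · exact mul_nonneg (Nat.cast_nonneg _) (hle x)
    · exact mul_nonneg (Nat.cast_nonneg _) ((hx01 x).1 v)
  have husum : ∀ x, ∑ a, u x a = N := fun x => by
    simp only [u, Fintype.sum_option, Option.elim, ← Finset.mul_sum]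
    ring
  have hsupp : ∀ x, ∃ G : Finset (Option F), G.card ≤ k + 1 ∧ ∀ a ∉ G, u x a = 0 := by
    intro x
    obtain ⟨h0, s, hs, hx⟩ := hx01 x
    -- vertices outside `F` all go to the additional coordinate
    refine ⟨s.image fun v => if h : v ∈ F then some ⟨v, h⟩ else none,
      Finset.card_image_le.trans (hK s hs), ?_⟩
    rintro (_ | v) ha
    · have : s \ F = ∅ := by
        ext v
        simp only [Finset.mem_sdiff, Finset.notMem_empty, iff_false, not_and, not_not]
        intro hv
        by_contra hvF
        exact ha (Finset.mem_image.2 ⟨v, hv, dif_neg hvF⟩)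
      have h1 := hsplit x s hx
      rw [this, Finset.sum_empty] at h1
      simp only [u, Option.elim]
      rw [show 1 - ∑ v : F, x.1 v = 0 by linarith, mul_zero]
    · have : (v : V) ∉ s := fun hv => ha (Finset.mem_image.2 ⟨v, hv, dif_pos v.2⟩)
      simp only [u, Option.elim, hx.2.1 _ this, mul_zero]
  let J : Set (Finset (Option F) × (Option F → ℤ)) :=
    {i | i.1.card ≠ 1 ∧ (gridSet u i ∩ C).Nonempty}
  refine ⟨gridSet u '' J, ?_, ?_, ?_, ?_⟩
  · rintro _ ⟨i, -, rfl⟩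
    exact isOpen_gridSet hu i
  · intro x hx
    obtain ⟨i, h1, h2⟩ := exists_mem_gridSet (husum x)
    exact ⟨_, ⟨i, ⟨h1, x, h2, hx⟩, rfl⟩, h2⟩
  · rintro _ ⟨i, ⟨-, x, hx, hxC⟩, rfl⟩
    obtain ⟨O, hO, hxO⟩ := hFN x hxC
    refine ⟨O, hO, fun y hy => hxO y hy.2 fun a ha => ?_⟩
    have h1 := abs_sub_le_of_mem_gridSet hx hy.1 (some ⟨a, ha⟩)
    simp only [u, Option.elim, ← mul_sub, abs_mul, Nat.abs_cast] at h1
    rw [← one_div, le_div_iff₀' (by exact_mod_cast hN)]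
    exact h1
  · intro x s hs
    have hch : ∀ O ∈ s, ∃ i ∈ J, gridSet u i = O := fun O hO => (hs O hO).1
    choose! φ hφJ hφ using hch
    obtain ⟨G, hG, hG0⟩ := hsupp x
    rw [← Finset.card_image_of_injOn (f := φ) (s := s) fun O hO O' hO' h => by
      rw [← hφ O hO, ← hφ O' hO', h]]
    refine card_gridSet_le (u := u) (x := x) hG hG0 fun i hi => ?_
    obtain ⟨O, hO, rfl⟩ := Finset.mem_image.1 hi
    exact ⟨(hφJ O hO).1, by rw [hφ O hO]; exact (hs O hO).2⟩

end Realization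

/-- If a compact set is mapped with point preimages of diameter at most `b`, then so are, up to any
error, the preimages of small open sets. -/
theorem exists_isOpen_preimage_le {X Y : Type*} [TopologicalSpace X] [TopologicalSpace Y]
    [T2Space Y] {e : X → X → ℝ≥0∞} (he : Continuous fun q : X × X => e q.1 q.2) {g : X → Y}
    (hg : Continuous g) {b b' : ℝ≥0∞} (hbb : b < b') (hgb : ∀ x y, g x = g y → e x y ≤ b)
    {A : Set X} (hA : IsCompact A) (y : Y) :
    ∃ P : Set Y, IsOpen P ∧ y ∈ P ∧ ∀ x ∈ A, ∀ x' ∈ A, g x ∈ P → g x' ∈ P → e x x' ≤ b' := by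
  have hQ : IsCompact ((A ×ˢ A) ∩ {q : X × X | b' ≤ e q.1 q.2}) :=
    (hA.prod hA).inter_right (isClosed_le continuous_const he)
  have hcl := (hQ.image (hg.prodMap hg)).isClosed
  have hmem : (y, y) ∈ (Prod.map g g '' ((A ×ˢ A) ∩ {q : X × X | b' ≤ e q.1 q.2}))ᶜ := by
    rintro ⟨⟨x, x'⟩, ⟨-, h⟩, hxy⟩
    obtain ⟨h1, h2⟩ := Prod.ext_iff.1 hxy
    exact (hbb.trans_le h).not_ge (hgb x x' (h1.trans h2.symm))
  obtain ⟨P, P', hP, hP', hy, hy', hsub⟩ := isOpen_prod_iff.1 hcl.isOpen_compl y y hmem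
  refine ⟨P ∩ P', hP.inter hP', ⟨hy, hy'⟩, fun x hx x' hx' h h' => ?_⟩
  by_contra hlt
  exact hsub (mk_mem_prod h.1 h'.2) ⟨(x, x'), ⟨⟨hx, hx'⟩, (not_le.1 hlt).le⟩, rfl⟩

/-- A space of macroscopic dimension at most `k` has an open cover by sets of bounded diameter
such that every point lies in at most `k + 1` of them. Covers of larger and larger balls,
each refining the preceding one, are merged: in the annulus `i R ≤ r < (i + 1) R` the `i`-th cover
is used, and its members that meet the inner sphere `r = i R` are added to members of the
`(i - 1)`-st cover that contain them. -/
theorem MacroDimLE.exists_cover {X : Type u} [TopologicalSpace X] {e : X → X → ℝ≥0∞} {k : ℕ}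
    (h : MacroDimLE X e k) (he : Continuous fun q : X × X => e q.1 q.2) {r : X → ℝ}
    (hr : Continuous r) (hr0 : ∀ x, 0 < r x) (hrc : ∀ a, IsCompact {x | r x ≤ a})
    (hre : ∀ x y c, 0 ≤ c → e x y ≤ ENNReal.ofReal c → |r x - r y| ≤ c) :
    ∃ (J : Type u) (W : J → Set X), (∀ j, IsOpen (W j)) ∧ (⋃ j, W j) = univ ∧
      (∀ (x : X) (s : Finset J), (∀ j ∈ s, x ∈ W j) → s.card ≤ k + 1) ∧
      ∃ D : ℝ, ∀ j, ∀ x ∈ W j, ∀ y ∈ W j, e x y ≤ ENNReal.ofReal D := by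
  classical
  obtain ⟨V, K, g, b, hK, hgb⟩ := h
  obtain ⟨b', hb', hgb'⟩ : ∃ b' : ℝ, 0 < b' ∧ ∀ (A : Set X), IsCompact A → ∀ y : Realization K,
      ∃ P : Set (Realization K), IsOpen P ∧ y ∈ P ∧
        ∀ x ∈ A, ∀ x' ∈ A, g x ∈ P → g x' ∈ P → e x x' ≤ ENNReal.ofReal b' := by
    refine ⟨max b 0 + 1, by positivity, fun A hA y => exists_isOpen_preimage_le he g.continuous
      ?_ hgb hA y⟩
    rw [ENNReal.ofReal_lt_ofReal_iff (by positivity)]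
    linarith [le_max_left b 0]
  set R : ℝ := 3 * b' with hR
  have hRpos : 0 < R := by positivity
  let A : ℕ → Set X := fun i => {x | r x ≤ (i + 2) * R}
  have hA : ∀ i, IsCompact (A i) := fun i => hrc _
  -- the properties required of the `i`-th cover
  let Good : ℕ → Set (Set (Realization K)) → Prop := fun i Q =>
    (∀ O ∈ Q, IsOpen O) ∧ g '' A i ⊆ ⋃₀ Q ∧
      (∀ O ∈ Q, ∀ x ∈ A i, ∀ x' ∈ A i, g x ∈ O → g x' ∈ O → e x x' ≤ ENNReal.ofReal b') ∧
      ∀ (x : Realization K) (s : Finset (Set (Realization K))), (∀ O ∈ s, O ∈ Q ∧ x ∈ O) →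
        s.card ≤ k + 1
  have hstep : ∀ (i : ℕ) (P : Set (Set (Realization K))), (∀ O ∈ P, IsOpen O) →
      g '' A i ⊆ ⋃₀ P → ∃ Q, Good i Q ∧ ∀ O ∈ Q, ∃ O' ∈ P, O ∩ g '' A i ⊆ O' := by
    intro i P hP hcov
    choose U hU hyU hUe using hgb' (A i) (hA i)
    obtain ⟨Q, hQo, hQc, hQr, hQk⟩ := exists_refinement hK ((hA i).image g.continuous)
      (P := {O | ∃ O' ∈ P, ∃ y, O = O' ∩ U y}) (by
        rintro _ ⟨O', hO', y, rfl⟩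
        exact (hP O' hO').inter (hU y)) (by
        intro y hy
        obtain ⟨O', hO', hyO'⟩ := hcov hy
        exact ⟨_, ⟨O', hO', y, rfl⟩, hyO', hyU y⟩)
    refine ⟨Q, ⟨hQo, hQc, ?_, hQk⟩, ?_⟩
    · intro O hO x hx x' hx' hxO hxO'
      obtain ⟨_, ⟨O', -, y, rfl⟩, hsub⟩ := hQr O hO
      exact hUe y x hx x' hx' (hsub ⟨hxO, x, hx, rfl⟩).2 (hsub ⟨hxO', x', hx', rfl⟩).2
    · intro O hO
      obtain ⟨_, ⟨O', hO', y, rfl⟩, hsub⟩ := hQr O hO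
      exact ⟨O', hO', fun z hz => (hsub hz).1⟩
  -- the members that meet the inner sphere
  let Inner : ℕ → Set (Realization K) → Prop := fun i O => ∃ x, g x ∈ O ∧ r x = i * R
  have hnext : ∀ i Q, Good i Q → ∃ Q', Good (i + 1) Q' ∧
      ∀ O ∈ Q', Inner (i + 1) O → ∃ O' ∈ Q, O ∩ g '' A (i + 1) ⊆ O' := by
    intro i Q hQ
    have hS : IsCompact {x | r x = (i + 1 : ℕ) * R} :=
      (hrc ((i + 1 : ℕ) * R)).of_isClosed_subset (isClosed_eq hr continuous_const)
        fun x hx => le_of_eq hx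
    obtain ⟨Q', hQ', hr'⟩ := hstep (i + 1) (insert (g '' {x | r x = (i + 1 : ℕ) * R})ᶜ Q) (by
        rintro O (rfl | hO)
        · exact (hS.image g.continuous).isClosed.isOpen_compl
        · exact hQ.1 O hO) (by
        rintro _ ⟨x, -, rfl⟩
        by_cases hx : g x ∈ g '' {x | r x = (i + 1 : ℕ) * R}
        · obtain ⟨x', hx', hxx⟩ := hx
          obtain ⟨O, hO, hxO⟩ := hQ.2.1 ⟨x', show r x' ≤ (i + 2) * R by
            rw [show r x' = _ from hx']; push_cast; nlinarith, hxx⟩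
          exact ⟨O, .inr hO, hxO⟩
        · exact ⟨_, .inl rfl, hx⟩)
    refine ⟨Q', hQ', fun O hO hin => ?_⟩
    obtain ⟨O', rfl | hO', hsub⟩ := hr' O hO
    · obtain ⟨x, hx, hxr⟩ := hin
      refine absurd ⟨x, hxr, rfl⟩ (hsub ⟨hx, x, ?_, rfl⟩)
      change r x ≤ ((i + 1 : ℕ) + 2) * R
      rw [hxr]
      nlinarith
    · exact ⟨O', hO', hsub⟩
  obtain ⟨Q₀, hQ₀, -⟩ := hstep 0 {univ} (by simp) (by simp)
  choose! next hnext hnext' using hnext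
  let Q : ℕ → Set (Set (Realization K)) := fun i => Nat.rec Q₀ next i
  have hQ : ∀ i, Good i (Q i) := fun i => by
    induction i with
    | zero => exact hQ₀
    | succ i ih => exact hnext i _ ih
  have hQr : ∀ i, ∀ O ∈ Q (i + 1), Inner (i + 1) O → ∃ O' ∈ Q i, O ∩ g '' A (i + 1) ⊆ O' :=
    fun i => hnext' i _ (hQ i)
  choose! φ hφQ hφ using hQr
  clear_value Q
  have hrnear : ∀ i, ∀ O ∈ Q i, Inner i O → ∀ x ∈ A i, g x ∈ O → |r x - i * R| ≤ b' := by
    rintro i O hO ⟨y, hyO, hy⟩ x hx hxO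
    rw [← hy]
    refine hre x y b' hb'.le ((hQ i).2.2.1 O hO x hx y ?_ hxO hyO)
    change r y ≤ (i + 2) * R
    rw [hy]; nlinarith
  let W : ℕ × Set (Realization K) → Set X := fun j => {x | j.1 * R < r x ∧
    (j.2 ∈ Q j.1 ∧ g x ∈ j.2 ∧ ¬ Inner j.1 j.2 ∧ r x < (j.1 + 1) * R ∨
      ∃ O ∈ Q (j.1 + 1), Inner (j.1 + 1) O ∧ φ j.1 O = j.2 ∧ g x ∈ O ∧ r x < (j.1 + 2) * R)}
  have hWr : ∀ j, ∀ x ∈ W j, j.1 * R < r x ∧ r x < (j.1 + 2) * R := by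
    rintro j x ⟨h1, ⟨-, -, -, h2⟩ | ⟨O, -, -, -, -, h2⟩⟩
    · exact ⟨h1, by linarith⟩
    · exact ⟨h1, h2⟩
  have hWQ : ∀ j, ∀ x ∈ W j, j.2 ∈ Q j.1 ∧ g x ∈ j.2 := by
    rintro ⟨i, P⟩ x ⟨h1, ⟨h2, h3, -, -⟩ | ⟨O, hO, hin, hφO, hgx, h2⟩⟩
    · exact ⟨h2, h3⟩
    · obtain rfl : φ i O = P := hφO
      refine ⟨hφQ i O hO hin, hφ i O hO hin ⟨hgx, x, ?_, rfl⟩⟩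
      change r x ≤ ((i + 1 : ℕ) + 2) * R
      push_cast
      simp only at h2
      linarith
  have hlevel : ∀ x, ∃ i : ℕ, i * R ≤ r x ∧ r x < (i + 1) * R := fun x =>
    ⟨⌊r x / R⌋₊, by
      rw [← le_div_iff₀ hRpos]; exact Nat.floor_le (div_nonneg (hr0 x).le hRpos.le), by
      rw [← div_lt_iff₀ hRpos]; exact Nat.lt_floor_add_one _⟩
  refine ⟨ℕ × Set (Realization K), W, ?_, ?_, ?_, b', ?_⟩
  · rintro ⟨i, P⟩
    rw [isOpen_iff_mem_nhds]
    rintro x ⟨h1, ⟨h2, h3, h4, h5⟩ | ⟨O, hO, hin, hφO, hgx, h2⟩⟩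
    · filter_upwards [hr.continuousAt.eventually (isOpen_Ioi.mem_nhds h1),
        hr.continuousAt.eventually (isOpen_Iio.mem_nhds h5),
        g.continuous.continuousAt.eventually (((hQ i).1 P h2).mem_nhds h3)] with x' h1' h5' h3'
      exact ⟨h1', .inl ⟨h2, h3', h4, h5'⟩⟩
    · filter_upwards [hr.continuousAt.eventually (isOpen_Ioi.mem_nhds h1),
        hr.continuousAt.eventually (isOpen_Iio.mem_nhds h2),
        g.continuous.continuousAt.eventually (((hQ (i + 1)).1 O hO).mem_nhds hgx)]
        with x' h1' h2' h3'
      exact ⟨h1', .inr ⟨O, hO, hin, hφO, h3', h2'⟩⟩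
  · refine eq_univ_of_forall fun x => ?_
    obtain ⟨i, hi, hi'⟩ := hlevel x
    obtain ⟨O, hO, hxO⟩ := (hQ i).2.1 ⟨x, show r x ≤ (i + 2) * R by linarith, rfl⟩
    by_cases hin : Inner i O
    · cases i with
      | zero =>
        obtain ⟨y, -, hy⟩ := hin
        have := hr0 y
        rw [hy] at this
        simp at this
      | succ i =>
        refine mem_iUnion.2 ⟨(i, φ i O), ?_, .inr ⟨O, hO, hin, rfl, hxO, ?_⟩⟩
        · push_cast at hi
          change i * R < r x
          linarith
        · push_cast at hi'
          change r x < (i + 2) * R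
          linarith
    · refine mem_iUnion.2 ⟨(i, O), lt_of_le_of_ne hi fun h => hin ⟨x, hxO, h.symm⟩,
        .inl ⟨hO, hxO, hin, hi'⟩⟩
  · intro x s hs
    obtain ⟨i, hi, hi'⟩ := hlevel x
    -- every set of the cover that contains `x` comes from a member of `Q i`
    have hch : ∀ j ∈ s, ∃ O ∈ Q i, g x ∈ O ∧ (Inner i O → j.1 + 1 = i ∧ φ j.1 O = j.2) ∧
        (¬ Inner i O → j = (i, O)) := by
      rintro ⟨l, P⟩ hj
      have hxW := hs _ hj
      have h1 := hWr _ x hxW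
      simp only at h1
      have h2 : (l : ℝ) < i + 1 := lt_of_mul_lt_mul_right (h1.1.trans hi') hRpos.le
      have h3 : (i : ℝ) < l + 2 := lt_of_mul_lt_mul_right (hi.trans_lt h1.2) hRpos.le
      norm_cast at h2 h3
      obtain rfl | rfl : l = i ∨ i = l + 1 := by omega
      · have hPQ := hWQ _ x hxW
        refine ⟨P, hPQ.1, hPQ.2, fun hin => ?_, fun _ => rfl⟩
        exfalso
        obtain ⟨-, ⟨-, -, h, -⟩ | ⟨O, hO, hinO, -, hxO, -⟩⟩ := hxW
        · exact h hin
        · have h4 := abs_le.1 (hrnear l P hPQ.1 hin x (show r x ≤ (l + 2) * R by linarith) hPQ.2)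
          have h5 := abs_le.1 (hrnear (l + 1) O hO hinO x
            (show r x ≤ ((l + 1 : ℕ) + 2) * R by push_cast; linarith) hxO)
          push_cast at h5
          linarith [h4.2, h5.1]
      · obtain ⟨-, ⟨-, -, -, h⟩ | ⟨O, hO, hinO, hφO, hxO, -⟩⟩ := hxW
        · push_cast at hi
          simp only at h
          linarith
        · exact ⟨O, hO, hxO, fun _ => ⟨rfl, hφO⟩, fun h => absurd hinO h⟩
    choose! ψ hψQ hψx hψ₁ hψ₂ using hch
    rw [← Finset.card_image_of_injOn (f := ψ) (s := s) fun j hj j' hj' h => by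
      by_cases hin : Inner i (ψ j)
      · have h1 := hψ₁ j hj hin
        have h2 := hψ₁ j' hj' (h ▸ hin)
        have h3 : j.1 = j'.1 := by omega
        exact Prod.ext h3 (by rw [← h1.2, ← h2.2, h3, h])
      · rw [hψ₂ j hj hin, hψ₂ j' hj' (h ▸ hin), h]]
    refine (hQ i).2.2.2 (g x) _ fun O hO => ?_
    obtain ⟨j, hj, rfl⟩ := Finset.mem_image.1 hO
    exact ⟨hψQ j hj, hψx j hj⟩
  · intro j x hx y hy
    have h1 := hWr j x hx
    have h2 := hWr j y hy
    exact (hQ j.1).2.2.1 j.2 (hWQ j x hx).1 x h1.2.le y h2.2.le (hWQ j x hx).2 (hWQ j y hy).2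

/-! ### The nerve of a cover -/

/-- Gluing along the pieces on which only finitely many given functions are nonzero. -/
theorem continuous_of_locallyFinite_support {Z J Y : Type*} [TopologicalSpace Z]
    [TopologicalSpace Y] {a : J → Z → ℝ} (ha : ∀ j, Continuous (a j))
    (hf : LocallyFinite fun j => Function.support (a j)) {g : Z → Y}
    (hg : ∀ s : Finset J, (∃ z, ∀ j, j ∈ s ↔ a j z ≠ 0) →
      ContinuousOn g {z | ∀ j ∉ s, a j z = 0}) : Continuous g := by
  classical
  have hfin : ∀ z, {j | a j z ≠ 0}.Finite := fun z => hf.point_finite z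
  refine LocallyFinite.continuous
    (f := fun s : Finset J => closure {z | ∀ j, j ∈ s ↔ a j z ≠ 0}) ?_ ?_
    (fun _ => isClosed_closure) ?_
  · refine LocallyFinite.closure fun z => ?_
    obtain ⟨N, hN, hNf⟩ := hf z
    refine ⟨N, hN, hNf.toFinset.powerset.finite_toSet.subset ?_⟩
    rintro s ⟨y, hy, hyN⟩
    rw [SetLike.mem_coe, Finset.mem_powerset]
    exact fun j hj => hNf.mem_toFinset.2 ⟨y, (hy j).1 hj, hyN⟩
  · exact eq_univ_of_forall fun z => mem_iUnion.2 ⟨(hfin z).toFinset, subset_closure fun j => by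
      rw [Set.Finite.mem_toFinset]; rfl⟩
  · intro s
    rcases eq_empty_or_nonempty {z | ∀ j, j ∈ s ↔ a j z ≠ 0} with h | h
    · rw [h, closure_empty]; exact continuousOn_empty _
    · refine (hg s h).mono (closure_minimal (fun z hz j hj => ?_) ?_)
      · exact not_not.1 fun h => hj ((hz j).2 h)
      · have : {z | ∀ j ∉ s, a j z = 0} = ⋂ (j) (_ : j ∉ s), {z | a j z = 0} := by ext; simp
        rw [this]
        exact isClosed_biInter fun j _ => isClosed_eq (ha j) continuous_const

/-- The canonical map to the nerve of an open cover bounds the macroscopic dimension. -/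
theorem macroDimLE_of_cover {X : Type u} [TopologicalSpace X] [NormalSpace X] [ParacompactSpace X]
    {e : X → X → ℝ≥0∞} {k : ℕ} (U : Set (Set X)) (hUo : ∀ W ∈ U, IsOpen W) (hU : ⋃₀ U = univ)
    (hk : ∀ (x : X) (s : Finset (Set X)), (∀ W ∈ s, W ∈ U ∧ x ∈ W) → s.card ≤ k + 1) {D : ℝ}
    (hD : ∀ W ∈ U, ∀ x ∈ W, ∀ y ∈ W, e x y ≤ ENNReal.ofReal D) : MacroDimLE X e k := by
  classical
  obtain ⟨φ, hφ⟩ := PartitionOfUnity.exists_isSubordinate isClosed_univ (fun W : U => W.1)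
    (fun W => hUo W W.2) (by rw [← sUnion_eq_iUnion, hU])
  have hφU : ∀ W x, φ W x ≠ 0 → x ∈ W.1 := fun W x h => hφ W (subset_tsupport _ h)
  have hfin : ∀ x, (Function.support fun W => φ W x).Finite := fun x =>
    φ.locallyFinite.point_finite x
  let S : X → Finset U := fun x => (hfin x).toFinset
  have hS : ∀ x W, W ∈ S x ↔ φ W x ≠ 0 := fun x W => by simp [S]
  have hsum : ∀ x, ∑ W ∈ S x, φ W x = 1 := fun x => by
    rw [← φ.sum_eq_one (mem_univ x), finsum_eq_sum_of_support_subset _ (s := S x) (by simp [S])]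
  have hcard : ∀ x, (S x).card ≤ k + 1 := fun x => by
    rw [← Finset.card_map ⟨Subtype.val, Subtype.val_injective⟩]
    refine hk x _ fun W hW => ?_
    obtain ⟨W', hW', rfl⟩ := Finset.mem_map.1 hW
    exact ⟨W'.2, hφU _ _ ((hS x W').1 hW')⟩
  have hne : ∀ x, (S x).Nonempty := fun x => by
    rw [Finset.nonempty_iff_ne_empty]
    intro h
    have := hsum x
    simp [h] at this
  let K : PreAbstractSimplicialComplex U :=
    { faces := {s | s.Nonempty ∧ s.card ≤ k + 1}
      isRelLowerSet_faces := fun s hs =>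
        ⟨hs.1, fun t hts ht => ⟨ht, (Finset.card_le_card hts).trans hs.2⟩⟩ }
  have hmem : ∀ x s, (∀ W, W ∉ s → φ W x = 0) → (fun W => φ W x) ∈ closedSimplex s :=
    fun x s h => ⟨fun W => φ.nonneg W x, h, by
      rw [← hsum x]
      refine (Finset.sum_subset (fun W hW => ?_) fun W _ hW => ?_).symm
      · exact by_contra fun hWs => (hS x W).1 hW (h W hWs)
      · exact not_not.1 fun h => hW ((hS x W).2 h)⟩
  have hSz : ∀ x W, W ∉ S x → φ W x = 0 := fun x W hW => not_not.1 fun h => hW ((hS x W).2 h)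
  let g : X → Realization K := fun x =>
    ⟨fun W => φ W x, S x, ⟨hne x, hcard x⟩, hmem x _ (hSz x)⟩
  have hg : Continuous g := by
    refine continuous_of_locallyFinite_support (fun W => (φ W).continuous) φ.locallyFinite ?_
    rintro s ⟨x, hx⟩
    have hs : s ∈ K.faces := by
      rw [show s = S x by ext W; rw [hS, hx]]
      exact ⟨hne x, hcard x⟩
    rw [continuousOn_iff_continuous_domRestrict]
    have h1 : Continuous fun x : {x | ∀ W ∉ s, φ W x = 0} =>
        (⟨fun W => φ W x, hmem x _ x.2⟩ : closedSimplex s) :=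
      (continuous_pi fun W => (φ W).continuous.comp continuous_subtype_val).subtype_mk _
    have h2 : Continuous (simplexInclusion K ⟨s, hs⟩) :=
      continuous_iSup_rng (continuous_coinduced_rng)
    exact h2.comp h1
  refine ⟨U, K, ⟨g, hg⟩, D, fun s hs => hs.2, fun x y hxy => ?_⟩
  obtain ⟨W, hW⟩ := hne x
  have hWx := (hS x W).1 hW
  have hWy : φ W y ≠ 0 := by
    rwa [← show φ W x = φ W y from congrFun (congrArg Subtype.val hxy) W]
  exact hD W W.2 x (hφU _ _ hWx) y (hφU _ _ hWy)

/-! ### Properness of the lift of a classifying map -/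

section Classifying

variable {M B X E : Type*} [TopologicalSpace X] [TopologicalSpace E] {pM : X → M} {p : E → B}

/-- If `f` is injective on fundamental groups, then a point of the universal covering space is
determined by its projection and its image under a lift of `f`. -/
theorem eq_of_lift_eq [TopologicalSpace M] [TopologicalSpace B] [PathConnectedSpace X]
    [SimplyConnectedSpace E] (hpM : IsCoveringMap pM) (hp : IsCoveringMap p) {f : C(M, B)}
    (hf : ∀ m, Function.Injective (FundamentalGroup.map f m)) {f' : C(X, E)}
    (hf' : ∀ x, p (f' x) = f (pM x)) {x x' : X} (h : pM x = pM x') (h' : f' x = f' x') :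
    x = x' := by
  obtain ⟨γ⟩ := PathConnectedSpace.joined x x'
  let α : Path (pM x) (pM x) := (γ.map hpM.continuous).cast rfl h
  have h1 : Path.Homotopic (α.map f.continuous) ((Path.refl (pM x)).map f.continuous) := by
    obtain ⟨F⟩ := SimplyConnectedSpace.paths_homotopic (γ.map f'.continuous)
      ((Path.refl (f' x)).cast rfl h'.symm)
    refine ⟨(F.compContinuousMap ⟨p, hp.continuous⟩).cast ?_ ?_⟩
    · ext t; exact hf' _
    · ext t; exact hf' _
  have h2 : FundamentalGroup.map f (pM x) (Path.Homotopic.Quotient.mk α) =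
      FundamentalGroup.map f (pM x) (Path.Homotopic.Quotient.mk (Path.refl _)) :=
    Quotient.sound h1
  have h3 : Path.Homotopic α (Path.refl (pM x)) := Quotient.exact (hf _ h2)
  have h4 := hpM.liftPath_apply_one_eq_of_homotopicRel h3 x (by simp) (by simp)
  have h5 : γ.toContinuousMap = hpM.liftPath α.toContinuousMap x (by simp) :=
    (hpM.eq_liftPath_iff' _).2 ⟨by ext t; rfl, by simp⟩
  have h6 : .const I x = hpM.liftPath (Path.refl (pM x)).toContinuousMap x (by simp) :=
    (hpM.eq_liftPath_iff' _).2 ⟨by ext t; rfl, by simp⟩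
  rw [← h5, ← h6] at h4
  simpa using h4.symm

theorem IsGeodesicSpace.isPreconnected_ball {M : Type*} [MetricSpace M] (hM : IsGeodesicSpace M)
    (x : M) (r : ℝ) : IsPreconnected (Metric.ball x r) := by
  refine isPreconnected_of_forall x fun y hy => ?_
  obtain ⟨γ, hγ, -⟩ := hM.exists_path x y
  refine ⟨range γ, ?_, ⟨0, by simp⟩, ⟨1, by simp⟩, isPreconnected_range γ.continuous⟩
  rintro _ ⟨t, rfl⟩
  exact Metric.mem_ball'.2 ((hγ t).trans_lt (Metric.mem_ball'.1 hy))

variable [MetricSpace M] [CompactSpace M] [MetricSpace B] (hM : IsGeodesicSpace M)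
  (hpM : IsCoveringMap pM) (hp : IsCoveringMap p) {f : C(M, B)} {f' : C(X, E)}
  (hf' : ∀ x, p (f' x) = f (pM x))

include hM hpM in
/-- The covering space of a compact space has a compact fundamental set. -/
theorem exists_isCompact_image_eq_univ [PathConnectedSpace X] :
    ∃ D : Set X, IsCompact D ∧ ∀ m, ∃ x ∈ D, pM x = m := by
  obtain ⟨x₀⟩ := (inferInstance : Nonempty X)
  obtain ⟨D, hD, hDr⟩ := exists_isCompact_liftEDist_le hpM hM (isCompact_singleton (x := x₀))
    (Metric.diam (univ : Set M))
  refine ⟨D, hD, fun m => ?_⟩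
  obtain ⟨γ, -, hγ⟩ := hM.exists_path (pM x₀) m
  obtain ⟨Γ, hΓ, hΓ0⟩ := hpM.exists_path_lifts γ.toContinuousMap x₀ (by simp)
  refine ⟨Γ 1, hDr x₀ rfl _ ?_, by simpa using congrFun hΓ 1⟩
  refine (iInf_le _ (⟨Γ, hΓ0, rfl⟩ : Path x₀ (Γ 1))).trans ?_
  have h1 : (fun t => pM ((⟨Γ, hΓ0, rfl⟩ : Path x₀ (Γ 1)) t)) = γ := hΓ
  rw [h1, edist_dist] at *
  refine hγ.trans (ENNReal.ofReal_le_ofReal ?_)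
  exact Metric.dist_le_diam_of_mem isCompact_univ.isBounded (mem_univ _) (mem_univ _)

include hM hpM hp hf' in
/-- The lift of a classifying map of a compact space is proper. -/
theorem isCompact_preimage_of_lift [SimplyConnectedSpace X] [SimplyConnectedSpace E] [T2Space E]
    (hf : ∀ m, Function.Injective (FundamentalGroup.map f m)) {C : Set E} (hC : IsCompact C) :
    IsCompact (f' ⁻¹' C) := by
  have := hM.locallyPathConnectedSpace
  have := locallyPathConnectedSpace_of_isLocalHomeomorph hpM.isLocalHomeomorph
  rw [isCompact_iff_ultrafilter_le_nhds]
  intro 𝓕 h𝓕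
  obtain ⟨y, hyC, hy⟩ := isCompact_iff_ultrafilter_le_nhds.1 hC (𝓕.map f')
    (Filter.le_principal_iff.2 (Filter.mem_map.2 (Filter.le_principal_iff.1 h𝓕)))
  obtain ⟨m, -, hm⟩ := isCompact_iff_ultrafilter_le_nhds.1 (isCompact_univ (X := M)) (𝓕.map pM)
    (by simp)
  have hy' : Filter.Tendsto f' 𝓕 (𝓝 y) := hy
  have hm' : Filter.Tendsto pM 𝓕 (𝓝 m) := hm
  obtain ⟨D, -, hDM⟩ := exists_isCompact_image_eq_univ hM hpM
  obtain ⟨xm, -, hxm⟩ := hDM m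
  obtain ⟨δ, hδ, hsec⟩ := exists_uniform_section hp (isCompact_singleton (x := p y))
  obtain ⟨s, hs, hsy, hps⟩ := hsec y rfl
  obtain ⟨δ', hδ', hsec'⟩ := exists_uniform_section hpM (isCompact_singleton (x := m))
  obtain ⟨s', hs', hsy', hps'⟩ := hsec' xm hxm
  rw [hxm] at hs' hps'
  have hfm : f m = p y := by
    refine tendsto_nhds_unique ((f.continuous.tendsto m).comp hm') ?_
    refine ((hp.continuous.tendsto y).comp hy').congr fun x => hf' x
  obtain ⟨η, hη, hηf⟩ := Metric.mem_nhds_iff.1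
    (f.continuous.continuousAt (x := m) (Metric.ball_mem_nhds _ hδ))
  rw [hfm] at hηf
  set r := min η δ'
  have hr : 0 < r := lt_min hη hδ'
  have hrs : Metric.ball m r ⊆ Metric.ball m δ' := Metric.ball_subset_ball (min_le_right _ _)
  have hrf : ∀ z ∈ Metric.ball m r, f z ∈ Metric.ball (p y) δ := fun z hz =>
    hηf (Metric.ball_subset_ball (min_le_left _ _) hz)
  have hgood : ∀ᶠ x in (𝓕 : Filter X), pM x ∈ Metric.ball m r ∧ s (f (pM x)) = f' x := by
    filter_upwards [hm'.eventually (Metric.ball_mem_nhds m hr),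
      hy'.eventually (eventually_eq_section hp hδ hs hsy hps)] with x hx hx'
    exact ⟨hx, by rw [← hf', hx']⟩
  -- near `m`, the lifts of `f` through `s` and through the sections of `pM` agree
  have hsheet : ∀ x, pM x ∈ Metric.ball m r → s (f (pM x)) = f' x →
      ∃ t : M → X, ContinuousOn t (Metric.ball m r) ∧ t (pM x) = x ∧
        ∀ z ∈ Metric.ball m r, pM (t z) = z ∧ f' (t z) = s (f z) := by
    intro x hx hsx
    obtain ⟨τ, hτ, hτx⟩ := exists_deck hpM (x := s' (pM x)) (y := x) (hps' _ (hrs hx))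
    have ht : ContinuousOn (fun z => τ (s' z)) (Metric.ball m r) :=
      τ.continuous.comp_continuousOn (hs'.mono hrs)
    have hpt : ∀ z ∈ Metric.ball m r, pM (τ (s' z)) = z := fun z hz => by rw [hτ, hps' z (hrs hz)]
    refine ⟨fun z => τ (s' z), ht, hτx, fun z hz => ⟨hpt z hz, ?_⟩⟩
    refine hp.eqOn_of_comp_eqOn (hM.isPreconnected_ball m r) (f'.continuous.comp_continuousOn ht)
      (hs.comp f.continuous.continuousOn hrf) (fun z hz => ?_) hx ?_ hz
    · change p (f' (τ (s' z))) = p (s (f z))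
      rw [hf', hpt z hz, hps _ (hrf z hz)]
    · change f' (τ (s' (pM x))) = s (f (pM x))
      rw [hτx, hsx]
  obtain ⟨x₀, hx₀, hsx₀⟩ := hgood.exists
  obtain ⟨t, ht, -, hpt⟩ := hsheet x₀ hx₀ hsx₀
  have heq : ∀ᶠ x in (𝓕 : Filter X), t (pM x) = x := by
    filter_upwards [hgood] with x hx
    exact eq_of_lift_eq hpM hp hf hf' (hpt _ hx.1).1 ((hpt _ hx.1).2.trans hx.2)
  have hlim : Filter.Tendsto id (𝓕 : Filter X) (𝓝 (t m)) :=
    (((ht.continuousAt (Metric.ball_mem_nhds m hr)).tendsto.comp hm').congr' heq)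
  refine ⟨t m, ?_, hlim⟩
  have : f' (t m) = y := tendsto_nhds_unique ((f'.continuous.tendsto _).comp hlim) hy'
  rwa [mem_preimage, this]

include hM hpM hp hf' in
/-- Coarse injectivity of the lift of a classifying map. -/
theorem exists_liftEDist_le_of_lift [SimplyConnectedSpace X] [SimplyConnectedSpace E]
    [ProperSpace B] (hB : IsGeodesicSpace B)
    (hf : ∀ m, Function.Injective (FundamentalGroup.map f m)) (r : ℝ) :
    ∃ b : ℝ, ∀ x y, liftEDist p (f' x) (f' y) ≤ ENNReal.ofReal r →
      liftEDist pM x y ≤ ENNReal.ofReal b := by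
  have := hM.locallyPathConnectedSpace
  have := locallyPathConnectedSpace_of_isLocalHomeomorph hpM.isLocalHomeomorph
  have := hB.locallyPathConnectedSpace
  have := locallyPathConnectedSpace_of_isLocalHomeomorph hp.isLocalHomeomorph
  have := t2Space_of_isCoveringMap hp
  obtain ⟨D, hD, hDM⟩ := exists_isCompact_image_eq_univ hM hpM
  obtain ⟨C, hC, hCr⟩ := exists_isCompact_liftEDist_le hp hB (hD.image f'.continuous) r
  obtain ⟨b, hb⟩ := exists_liftEDist_le hpM hM hD (isCompact_preimage_of_lift hM hpM hp hf' hf hC)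
  refine ⟨b, fun x y hxy => ?_⟩
  obtain ⟨x', hx', hxx⟩ := hDM (pM x)
  obtain ⟨τ, hτ, hτx⟩ := exists_deck hpM hxx.symm
  obtain ⟨θ, hθ, hθf⟩ := exists_deck_comp_eq (p := p) (f := f) hp f' hf' hτ
  rw [← liftEDist_deck pM hτ, hτx]
  refine hb x' hx' _ (hCr (f' x') ⟨x', hx', rfl⟩ _ ?_)
  rwa [← hτx, hθf, hθf, liftEDist_deck p hθ]

end Classifying

/-! ### Neighbourhoods of cells -/

namespace CellStructure

variable {E : Type*} [EMetricSpace E] (K : CellStructure E)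

/-- The points that are closer to the open cell `c` than to the other cells of at most the same
dimension, and at distance less than `1` from it. -/
def cellNhd (c : K.ι) : Set E :=
  {y | Metric.infEDist y (K.openCell c) <
    Metric.infEDist y (K.skel (K.dim c + 1) \ K.openCell c)} ∩
  {y | Metric.infEDist y (K.openCell c) < 1}

theorem isOpen_cellNhd (c : K.ι) : IsOpen (K.cellNhd c) :=
  (isOpen_lt Metric.continuous_infEDist Metric.continuous_infEDist).inter
    (isOpen_lt Metric.continuous_infEDist continuous_const)

theorem openCell_subset_cellNhd (c : K.ι) : K.openCell c ⊆ K.cellNhd c := by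
  intro y hy
  have h0 : Metric.infEDist y (K.openCell c) = 0 := Metric.infEDist_zero_of_mem hy
  have heq : K.skel (K.dim c + 1) \ K.openCell c =
      ⋃ c' ∈ {c' | K.dim c' < K.dim c + 1 ∧ c' ≠ c}, K.closedCell c' := by
    ext z
    simp only [mem_iUnion, exists_prop]
    constructor
    · rintro ⟨⟨c', hc', hz⟩, hzc⟩
      exact ⟨c', ⟨hc', by rintro rfl; exact hzc hz⟩, K.openCell_subset_closedCell c' hz⟩
    · rintro ⟨c', ⟨hc', hne⟩, hz⟩
      refine ⟨K.closedCell_subset_skel hc' hz, fun hzc => ?_⟩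
      rcases K.mem_closedCell hz with h | h
      · exact hne (K.eq_of_mem_openCell h hzc)
      · have := (K.mem_skel_iff_of_mem_openCell hzc).1 h
        omega
  have hcl : IsClosed (K.skel (K.dim c + 1) \ K.openCell c) := by
    rw [heq]; exact K.isClosed_biUnion_closedCell _
  refine ⟨?_, ?_⟩
  · rw [mem_ofPred_eq, h0]
    refine pos_iff_ne_zero.2 fun h => ?_
    exact ((Metric.mem_iff_infEDist_zero_of_closed hcl).2 h).2 hy
  · rw [mem_ofPred_eq, h0]
    exact one_pos

theorem eq_of_mem_cellNhd {c c' : K.ι} (h : K.dim c = K.dim c') {y : E} (hy : y ∈ K.cellNhd c)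
    (hy' : y ∈ K.cellNhd c') : c = c' := by
  by_contra hne
  have key : ∀ {c c' : K.ι}, K.dim c = K.dim c' → c ≠ c' →
      K.openCell c' ⊆ K.skel (K.dim c + 1) \ K.openCell c := fun {c c'} h hne z hz =>
    ⟨⟨c', by omega, hz⟩, fun hzc => hne (K.eq_of_mem_openCell hzc hz)⟩
  have h1 := hy.1.trans_le (Metric.infEDist_anti (key h hne))
  have h2 := hy'.1.trans_le (Metric.infEDist_anti (key h.symm (Ne.symm hne)))
  exact lt_asymm h1 h2

end CellStructure

/-- Deck transformations permute the cells of the covering space. -/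
theorem CellStructure.exists_openCell_deck {B E : Type*} [TopologicalSpace B] [T2Space B]
    [TopologicalSpace E] (K : CellStructure B) {p : E → B} (hp : IsCoveringMap p) {θ : E ≃ₜ E}
    (hθ : ∀ z, p (θ z) = p z) (c : (K.lift hp).ι) :
    ∃ c', MapsTo θ ((K.lift hp).openCell c) ((K.lift hp).openCell c') := by
  obtain ⟨c, F, hF⟩ := c
  refine ⟨⟨c, (θ : C(E, E)).comp F, ?_⟩, ?_⟩
  · rw [← hF]; ext z; exact hθ _
  · rintro _ ⟨z, hz, rfl⟩
    exact ⟨z, hz, rfl⟩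

/-- If the lift of a classifying map is moved a bounded distance into the union of the cells of
dimension less than `n`, then the neighbourhoods of the cells provide a cover of order `n`. -/
theorem macroDim_lt_of_bounded {M B : Type*} {X : Type u} {E : Type*} [TopologicalSpace X]
    [TopologicalSpace E] {pM : X → M} {p : E → B} [MetricSpace M] [CompactSpace M] [MetricSpace B]
    [ProperSpace B] [SimplyConnectedSpace X] [SimplyConnectedSpace E] (hM : IsGeodesicSpace M)
    (hB : IsGeodesicSpace B) (hpM : IsCoveringMap pM) (hp : IsCoveringMap p) {f : C(M, B)}
    {f' : C(X, E)} (hf' : ∀ x, p (f' x) = f (pM x))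
    (hf : ∀ m, Function.Injective (FundamentalGroup.map f m)) (K : CellStructure B) {n : ℕ}
    {h : C(X, E)} (hn : ∀ x, h x ∈ (K.lift hp).skel n) {b : ℝ}
    (hb : ∀ x, liftEDist p (f' x) (h x) ≤ ENNReal.ofReal b) :
    macroDim X (liftEDist pM) < n := by
  classical
  have := hM.locallyPathConnectedSpace
  have := locallyPathConnectedSpace_of_isLocalHomeomorph hpM.isLocalHomeomorph
  have := hB.locallyPathConnectedSpace
  have := locallyPathConnectedSpace_of_isLocalHomeomorph hp.isLocalHomeomorph
  let mE : EMetricSpace E := liftEMetricSpace hp hB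
  let mX : EMetricSpace X := liftEMetricSpace hpM hM
  set K' := K.lift hp
  obtain ⟨x₀⟩ := (inferInstance : Nonempty X)
  cases n with
  | zero =>
    obtain ⟨c, hc, -⟩ := hn x₀
    omega
  | succ k =>
  obtain ⟨D, hD, hDM⟩ := exists_isCompact_image_eq_univ hM hpM
  obtain ⟨C, hC, hCb⟩ := exists_isCompact_liftEDist_le hp hB (hD.image f'.continuous) b
  obtain ⟨C₁, hC₁, hC₁b⟩ := exists_isCompact_liftEDist_le hp hB hC 1
  have hC₂ : IsCompact (⋃ c ∈ {c | (K'.closedCell c ∩ C₁).Nonempty}, K'.closedCell c) :=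
    (K'.finite_inter_nonempty hC₁).isCompact_biUnion fun c _ => K'.isCompact_closedCell c
  obtain ⟨d, hd⟩ := exists_liftEDist_le hp hB hC₂ hC₂
  -- the cells near the image of `h` are translates of the finitely many cells that meet `C₁`
  have hdiam : ∀ c x x', h x ∈ K'.cellNhd c → h x' ∈ K'.cellNhd c →
      edist (h x) (h x') ≤ 1 + ENNReal.ofReal d + 1 := by
    intro c x x' hx hx'
    obtain ⟨z, hz, hxz⟩ := Metric.infEDist_lt_iff.1 hx.2
    obtain ⟨z', hz', hxz'⟩ := Metric.infEDist_lt_iff.1 hx'.2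
    obtain ⟨w, hwD, hw⟩ := hDM (pM x)
    obtain ⟨τ, hτ, hτx⟩ := exists_deck hpM hw.symm
    obtain ⟨θ, hθ, hθf⟩ := exists_deck_comp_eq (p := p) (f := f) hp f' hf' hτ
    have h1 : θ (h x) ∈ C := by
      refine hCb (f' w) ⟨w, hwD, rfl⟩ _ ?_
      rw [← hτx, hθf, liftEDist_deck p hθ]
      exact hb x
    have h2 : θ z ∈ C₁ := by
      refine hC₁b _ h1 _ ?_
      rw [liftEDist_deck p hθ, ENNReal.ofReal_one]
      exact hxz.le
    obtain ⟨c', hc'⟩ := K.exists_openCell_deck hp hθ c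
    have h3 : ∀ z ∈ K'.openCell c, θ z ∈ ⋃ c ∈ {c | (K'.closedCell c ∩ C₁).Nonempty},
        K'.closedCell c := fun z₁ hz₁ =>
      mem_biUnion (show c' ∈ {c | (K'.closedCell c ∩ C₁).Nonempty} from
        ⟨θ z, K'.openCell_subset_closedCell _ (hc' hz), h2⟩)
        (K'.openCell_subset_closedCell _ (hc' hz₁))
    have h4 := hd _ (h3 z hz) _ (h3 z' hz')
    rw [liftEDist_deck p hθ] at h4
    calc edist (h x) (h x') ≤ edist (h x) z + edist z z' + edist z' (h x') :=
      edist_triangle4 _ _ _ _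
      _ ≤ _ := add_le_add (add_le_add hxz.le h4) (by rw [edist_comm]; exact hxz'.le)
  obtain ⟨b', hb'⟩ := exists_liftEDist_le_of_lift hM hpM hp hf' hB hf
    (ENNReal.ofReal b + (1 + ENNReal.ofReal d + 1) + ENNReal.ofReal b).toReal
  have hk : MacroDimLE X (liftEDist pM) k := by
    refine macroDimLE_of_cover ((fun c => h ⁻¹' K'.cellNhd c) '' {c | K'.dim c < k + 1}) ?_ ?_ ?_
      (D := b') ?_
    · rintro _ ⟨c, -, rfl⟩
      exact (K'.isOpen_cellNhd c).preimage h.continuous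
    · refine eq_univ_of_forall fun x => ?_
      obtain ⟨c, hc, hx⟩ := hn x
      exact ⟨_, ⟨c, hc, rfl⟩, K'.openCell_subset_cellNhd c hx⟩
    · intro x s hs
      have hch : ∀ W ∈ s, ∃ c, K'.dim c < k + 1 ∧ h ⁻¹' K'.cellNhd c = W := fun W hW => (hs W hW).1
      have : Nonempty K'.ι := ⟨(K'.exists_mem_openCell (h x)).choose⟩
      choose! φ hφ hφW using hch
      rw [← Finset.card_range (k + 1)]
      refine Finset.card_le_card_of_injOn (fun W => K'.dim (φ W))
        (fun W hW => by simpa using hφ W hW) fun W hW W' hW' hdim => ?_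
      have h1 : h x ∈ K'.cellNhd (φ W) := by
        have := (hs W hW).2
        rwa [← hφW W hW] at this
      have h2 : h x ∈ K'.cellNhd (φ W') := by
        have := (hs W' hW').2
        rwa [← hφW W' hW'] at this
      rw [← hφW W hW, ← hφW W' hW', K'.eq_of_mem_cellNhd hdim h1 h2]
    · rintro _ ⟨c, -, rfl⟩ x hx x' hx'
      refine hb' x x' ?_
      rw [ENNReal.ofReal_toReal (by finiteness)]
      calc edist (f' x) (f' x') ≤ edist (f' x) (h x) + edist (h x) (h x') + edist (h x') (f' x') :=
            edist_triangle4 _ _ _ _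
        _ ≤ _ := add_le_add (add_le_add (hb x) (hdiam c x x' hx hx'))
            (by rw [edist_comm]; exact hb x')
  exact (iInf₂_le k hk).trans_lt (by exact_mod_cast Nat.lt_succ_self k)

/-! ### Uniform control by deck transformations -/

/-- The points that are mapped into `L` by a deck transformation of `p`. -/
def deckOrbit {E B : Type*} [TopologicalSpace E] (p : E → B) (L : Set E) : Set E :=
  {y | ∃ θ : E ≃ₜ E, (∀ z, p (θ z) = p z) ∧ θ y ∈ L}

section Control

variable {B E : Type*} [MetricSpace B] [TopologicalSpace E] [PathConnectedSpace E]
  {p : E → B} (hp : IsCoveringMap p) (hB : IsGeodesicSpace B) {L : Set E} (hL : IsCompact L)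

include hp hB hL

/-- The points at a bounded distance from `y` are in the translate of a compact set by the same deck
transformation as `y`. -/
theorem exists_isCompact_of_liftEDist_le [ProperSpace B] (r : ℝ) :
    ∃ C, IsCompact C ∧ ∀ {θ : E ≃ₜ E}, (∀ z, p (θ z) = p z) → ∀ {y z}, θ y ∈ L →
      liftEDist p y z ≤ ENNReal.ofReal r → θ z ∈ C := by
  obtain ⟨C, hC, h⟩ := exists_isCompact_liftEDist_le hp hB hL r
  exact ⟨C, hC, fun {θ} hθ {y z} hy hyz => h _ hy _ (by rwa [liftEDist_deck p hθ])⟩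

theorem exists_liftEDist_le_of_mem {C : Set E} (hC : IsCompact C) :
    ∃ r : ℝ, ∀ {θ : E ≃ₜ E}, (∀ z, p (θ z) = p z) → ∀ {y z}, θ y ∈ L → θ z ∈ C →
      liftEDist p y z ≤ ENNReal.ofReal r := by
  obtain ⟨r, hr⟩ := exists_liftEDist_le hp hB hL hC
  exact ⟨r, fun {θ} hθ {y z} hy hz => by rw [← liftEDist_deck p hθ]; exact hr _ hy _ hz⟩

/-- Controlled extension in the covering space, with respect to the lifted metric. -/
theorem exists_extension_near [ProperSpace B] [ContractibleSpace E] (K : CellStructure B) (r : ℝ) :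
    ∃ r' : ℝ, ∀ y ∈ deckOrbit p L, ∀ {W : Type w} [TopologicalSpace W] {D S : Set W} {d : ℕ},
      IsDiscPair D S d → ∀ {u₀ : W → E}, ContinuousOn u₀ S →
      (∀ s ∈ S, liftEDist p y (u₀ s) ≤ ENNReal.ofReal r) →
      (∃ u : W → E, ContinuousOn u D ∧ EqOn u u₀ S ∧
        ∀ z ∈ D, liftEDist p y (u z) ≤ ENNReal.ofReal r') ∧
      ∀ k, d < k → MapsTo u₀ S ((K.lift hp).skel k) →
        ∃ u : W → E, ContinuousOn u D ∧ EqOn u u₀ S ∧ MapsTo u D ((K.lift hp).skel k) ∧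
          ∀ z ∈ D, liftEDist p y (u z) ≤ ENNReal.ofReal r' := by
  have := t2Space_of_isCoveringMap hp
  obtain ⟨C, hC, hCr⟩ := exists_isCompact_of_liftEDist_le hp hB hL r
  obtain ⟨C', hC', -, hext⟩ := (K.lift hp).exists_controlled_extension hC
  obtain ⟨r', hr'⟩ := exists_liftEDist_le_of_mem hp hB hL hC'
  refine ⟨r', ?_⟩
  rintro y ⟨θ, hθ, hy⟩ W _ D S d hDS u₀ hu₀ hu₀r
  have hθs : ∀ z, p (θ.symm z) = p z := deck_symm hθ
  have hsk : ∀ k z, p z ∈ K.skel k ↔ z ∈ (K.lift hp).skel k := fun k z => by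
    rw [K.skel_lift hp]; rfl
  have hdist : ∀ z, z ∈ C' → liftEDist p y (θ.symm z) ≤ ENNReal.ofReal r' := fun z hz =>
    hr' hθ hy (by rwa [θ.apply_symm_apply])
  obtain ⟨h1, h2⟩ := hext hDS (u₀ := fun s => θ (u₀ s)) (θ.continuous.comp_continuousOn hu₀)
    fun s hs => hCr hθ hy (hu₀r s hs)
  constructor
  · obtain ⟨u, hu, huS, hum⟩ := h1
    exact ⟨fun z => θ.symm (u z), θ.symm.continuous.comp_continuousOn hu,
      fun s hs => by simp [huS hs], fun z hz => hdist _ (hum hz)⟩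
  · intro k hk hu₀k
    obtain ⟨u, hu, huS, hum⟩ := h2 k hk fun s hs => by
      rw [← hsk, hθ, hsk]; exact hu₀k hs
    exact ⟨fun z => θ.symm (u z), θ.symm.continuous.comp_continuousOn hu,
      fun s hs => by simp [huS hs], fun z hz => by
        rw [← hsk, hθs, hsk]; exact (hum hz).2, fun z hz => hdist _ (hum hz).1⟩

/-- Contractions of the covering space that are uniformly controlled near `y`. -/
theorem exists_contraction_near [ProperSpace B] [ContractibleSpace E] :
    ∃ (c : E → C(I × E, E)) (e : E → E), (∀ y z, c y (0, z) = z) ∧ (∀ y z, c y (1, z) = e y) ∧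
      ∀ r : ℝ, ∃ r' : ℝ, ∀ y ∈ deckOrbit p L, ∀ z t, liftEDist p y z ≤ ENNReal.ofReal r →
        liftEDist p y (c y (t, z)) ≤ ENNReal.ofReal r' := by
  classical
  obtain ⟨e₀, ⟨h⟩⟩ := id_nullhomotopic E
  have hθ : ∀ y, ∃ θ : E ≃ₜ E, (∀ z, p (θ z) = p z) ∧ (y ∈ deckOrbit p L → θ y ∈ L) := fun y => by
    by_cases hy : y ∈ deckOrbit p L
    · obtain ⟨θ, hθ, hyL⟩ := hy
      exact ⟨θ, hθ, fun _ => hyL⟩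
    · exact ⟨Homeomorph.refl E, fun _ => rfl, fun h => absurd h hy⟩
  choose θ hθ hθL using hθ
  refine ⟨fun y => ⟨fun q => (θ y).symm (h (q.1, θ y q.2)), by fun_prop⟩,
    fun y => (θ y).symm e₀, fun y z => by simp, fun y z => by simp, fun r => ?_⟩
  obtain ⟨C, hC, hCr⟩ := exists_isCompact_of_liftEDist_le hp hB hL r
  obtain ⟨r', hr'⟩ := exists_liftEDist_le_of_mem hp hB hL
    ((isCompact_univ.prod hC).image h.continuous)
  refine ⟨r', fun y hy z t hz => hr' (hθ y) (hθL y hy) ?_⟩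
  change θ y ((θ y).symm _) ∈ _
  rw [(θ y).apply_symm_apply]
  exact ⟨(t, θ y z), ⟨mem_univ _, hCr (hθ y) (hθL y hy) hz⟩, rfl⟩

end Control

/-! ### Iterated contractions -/

section Fold

variable {Z J E : Type*} [TopologicalSpace E] (c : J → C(I × E, E))
  (s : Z → ℝ) (a : J → Z → ℝ) (φ : Z → E)

/-- The total weight of a list of indices. -/
def foldWeight : List J → Z → ℝ
  | [], z => s z
  | j :: l, z => foldWeight l z + a j z

/-- The iterated contraction of `φ z`, which has the weight `s z`, towards the end points of the
contractions `c j`, which have the weights `a j z`. -/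
noncomputable def fold : List J → Z → E
  | [], z => φ z
  | j :: l, z => c j (projIcc 0 1 zero_le_one (a j z / foldWeight s a (j :: l) z), fold l z)

variable {c s a φ}

theorem foldWeight_nonneg (hs : ∀ z, 0 ≤ s z) (ha : ∀ j z, 0 ≤ a j z) (z : Z) :
    ∀ l : List J, 0 ≤ foldWeight s a l z
  | [] => hs z
  | j :: l => add_nonneg (foldWeight_nonneg hs ha z l) (ha j z)

theorem foldWeight_eq_sum (z : Z) : ∀ l : List J,
    foldWeight s a l z = s z + (l.map fun j => a j z).sum
  | [] => by simp [foldWeight]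
  | j :: l => by
    rw [foldWeight, foldWeight_eq_sum z l, List.map_cons, List.sum_cons]; ring

theorem continuous_foldWeight [TopologicalSpace Z] (hs : Continuous s) (ha : ∀ j, Continuous (a j))
    :
    ∀ l : List J, Continuous (foldWeight s a l)
  | [] => hs
  | j :: l => (continuous_foldWeight hs ha l).add (ha j)

theorem fold_cons_of_eq_zero (hc : ∀ j y, c j (0, y) = y) {j : J} {l : List J} {z : Z}
    (h : a j z = 0) : fold c s a φ (j :: l) z = fold c s a φ l z := by
  rw [fold, h, zero_div, projIcc_of_le_left _ le_rfl]
  exact hc j _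

theorem fold_filter (hc : ∀ j y, c j (0, y) = y) (z : Z) (P : J → Bool)
    (hP : ∀ j, P j = false → a j z = 0) : ∀ l : List J,
    fold c s a φ (l.filter P) z = fold c s a φ l z ∧
      foldWeight s a (l.filter P) z = foldWeight s a l z
  | [] => ⟨rfl, rfl⟩
  | j :: l => by
    obtain ⟨h1, h2⟩ := fold_filter hc z P hP l
    cases hj : P j with
    | true =>
      rw [List.filter_cons_of_pos hj]
      simp only [fold, foldWeight, h1, h2, and_self]
    | false =>
      rw [List.filter_cons_of_neg (by simp [hj]), fold_cons_of_eq_zero hc (hP j hj), foldWeight,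
        hP j hj, add_zero]
      exact ⟨h1, h2⟩

theorem fold_eq_of_forall_eq_zero (hc : ∀ j y, c j (0, y) = y) {z : Z} (h : ∀ j, a j z = 0) :
    ∀ l : List J, fold c s a φ l z = φ z
  | [] => rfl
  | j :: l => by rw [fold_cons_of_eq_zero hc (h j), fold_eq_of_forall_eq_zero hc h l]

theorem fold_congr_of_eq_zero {e : J → E} (hc1 : ∀ j y, c j (1, y) = e j) (hs : ∀ z, 0 ≤ s z)
    (ha : ∀ j z, 0 ≤ a j z) {φ' : Z → E} {z : Z} (h : s z = 0) : ∀ l : List J,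
    0 < foldWeight s a l z → fold c s a φ l z = fold c s a φ' l z
  | [], hpos => by
    rw [foldWeight, h] at hpos
    exact absurd hpos (lt_irrefl _)
  | j :: l, hpos => by
    rcases (foldWeight_nonneg hs ha z l).lt_or_eq with h1 | h1
    · rw [fold, fold, fold_congr_of_eq_zero hc1 hs ha h l h1]
    · have h2 : a j z / foldWeight s a (j :: l) z = 1 := by
        rw [foldWeight, ← h1, zero_add] at hpos ⊢
        exact div_self hpos.ne'
      rw [fold, fold, h2, projIcc_of_right_le _ le_rfl]
      exact (hc1 j _).trans (hc1 j _).symm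

/-- Where the total weight vanishes, the iterated contraction need not be continuous, but it stays
in a compact set, and this suffices for the continuity after the next contraction. -/
theorem fold_continuousAt [TopologicalSpace Z] {e : J → E} (hc1 : ∀ j y, c j (1, y) = e j)
    (hs : Continuous s)
    (hs0 : ∀ z, 0 ≤ s z) (ha : ∀ j, Continuous (a j)) (ha0 : ∀ j z, 0 ≤ a j z)
    (hφ : Continuous φ) {z : Z} (hz : ∃ C, IsCompact C ∧ ∀ᶠ z' in 𝓝 z, φ z' ∈ C) :
    ∀ l : List J, (∃ C, IsCompact C ∧ ∀ᶠ z' in 𝓝 z, fold c s a φ l z' ∈ C) ∧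
      (0 < foldWeight s a l z → ContinuousAt (fold c s a φ l) z)
  | [] => ⟨hz, fun _ => hφ.continuousAt⟩
  | j :: l => by
    obtain ⟨⟨C, hC, hzC⟩, hcont⟩ := fold_continuousAt hc1 hs hs0 ha ha0 hφ hz l
    refine ⟨⟨c j '' (univ ×ˢ C), (isCompact_univ.prod hC).image (c j).continuous, ?_⟩,
      fun hpos => ?_⟩
    · filter_upwards [hzC] with z' hz' using ⟨_, ⟨mem_univ _, hz'⟩, rfl⟩
    have hr : ContinuousAt
        (fun z' => projIcc (0 : ℝ) 1 zero_le_one (a j z' / foldWeight s a (j :: l) z')) z :=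
      continuous_projIcc.continuousAt.comp ((ha j).continuousAt.div
        (continuous_foldWeight hs ha (j :: l)).continuousAt hpos.ne')
    rcases (foldWeight_nonneg hs0 ha0 z l).lt_or_eq with h1 | h1
    · exact (c j).continuous.continuousAt.comp (hr.prodMk (hcont h1))
    · have h2 : a j z / foldWeight s a (j :: l) z = 1 := by
        rw [foldWeight, ← h1, zero_add] at hpos ⊢
        exact div_self hpos.ne'
      have h3 : projIcc (0 : ℝ) 1 zero_le_one (a j z / foldWeight s a (j :: l) z) = 1 := by
        rw [h2]; exact projIcc_of_right_le _ le_rfl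
      intro U hU
      rw [fold, h3, hc1] at hU
      obtain ⟨O, hOU, hO, heO⟩ := mem_nhds_iff.1 hU
      obtain ⟨A, A', hA, -, h1A, hCA, hAA⟩ := generalized_tube_lemma
        (isCompact_singleton (x := (1 : I))) hC (hO.preimage (c j).continuous) (by
          rintro ⟨t, y⟩ ⟨ht, -⟩
          obtain rfl : t = 1 := ht
          rw [mem_preimage, hc1]
          exact heO)
      refine Filter.mem_map.2 ?_
      filter_upwards [hzC, hr.eventually (hA.mem_nhds (by simp only [h3]; exact h1A rfl))] with z'
        hz' hz''
      exact hOU (hAA (show (_, _) ∈ A ×ˢ A' from ⟨hz'', hCA hz'⟩))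

end Fold

/-- Iterated contraction deforms all maps to the same map, which depends only on the partition of
unity and the contractions `c j`. If the contractions with `g j x ≠ 0` map `Q m` to `Q (m + 1)`, the
track of `x` stays in the union of the first sets `Q m`. -/
theorem exists_fold_homotopy {X J E : Type*} [TopologicalSpace X] [WeaklyLocallyCompactSpace X]
    [TopologicalSpace E] (g : PartitionOfUnity J X univ) (c : J → C(I × E, E)) {e : J → E}
    (hc0 : ∀ j y, c j (0, y) = y) (hc1 : ∀ j y, c j (1, y) = e j) {n : ℕ}
    (hn : ∀ (x : X) (s : Finset J), (∀ j ∈ s, g j x ≠ 0) → s.card ≤ n) :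
    ∃ H : C(X, E) → C(X × I, E), (∀ φ x, H φ (x, 0) = φ x) ∧
      (∀ φ φ' x, H φ (x, 1) = H φ' (x, 1)) ∧
      ∀ (φ : C(X, E)) (x : X) (t : I) (Q : ℕ → Set E), φ x ∈ Q 0 →
        (∀ m j, g j x ≠ 0 → ∀ y ∈ Q m, ∀ t, c j (t, y) ∈ Q (m + 1)) →
        ∃ m ≤ n, H φ (x, t) ∈ Q m := by
  classical
  let _ : LinearOrder J := linearOrderOfSTO WellOrderingRel
  -- at time `t`, the weights are `1 - t` for the given map and `t * g j` for the contractions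
  let s : X × I → ℝ := fun z => 1 - z.2
  let a : J → X × I → ℝ := fun j z => z.2 * g j z.1
  have hs : Continuous s := by fun_prop
  have hs0 : ∀ z, 0 ≤ s z := fun z => sub_nonneg.2 z.2.2.2
  have ha : ∀ j, Continuous (a j) := fun j => by fun_prop
  have ha0 : ∀ j z, 0 ≤ a j z := fun j z => mul_nonneg z.2.2.1 (g.nonneg j z.1)
  have hfin : ∀ x, {j | g j x ≠ 0}.Finite := fun x => g.locallyFinite.point_finite x
  let S : X → Finset J := fun x => (hfin x).toFinset
  have hS : ∀ x j, j ∈ S x ↔ g j x ≠ 0 := fun x j => by simp [S]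
  have hsum : ∀ x (F : Finset J), (∀ j ∉ F, g j x = 0) → ∑ j ∈ F, g j x = 1 := fun x F hF => by
    rw [← g.sum_eq_one (mem_univ x), finsum_eq_sum_of_support_subset _ (s := F)]
    intro j hj
    by_contra h
    exact hj (hF j h)
  have hwt : ∀ (F : Finset J) (z : X × I), (∀ j ∉ F, g j z.1 = 0) →
      foldWeight s a F.sort z = 1 := fun F z hF => by
    rw [foldWeight_eq_sum, ← Multiset.sum_coe, ← Multiset.map_coe, Finset.sort_eq]
    change s z + ∑ j ∈ F, a j z = 1
    rw [← Finset.mul_sum, hsum _ F hF]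
    simp only [s]; ring
  let H : C(X, E) → X × I → E := fun φ z => fold c s a (fun z => φ z.1) (S z.1).sort z
  have hHF : ∀ φ (F : Finset J) (z : X × I), (∀ j ∉ F, g j z.1 = 0) →
      H φ z = fold c s a (fun z => φ z.1) F.sort z := fun φ F z hF => by
    have h1 : (S z.1).sort = F.sort.filter (· ∈ S z.1) := by
      refine List.Perm.eq_of_pairwise' (Finset.pairwise_sort _ _)
        ((Finset.pairwise_sort _ _).filter _) ?_
      refine (List.perm_ext_iff_of_nodup (Finset.sort_nodup _ _)
        ((Finset.sort_nodup _ _).filter _)).2 fun j => ?_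
      simp only [Finset.mem_sort, List.mem_filter, decide_eq_true_eq]
      exact ⟨fun h => ⟨by_contra fun hj => (hS _ _).1 h (hF j hj), h⟩, fun h => h.2⟩
    simp only [H]
    rw [h1]
    refine (fold_filter hc0 z _ (fun j hj => ?_) _).1
    have : j ∉ S z.1 := by simpa using hj
    rw [hS, not_not] at this
    simp [a, this]
  have hH : ∀ φ, Continuous (H φ) := fun φ => by
    refine continuous_of_locallyFinite_support (a := fun j (z : X × I) => g j z.1)
      (fun j => by fun_prop) (g.locallyFinite.preimage_continuous continuous_fst) fun F _ => ?_
    have h1 : ContinuousOn (fold c s a (fun z => φ z.1) F.sort) {z | ∀ j ∉ F, g j z.1 = 0} := by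
      intro z hz
      obtain ⟨N, hN, hNz⟩ := exists_compact_mem_nhds z.1
      refine ((fold_continuousAt hc1 hs hs0 ha ha0 (by fun_prop) ⟨φ '' N, hN.image φ.continuous,
        ?_⟩ _).2 (by rw [hwt F z hz]; exact one_pos)).continuousWithinAt
      filter_upwards [continuous_fst.continuousAt.eventually hNz] with z' hz'
      exact ⟨_, hz', rfl⟩
    exact h1.congr fun z hz => hHF φ F z hz
  have hSz : ∀ x, ∀ j ∉ S x, g j x = 0 := fun x j hj => by rwa [hS, not_not] at hj
  refine ⟨fun φ => ⟨H φ, hH φ⟩, fun φ x => ?_, fun φ φ' x => ?_, fun φ x t Q hQ0 hQ => ?_⟩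
  · exact fold_eq_of_forall_eq_zero hc0 (fun j => by simp [a]) _
  · exact fold_congr_of_eq_zero hc1 hs0 ha0 (by simp [s]) _
      (by rw [hwt _ (x, 1) (hSz x)]; exact one_pos)
  · have hfold : ∀ l : List J, (∀ j ∈ l, g j x ≠ 0) →
        fold c s a (fun z => φ z.1) l (x, t) ∈ Q l.length := by
      intro l
      induction l with
      | nil => exact fun _ => hQ0
      | cons j l ih =>
        intro hl
        exact hQ _ j (hl j (by simp)) _ (ih fun j hj => hl j (by simp [hj])) _
    refine ⟨_, hn x (S x) fun j hj => (hS x j).1 hj, ?_⟩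
    have := hfold (S x).sort fun j hj => (hS x j).1 (by simpa using hj)
    rwa [Finset.length_sort] at this

theorem liftEDist_le_add {E B : Type*} [TopologicalSpace E] [PseudoEMetricSpace B] {p : E → B}
    {x y z : E} {a b : ℝ} (h : liftEDist p x y ≤ ENNReal.ofReal a)
    (h' : liftEDist p y z ≤ ENNReal.ofReal b) :
    liftEDist p x z ≤ ENNReal.ofReal (|a| + |b|) := by
  rw [ENNReal.ofReal_add (abs_nonneg a) (abs_nonneg b)]
  exact (liftEDist_triangle p x y z).trans (add_le_add
    (h.trans (ENNReal.ofReal_le_ofReal (le_abs_self a)))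
    (h'.trans (ENNReal.ofReal_le_ofReal (le_abs_self b))))

/-! ### Coarse geometry of the lift of a map -/

section Deform

variable {M B : Type*} {X : Type u} {E : Type*} [TopologicalSpace X]
  [TopologicalSpace E] {pM : X → M} {p : E → B} [MetricSpace M] [CompactSpace M] [MetricSpace B]
  [SimplyConnectedSpace X] [SimplyConnectedSpace E] (hM : IsGeodesicSpace M)
  (hB : IsGeodesicSpace B) (hpM : IsCoveringMap pM) (hp : IsCoveringMap p) {f : M → B}
  {f' : C(X, E)} (hf' : ∀ x, p (f' x) = f (pM x))

include hM hpM in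
theorem weaklyLocallyCompactSpace_of_isCoveringMap : WeaklyLocallyCompactSpace X := by
  refine ⟨fun x => ?_⟩
  obtain ⟨K, hK, hKx⟩ := exists_isCompact_liftEDist_le hpM hM (isCompact_singleton (x := x)) 1
  refine ⟨K, hK, ?_⟩
  filter_upwards [(hasBasis_nhds_liftEDist hpM hM x).mem_of_mem (i := 1) one_pos] with y hy
  refine hKx x rfl y ?_
  rw [liftEDist_comm, ENNReal.ofReal_one]
  exact le_of_lt hy

include hM hB hpM hp hf'

/-- The image of `f'` is covered by the translates of a compact set. -/
theorem exists_isCompact_mem_deckOrbit : ∃ L, IsCompact L ∧ ∀ x, f' x ∈ deckOrbit p L := by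
  have := hM.locallyPathConnectedSpace
  have := locallyPathConnectedSpace_of_isLocalHomeomorph hpM.isLocalHomeomorph
  have := hB.locallyPathConnectedSpace
  have := locallyPathConnectedSpace_of_isLocalHomeomorph hp.isLocalHomeomorph
  obtain ⟨D, hD, hDM⟩ := exists_isCompact_image_eq_univ hM hpM
  refine ⟨f' '' D, hD.image f'.continuous, fun x => ?_⟩
  obtain ⟨x', hx', hxx⟩ := hDM (pM x)
  obtain ⟨τ, hτ, hτx⟩ := exists_deck hpM hxx.symm
  obtain ⟨θ, hθ, hθf⟩ := exists_deck_comp_eq hp f' hf' hτ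
  exact ⟨θ, hθ, x', hx', by rw [← hτx, hθf]⟩

/-- The lift of a map of a compact space is coarsely Lipschitz. -/
theorem exists_liftEDist_lift_le (r : ℝ) : ∃ b : ℝ, ∀ x y,
    liftEDist pM x y ≤ ENNReal.ofReal r → liftEDist p (f' x) (f' y) ≤ ENNReal.ofReal b := by
  have := hM.locallyPathConnectedSpace
  have := locallyPathConnectedSpace_of_isLocalHomeomorph hpM.isLocalHomeomorph
  have := hB.locallyPathConnectedSpace
  have := locallyPathConnectedSpace_of_isLocalHomeomorph hp.isLocalHomeomorph
  obtain ⟨D, hD, hDM⟩ := exists_isCompact_image_eq_univ hM hpM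
  obtain ⟨C, hC, hCr⟩ := exists_isCompact_of_liftEDist_le hpM hM hD r
  obtain ⟨b, hb⟩ := exists_liftEDist_le hp hB (hD.image f'.continuous) (hC.image f'.continuous)
  refine ⟨b, fun x y hxy => ?_⟩
  obtain ⟨x', hx', hxx⟩ := hDM (pM x)
  obtain ⟨τ, hτ, hτx⟩ := exists_deck hpM hxx.symm
  obtain ⟨θ, hθ, hθf⟩ := exists_deck_comp_eq hp f' hf' hτ
  rw [← liftEDist_deck p hθ, ← hθf, ← hθf]
  have hx : τ x ∈ D := by rwa [hτx]
  exact hb _ ⟨_, hx, rfl⟩ _ ⟨_, hCr hτ hx hxy, rfl⟩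

/-- If the universal covering space has small macroscopic dimension, it has a partition of unity of
order `n` with uniformly bounded supports; the bound is stated in terms of the map `f'`. -/
theorem exists_partitionOfUnity {n : ℕ} (hdim : macroDim X (liftEDist pM) < n) :
    ∃ (J : Type u) (g : PartitionOfUnity J X univ) (x₀ : J → X) (b : ℝ),
      (∀ (x : X) (s : Finset J), (∀ j ∈ s, g j x ≠ 0) → s.card ≤ n) ∧
      ∀ j x, g j x ≠ 0 → liftEDist p (f' x) (f' (x₀ j)) ≤ ENNReal.ofReal b := by
  classical
  let mX : EMetricSpace X := liftEMetricSpace hpM hM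
  obtain ⟨k, hk⟩ := iInf_lt_iff.1 hdim
  obtain ⟨hk, hkn⟩ := iInf_lt_iff.1 hk
  obtain ⟨z⟩ := (inferInstance : Nonempty X)
  have hcont := continuous_liftEDist hpM hM
  have hfin : ∀ x y, liftEDist pM x y ≠ ⊤ := fun x y => (liftEDist_lt_top hpM hM x y).ne
  have hcz : Continuous fun x => liftEDist pM z x := hcont.comp (Continuous.prodMk_right z)
  have hr : Continuous fun x => (liftEDist pM z x).toReal + 1 :=
    (ENNReal.continuousOn_toReal.comp_continuous hcz fun x => hfin z x).add continuous_const
  have hle : ∀ x y c, 0 ≤ c → liftEDist pM x y ≤ ENNReal.ofReal c →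
      (liftEDist pM z y).toReal ≤ (liftEDist pM z x).toReal + c := fun x y c hc hxy => by
    have h1 := (liftEDist_triangle pM z x y).trans (add_le_add_right hxy _)
    have h2 := ENNReal.toReal_mono (by finiteness [hfin z x]) h1
    rwa [ENNReal.toReal_add (hfin z x) ENNReal.ofReal_ne_top, ENNReal.toReal_ofReal hc] at h2
  obtain ⟨J, W, hWo, hWc, hWk, D, hWD⟩ := hk.exists_cover hcont
    (r := fun x => (liftEDist pM z x).toReal + 1) hr (fun x => by positivity) (fun a => by
      obtain ⟨C, hC, hCa⟩ := exists_isCompact_liftEDist_le hpM hM (isCompact_singleton (x := z)) a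
      refine hC.of_isClosed_subset (isClosed_le hr continuous_const) fun x hx => hCa z rfl x ?_
      rw [← ENNReal.ofReal_toReal (hfin z x)]
      refine ENNReal.ofReal_le_ofReal ?_
      have : (liftEDist pM z x).toReal + 1 ≤ a := hx
      linarith) (fun x y c hc hxy => by
      have h1 := hle x y c hc hxy
      have h2 := hle y x c hc (by rwa [liftEDist_comm])
      rw [abs_le]
      constructor <;> linarith)
  obtain ⟨g, hg⟩ := PartitionOfUnity.exists_isSubordinate isClosed_univ W hWo hWc.ge
  have hgW : ∀ j x, g j x ≠ 0 → x ∈ W j := fun j x h => hg j (subset_tsupport _ h)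
  obtain ⟨b, hb⟩ := exists_liftEDist_lift_le hM hB hpM hp hf' D
  refine ⟨J, g, fun j => if h : (W j).Nonempty then h.some else z, b, fun x s hs => ?_,
    fun j x hx => hb _ _ ?_⟩
  · have h1 := hWk x s fun j hj => hgW j x (hs j hj)
    have h2 : k < n := by exact_mod_cast hkn
    omega
  · have hne : (W j).Nonempty := ⟨x, hgW j x hx⟩
    simp only [dif_pos hne]
    exact hWD j x (hgW j x hx) _ hne.some_mem

end Deform

/-! ### Homotopies and maps controlled by a cover of small order -/

theorem liftEDist_le_of_le {E B : Type*} [TopologicalSpace E] [PseudoEMetricSpace B] {p : E → B}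
    {x y : E} {a b : ℝ} (h : liftEDist p x y ≤ ENNReal.ofReal a) (hab : a ≤ b) :
    liftEDist p x y ≤ ENNReal.ofReal b :=
  h.trans (ENNReal.ofReal_le_ofReal hab)

section Nerve

variable {B E : Type*} [MetricSpace B] [TopologicalSpace E] [ContractibleSpace E]
  {p : E → B} (hp : IsCoveringMap p) (hB : IsGeodesicSpace B) {L : Set E} (hL : IsCompact L)

theorem simplexBoundary_eq {J : Type*} [DecidableEq J] (s : Finset J) :
    simplexBoundary s = ⋃ v : s, closedSimplex (s.erase v) := by
  ext w
  simp only [mem_iUnion]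
  constructor
  · rintro ⟨⟨h0, hs, h1⟩, v, hv, hwv⟩
    refine ⟨⟨v, hv⟩, h0, fun v' hv' => ?_, ?_⟩
    · by_cases h : v' = v
      · rw [h, hwv]
      · exact hs v' fun h' => hv' (Finset.mem_erase.2 ⟨h, h'⟩)
    · rw [← h1, ← Finset.add_sum_erase s w hv, hwv, zero_add]
  · rintro ⟨⟨v, hv⟩, h0, hs, h1⟩
    have hwv : w v = 0 := hs v (Finset.notMem_erase v s)
    refine ⟨⟨h0, fun v' hv' => hs v' fun h => hv' (Finset.mem_of_mem_erase h), ?_⟩, v, hv, hwv⟩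
    rw [← Finset.add_sum_erase s w hv, hwv, zero_add, h1]

theorem nonempty_of_mem_closedSimplex {J : Type*} {s : Finset J} {w : J → ℝ}
    (hw : w ∈ closedSimplex s) : s.Nonempty := by
  rw [Finset.nonempty_iff_ne_empty]
  rintro rfl
  simpa using hw.2.2

include hp hB hL in
/-- A map of the vertices of a simplicial complex, given by its set `P` of faces, into the covering
space extends over the simplices, with a uniform control and with values in the skeleton, if the
images of adjacent vertices are at a bounded distance. -/
theorem exists_nerve_extension [ProperSpace B] (K : CellStructure B) {J : Type*}
    {P : Finset J → Prop} (hP : ∀ s t, P s → t ⊆ s → P t) {y : J → E}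
    (hy : ∀ j, y j ∈ deckOrbit p L) {b : ℝ}
    (hb : ∀ s, P s → ∀ j ∈ s, ∀ j' ∈ s, liftEDist p (y j) (y j') ≤ ENNReal.ofReal b) (n : ℕ) :
    ∀ d ≤ n, ∃ (Ψ : (J → ℝ) → E) (r : ℝ), ∀ s, P s → s.card ≤ d →
      ContinuousOn Ψ (closedSimplex s) ∧ ∀ w ∈ closedSimplex s, Ψ w ∈ (K.lift hp).skel n ∧
        ∀ j ∈ s, liftEDist p (y j) (Ψ w) ≤ ENNReal.ofReal r := by
  classical
  intro d
  induction d with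
  | zero =>
    obtain ⟨z⟩ := (inferInstance : Nonempty E)
    refine fun _ => ⟨fun _ => z, 0, fun s _ hs => ⟨continuousOn_const, fun w hw => ?_⟩⟩
    have := (nonempty_of_mem_closedSimplex hw).card_pos
    omega
  | succ d ih =>
    intro hdn
    obtain ⟨Ψ, r, hΨ⟩ := ih (by omega)
    obtain ⟨r', hr'⟩ := exists_extension_near hp hB hL K (|b| + |r|)
    have hu : ∀ s : Finset J, ∃ u : (J → ℝ) → E, P s → s.card = d + 1 →
        ContinuousOn u (closedSimplex s) ∧ EqOn u Ψ (simplexBoundary s) ∧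
        MapsTo u (closedSimplex s) ((K.lift hp).skel n) ∧ ∀ w ∈ closedSimplex s, ∀ j ∈ s,
          liftEDist p (y j) (u w) ≤ ENNReal.ofReal (|b| + |r'|) := by
      intro s
      by_cases hs : P s ∧ s.card = d + 1
      swap
      · exact ⟨Ψ, fun h h' => absurd ⟨h, h'⟩ hs⟩
      obtain ⟨hPs, hsd⟩ := hs
      obtain ⟨j₀, hj₀⟩ : s.Nonempty := Finset.card_pos.1 (by omega)
      have hface : ∀ v : s, P (s.erase v) ∧ (s.erase (v : J)).card ≤ d := fun v =>
        ⟨hP s _ hPs (Finset.erase_subset _ _), by rw [Finset.card_erase_of_mem v.2]; omega⟩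
      obtain ⟨-, h2⟩ := hr' (y j₀) (hy j₀) (isDiscPair_closedSimplex hsd) (u₀ := Ψ) (by
        rw [simplexBoundary_eq]
        exact (locallyFinite_of_finite _).continuousOn_iUnion
          (fun v => isClosed_closedSimplex _)
          fun v => (hΨ _ (hface v).1 (hface v).2).1) (by
        intro w hw
        rw [simplexBoundary_eq] at hw
        obtain ⟨v, hv⟩ := mem_iUnion.1 hw
        obtain ⟨j, hj⟩ := nonempty_of_mem_closedSimplex hv
        exact liftEDist_le_add (hb s hPs j₀ hj₀ j (Finset.mem_of_mem_erase hj))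
          (((hΨ _ (hface v).1 (hface v).2).2 w hv).2 j hj))
      obtain ⟨u, hu, huS, hun, hur⟩ := h2 n (by omega) (by
        intro w hw
        rw [simplexBoundary_eq] at hw
        obtain ⟨v, hv⟩ := mem_iUnion.1 hw
        exact ((hΨ _ (hface v).1 (hface v).2).2 w hv).1)
      exact ⟨u, fun _ _ => ⟨hu, huS, hun, fun w hw j hj =>
        liftEDist_le_add (hb s hPs j hj j₀ hj₀) (hur w hw)⟩⟩
    choose u hu using hu
    let T : (J → ℝ) → Finset J → Prop := fun w s =>
      P s ∧ s.card = d + 1 ∧ w ∈ closedSimplex s ∧ ∀ v ∈ s, w v ≠ 0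
    let Ψ' : (J → ℝ) → E := fun w => if h : ∃ s, T w s then u h.choose w else Ψ w
    have hΨ'0 : ∀ w, (¬ ∃ s, T w s) → Ψ' w = Ψ w := fun w h => dif_neg h
    -- a face all of whose coordinates are nonzero at `w` is determined by `w`
    have hle : ∀ w s t, T w s → w ∈ closedSimplex t → s ⊆ t := fun w s t hs ht v hv => by
      by_contra h
      exact hs.2.2.2 v hv (ht.2.1 v h)
    have hΨ'1 : ∀ s, P s → s.card = d + 1 → EqOn Ψ' (u s) (closedSimplex s) := by
      intro s hs hsd w hw
      by_cases h : ∃ s, T w s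
      · have h1 : h.choose = s := Finset.eq_of_subset_of_card_le
          (hle w _ s h.choose_spec hw) (by rw [hsd, h.choose_spec.2.1])
        simp only [Ψ', dif_pos h, h1]
      · rw [hΨ'0 w h]
        have h1 : ∃ v ∈ s, w v = 0 := by
          by_contra h1
          push Not at h1
          exact h ⟨s, hs, hsd, hw, h1⟩
        exact ((hu s hs hsd).2.1 ⟨hw, h1⟩).symm
    refine ⟨Ψ', |r| + (|b| + |r'|), fun s hs hsd => ?_⟩
    rcases hsd.lt_or_eq with h | h
    · have heq : EqOn Ψ' Ψ (closedSimplex s) := fun w hw => hΨ'0 w (by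
        rintro ⟨t, ht⟩
        have h1 := Finset.card_le_card (hle w t s ht hw)
        have h2 := ht.2.1
        omega)
      obtain ⟨h1, h2⟩ := hΨ s hs (by omega)
      refine ⟨h1.congr heq, fun w hw => ?_⟩
      rw [heq hw]
      refine ⟨(h2 w hw).1, fun j hj => liftEDist_le_of_le ((h2 w hw).2 j hj) ?_⟩
      have := le_abs_self r
      linarith [abs_nonneg b, abs_nonneg r']
    · obtain ⟨h1, -, h2, h3⟩ := hu s hs h
      refine ⟨h1.congr (hΨ'1 s hs h), fun w hw => ?_⟩
      rw [hΨ'1 s hs h hw]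
      exact ⟨h2 hw, fun j hj => liftEDist_le_of_le (h3 w hw j hj)
        (le_add_of_nonneg_left (abs_nonneg r))⟩

end Nerve

section Deform

variable {M B : Type*} {X : Type u} {E : Type*} [TopologicalSpace X]
  [TopologicalSpace E] {pM : X → M} {p : E → B} [MetricSpace M] [CompactSpace M] [MetricSpace B]
  [ProperSpace B] [SimplyConnectedSpace X] [ContractibleSpace E] (hM : IsGeodesicSpace M)
  (hB : IsGeodesicSpace B) (hpM : IsCoveringMap pM) (hp : IsCoveringMap p) {f : M → B}
  {f' : C(X, E)} (hf' : ∀ x, p (f' x) = f (pM x)) {n : ℕ}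
  (hdim : macroDim X (liftEDist pM) < n)

include hM hB hpM hp hf' hdim

/-- Two maps at a bounded distance from `f'` are homotopic at a bounded distance from `f'`. -/
theorem exists_homotopy_near {φ₀ φ₁ : C(X, E)} {r : ℝ}
    (h₀ : ∀ x, liftEDist p (f' x) (φ₀ x) ≤ ENNReal.ofReal r)
    (h₁ : ∀ x, liftEDist p (f' x) (φ₁ x) ≤ ENNReal.ofReal r) :
    ∃ (H : C(X × I, E)) (b : ℝ), (∀ x, H (x, 0) = φ₀ x) ∧ (∀ x, H (x, 1) = φ₁ x) ∧
      ∀ x t, liftEDist p (f' x) (H (x, t)) ≤ ENNReal.ofReal b := by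
  have := weaklyLocallyCompactSpace_of_isCoveringMap hM hpM
  obtain ⟨L, hL, hfL⟩ := exists_isCompact_mem_deckOrbit hM hB hpM hp hf'
  obtain ⟨c, e, hc0, hc1, hc⟩ := exists_contraction_near hp hB hL
  choose ρ hρ using hc
  obtain ⟨J, g, x₀, b, hgn, hgb⟩ := exists_partitionOfUnity hM hB hpM hp hf' hdim
  obtain ⟨H, hH0, hH1, hHQ⟩ := exists_fold_homotopy g (fun j => c (f' (x₀ j)))
    (e := fun j => e (f' (x₀ j))) (fun j => hc0 _) (fun j => hc1 _) hgn
  let R : ℕ → ℝ := fun m => Nat.rec r (fun _ R => |b| + |ρ (|b| + |R|)|) m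
  let b' : ℝ := ∑ m ∈ Finset.range (n + 1), |R m|
  have hHb : ∀ φ : C(X, E), (∀ x, liftEDist p (f' x) (φ x) ≤ ENNReal.ofReal r) → ∀ x t,
      liftEDist p (f' x) (H φ (x, t)) ≤ ENNReal.ofReal b' := by
    intro φ hφ x t
    obtain ⟨m, hm, hm'⟩ := hHQ φ x t
      (fun m => {y | liftEDist p (f' x) y ≤ ENNReal.ofReal (R m)}) (hφ x)
      fun m j hj y hy t => liftEDist_le_add (hgb j x hj) (hρ _ _ (hfL _) _ _
        (liftEDist_le_add (by rw [liftEDist_comm]; exact hgb j x hj) hy))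
    exact liftEDist_le_of_le hm' ((le_abs_self _).trans
      (Finset.single_le_sum (f := fun m => |R m|) (fun _ _ => abs_nonneg _)
        (Finset.mem_range.2 (Nat.lt_succ_of_le hm))))
  let ψ : C(X, E) := ⟨fun x => H φ₀ (x, 1), by fun_prop⟩
  let F : ∀ φ : C(X, E), φ.Homotopy ψ := fun φ =>
    { toFun := fun q => H φ (q.2, q.1)
      continuous_toFun := by fun_prop
      map_zero_left := fun x => hH0 φ x
      map_one_left := fun x => hH1 _ _ x }
  let G := (F φ₀).trans (F φ₁).symm
  refine ⟨⟨fun q => G (q.2, q.1), by fun_prop⟩, b', fun x => G.map_zero_left x,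
    fun x => G.map_one_left x, fun x t => ?_⟩
  change liftEDist p (f' x) (((F φ₀).trans (F φ₁).symm) (t, x)) ≤ _
  rw [ContinuousMap.Homotopy.trans_apply]
  split_ifs
  · exact hHb φ₀ h₀ x _
  · exact hHb φ₁ h₁ x _

/-- There is a map into the skeleton at a bounded distance from `f'`:
    it factors through the nerve of
a cover of small order. -/
theorem exists_map_skel_near (K : CellStructure B) :
    ∃ (φ : C(X, E)) (b : ℝ), ∀ x, φ x ∈ (K.lift hp).skel n ∧
      liftEDist p (f' x) (φ x) ≤ ENNReal.ofReal b := by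
  obtain ⟨L, hL, hfL⟩ := exists_isCompact_mem_deckOrbit hM hB hpM hp hf'
  obtain ⟨J, g, x₀, b, hgn, hgb⟩ := exists_partitionOfUnity hM hB hpM hp hf' hdim
  obtain ⟨Ψ, r, hΨ⟩ := exists_nerve_extension hp hB hL K
    (P := fun s => ∃ x, ∀ j ∈ s, g j x ≠ 0) (y := fun j => f' (x₀ j))
    (fun s t ⟨x, hx⟩ hts => ⟨x, fun j hj => hx j (hts hj)⟩) (fun j => hfL _)
    (b := |b| + |b|) (fun s ⟨x, hx⟩ j hj j' hj' => liftEDist_le_add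
      (by rw [liftEDist_comm]; exact hgb j x (hx j hj)) (hgb j' x (hx j' hj'))) n n le_rfl
  have hmem : ∀ x (s : Finset J), (∀ j ∉ s, g j x = 0) → (fun j => g j x) ∈ closedSimplex s :=
    fun x s hs => ⟨fun j => g.nonneg j x, hs, by
      rw [← g.sum_eq_one (mem_univ x), finsum_eq_sum_of_support_subset _ (s := s)]
      intro j hj
      by_contra h
      exact hj (hs j h)⟩
  refine ⟨⟨fun x => Ψ fun j => g j x, continuous_of_locallyFinite_support
    (a := fun j x => g j x) (fun j => (g j).continuous) g.locallyFinite
      fun s ⟨z, hz⟩ => ?_⟩, |b| + |r|, fun x => ?_⟩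
  · have hs : ∀ j ∈ s, g j z ≠ 0 := fun j hj => (hz j).1 hj
    exact (hΨ s ⟨z, hs⟩ (hgn z s hs)).1.comp
      (continuous_pi fun j => (g j).continuous).continuousOn fun x hx => hmem x s hx
  · let s := (g.locallyFinite.point_finite x).toFinset
    have hs : ∀ j, j ∈ s ↔ g j x ≠ 0 := fun j => by simp [s]
    have hx := hmem x s fun j hj => by rwa [hs, not_not] at hj
    obtain ⟨j, hj⟩ := nonempty_of_mem_closedSimplex hx
    have h := (hΨ s ⟨x, fun j hj => (hs j).1 hj⟩ (hgn x s fun j hj => (hs j).1 hj)).2 _ hx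
    exact ⟨h.1, liftEDist_le_add (hgb j x ((hs j).1 hj)) (h.2 j hj)⟩

/-- If the macroscopic dimension is less than `n`, then `f'` can be deformed, at a bounded distance,
into the cells of dimension less than `n`. -/
theorem exists_deformation_near (K : CellStructure B) :
    ∃ (H : C(X × I, E)) (b : ℝ), (∀ x, H (x, 0) = f' x) ∧
      (∀ x, H (x, 1) ∈ (K.lift hp).skel n) ∧
      ∀ x t, liftEDist p (f' x) (H (x, t)) ≤ ENNReal.ofReal b := by
  obtain ⟨φ, b, hφ⟩ := exists_map_skel_near hM hB hpM hp hf' hdim K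
  obtain ⟨H, b', hH0, hH1, hHb⟩ := exists_homotopy_near hM hB hpM hp hf' hdim (φ₀ := f') (φ₁ := φ)
    (r := b) (fun x => by rw [liftEDist_self]; exact zero_le) (fun x => (hφ x).2)
  exact ⟨H, b', hH0, fun x => by rw [hH1]; exact (hφ x).1, hHb⟩

end Deform

/-! ### Homotopies constructed cell by cell -/

/-- Construction of a homotopy by induction over the skeleta. The requirement over the cells of
dimension less than `k` is that the graph of the homotopy lies in `R k r`, where `r` is a real
parameter that may be enlarged with every step. -/
theorem CellStructure.exists_homotopy_of_step {X E : Type*} [TopologicalSpace X] [T2Space X]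
    [TopologicalSpace E] [Nonempty E] (K : CellStructure X) {R : ℕ → ℝ → Set (X × ℝ × E)}
    (hmono : ∀ {k l r s}, k ≤ l → r ≤ s → R k r ⊆ R l s)
    (hstep : ∀ k r, ∃ r', r ≤ r' ∧ ∀ c, K.dim c = k → ∀ v : (Fin (K.dim c) → ℝ) × ℝ → E,
      ContinuousOn v (Metric.sphere 0 1 ×ˢ Icc 0 1) →
      (∀ z ∈ Metric.sphere 0 1, ∀ t ∈ Icc (0 : ℝ) 1, (K.map c z, t, v (z, t)) ∈ R k r) →
      ∃ u : (Fin (K.dim c) → ℝ) × ℝ → E, ContinuousOn u (Metric.closedBall 0 1 ×ˢ Icc 0 1) ∧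
        EqOn u v (Metric.sphere 0 1 ×ˢ Icc 0 1) ∧
        ∀ z ∈ Metric.closedBall 0 1, ∀ t ∈ Icc (0 : ℝ) 1, (K.map c z, t, u (z, t)) ∈ R (k + 1) r')
    (k : ℕ) : ∃ (r : ℝ) (H : X × ℝ → E), ContinuousOn H (K.skel k ×ˢ Icc 0 1) ∧
      ∀ l ≤ k, ∀ x ∈ K.skel l, ∀ t ∈ Icc (0 : ℝ) 1, (x, t, H (x, t)) ∈ R l r := by
  classical
  induction k with
  | zero =>
    obtain ⟨y⟩ := (inferInstance : Nonempty E)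
    refine ⟨0, fun _ => y, continuousOn_const, fun l hl x hx => ?_⟩
    obtain ⟨c, hc, -⟩ := hx
    omega
  | succ k ih =>
    obtain ⟨r, H, hH, hHR⟩ := ih
    obtain ⟨r', hrr, hstep⟩ := hstep k r
    have hsph : ∀ c, K.dim c = k → ∀ z ∈ Metric.sphere 0 1, K.map c z ∈ K.skel k :=
      fun c hc z hz => hc ▸ K.exists_lt_dim c z hz
    have hu : ∀ c, ∃ u : (Fin (K.dim c) → ℝ) × ℝ → E, K.dim c = k →
        ContinuousOn u (Metric.closedBall 0 1 ×ˢ Icc 0 1) ∧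
        EqOn u (fun q => H (K.map c q.1, q.2)) (Metric.sphere 0 1 ×ˢ Icc 0 1) ∧
        ∀ z ∈ Metric.closedBall 0 1, ∀ t ∈ Icc (0 : ℝ) 1,
          (K.map c z, t, u (z, t)) ∈ R (k + 1) r' := by
      intro c
      by_cases hc : K.dim c = k
      · obtain ⟨u, hu⟩ := hstep c hc (fun q => H (K.map c q.1, q.2))
          (hH.comp ((((K.continuousOn c).mono Metric.sphere_subset_closedBall).comp
            continuousOn_fst fun q hq => hq.1).prodMk continuousOn_snd)
            fun q hq => ⟨hsph c hc q.1 hq.1, hq.2⟩)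
          fun z hz t ht => hHR k le_rfl _ (hsph c hc z hz) t ht
        exact ⟨u, fun _ => hu⟩
      · exact ⟨fun q => H (K.map c q.1, q.2), fun h => absurd h hc⟩
    choose u hu using hu
    choose cell hcell using K.exists_mem_openCell
    let H' : X × ℝ → E := fun q => if q.1 ∈ K.skel k then H q else
      u (cell q.1) (Function.invFunOn (K.map (cell q.1)) (Metric.ball 0 1) q.1, q.2)
    have hH'0 : ∀ x ∈ K.skel k, ∀ t, H' (x, t) = H (x, t) := fun x hx t => if_pos hx
    have hH'1 : ∀ c, K.dim c = k → ∀ z ∈ Metric.closedBall 0 1, ∀ t ∈ Icc (0 : ℝ) 1,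
        H' (K.map c z, t) = u c (z, t) := by
      intro c hc z hz t ht
      rcases (Metric.mem_closedBall.1 hz).lt_or_eq with h | h
      · have hmem : K.map c z ∈ K.openCell c := ⟨z, h, rfl⟩
        have h1 : K.map c z ∉ K.skel k := by
          rw [K.mem_skel_iff_of_mem_openCell hmem]; omega
        have h2 : cell (K.map c z) = c := K.eq_of_mem_openCell (hcell _) hmem
        simp only [H', if_neg h1]
        rw [h2, (K.injOn c).leftInvOn_invFunOn h]
      · rw [hH'0 _ (hsph c hc z h), (hu c hc).2.1 (show (z, t) ∈ Metric.sphere 0 1 ×ˢ Icc (0 : ℝ) 1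
          from ⟨h, ht⟩)]
    refine ⟨r', H', ?_, fun l hl x hx t ht => ?_⟩
    · have hcover : K.skel (k + 1) ×ˢ Icc (0 : ℝ) 1 ⊆ K.skel k ×ˢ Icc 0 1 ∪
          ⋃ c : {c // K.dim c = k}, K.closedCell c ×ˢ Icc 0 1 := by
        rintro ⟨x, t⟩ ⟨⟨c, hc, hx⟩, ht⟩
        by_cases h : K.dim c = k
        · exact .inr (mem_iUnion.2 ⟨⟨c, h⟩, K.openCell_subset_closedCell c hx, ht⟩)
        · exact .inl ⟨⟨c, by omega, hx⟩, ht⟩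
      have hlf : LocallyFinite fun c : {c // K.dim c = k} => K.closedCell c ×ˢ Icc (0 : ℝ) 1 :=
        ((K.locallyFinite.comp_injective (Subtype.val_injective
          (p := fun c => K.dim c = k))).preimage_continuous
          (continuous_fst (X := X) (Y := ℝ))).subset fun c => prod_subset_preimage_fst _ _
      have hcl : ∀ c, IsClosed (K.closedCell c ×ˢ Icc (0 : ℝ) 1) := fun c =>
        (K.isCompact_closedCell c).isClosed.prod isClosed_Icc
      refine (ContinuousOn.union_of_isClosed (hH.congr fun q hq => hH'0 _ hq.1 _)
        (hlf.continuousOn_iUnion (fun c => hcl c) fun c => ?_)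
          ((K.isClosed_skel k).prod isClosed_Icc)
        (hlf.isClosed_iUnion fun c => hcl c)).mono hcover
      have h1 := continuousOn_union_image (A := ∅) isClosed_empty
        ((isCompact_closedBall (0 : Fin (K.dim c) → ℝ) 1).prod
          (isCompact_Icc (a := (0 : ℝ)) (b := 1)))
        (Φ := fun q => (K.map c q.1, q.2)) (((K.continuousOn c).comp
            continuousOn_fst fun q hq => hq.1).prodMk continuousOn_snd) (g := H')
        (continuousOn_empty _) ((hu c c.2).1.congr fun q hq => hH'1 c c.2 q.1 hq.1 q.2 hq.2)
      refine h1.mono ?_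
      rintro ⟨_, t⟩ ⟨⟨z, hz, rfl⟩, ht⟩
      exact .inr ⟨(z, t), ⟨hz, ht⟩, rfl⟩
    · by_cases hxk : x ∈ K.skel k
      · rw [hH'0 x hxk]
        rcases hl.lt_or_eq with h | rfl
        · exact hmono le_rfl hrr (hHR l (by omega) x hx t ht)
        · exact hmono (Nat.le_succ k) hrr (hHR k le_rfl x hxk t ht)
      · obtain ⟨c, hc, hxc⟩ := hx
        have hck : ¬ K.dim c < k := by rwa [← K.mem_skel_iff_of_mem_openCell hxc]
        obtain rfl : l = k + 1 := by omega
        have hck' : K.dim c = k := by omega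
        obtain ⟨z, hz, rfl⟩ := hxc
        have hz' := Metric.ball_subset_closedBall hz
        rw [hH'1 c hck' z hz' t ht]
        exact (hu c hck').2.2 z hz' t ht

/-- The homotopy extension property of a ball and its boundary, with the values of the extension. -/
theorem exists_extension_cylinder {F E : Type*} [NormedAddCommGroup F] [NormedSpace ℝ F]
    [TopologicalSpace E] {v : F × ℝ → E} {g : F → E}
    (hv : ContinuousOn v (Metric.sphere 0 1 ×ˢ Icc 0 1))
    (hg : ContinuousOn g (Metric.closedBall 0 1)) (hvg : ∀ z ∈ Metric.sphere 0 1, v (z, 0) = g z) :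
    ∃ u : F × ℝ → E, ContinuousOn u (Metric.closedBall 0 1 ×ˢ Icc 0 1) ∧
      EqOn u v (Metric.sphere 0 1 ×ˢ Icc 0 1) ∧ (∀ z ∈ Metric.closedBall 0 1, u (z, 0) = g z) ∧
      MapsTo u (Metric.closedBall 0 1 ×ˢ Icc 0 1)
        (g '' Metric.closedBall 0 1 ∪ v '' (Metric.sphere 0 1 ×ˢ Icc 0 1)) := by
  -- projection from the point `(0, 2)` retracts the cylinder to its base and its sides; `σ'` is the
  -- coordinate of the points that are projected to the base, and `ρ` is the projection to the sides
  let ρ : F × ℝ → F × ℝ := fun q => (‖q.1‖⁻¹ • q.1, 2 - (2 - q.2) * ‖q.1‖⁻¹)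
  let σ' : F × ℝ → F := fun q => (2 * (2 - q.2)⁻¹) • q.1
  have hσ : ∀ q ∈ {q ∈ Metric.closedBall (0 : F) 1 ×ˢ Icc (0 : ℝ) 1 | ‖q.1‖ + q.2 / 2 ≤ 1},
      σ' q ∈ Metric.closedBall 0 1 := by
    rintro ⟨z, t⟩ ⟨⟨hz, ht0, ht1⟩, h⟩
    simp only at h ht0 ht1
    have h2 : (0 : ℝ) < 2 - t := by linarith
    rw [mem_closedBall_zero_iff, norm_smul, Real.norm_of_nonneg (by positivity),
      mul_assoc, ← div_eq_inv_mul, ← mul_div_assoc, div_le_one h2]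
    linarith
  have hne : ∀ q ∈ {q ∈ Metric.closedBall (0 : F) 1 ×ˢ Icc (0 : ℝ) 1 | 1 ≤ ‖q.1‖ + q.2 / 2},
      0 < ‖q.1‖ := by
    rintro ⟨z, t⟩ ⟨⟨hz, ht0, ht1⟩, h⟩
    simp only at h ht0 ht1 ⊢
    linarith
  have hρ : ∀ q ∈ {q ∈ Metric.closedBall (0 : F) 1 ×ˢ Icc (0 : ℝ) 1 | 1 ≤ ‖q.1‖ + q.2 / 2},
      ρ q ∈ Metric.sphere (0 : F) 1 ×ˢ Icc (0 : ℝ) 1 := by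
    rintro ⟨z, t⟩ hq
    have h0 := hne _ hq
    obtain ⟨⟨hz, ht0, ht1⟩, h⟩ := hq
    simp only at h ht0 ht1 h0
    rw [mem_closedBall_zero_iff] at hz
    simp only at hz
    refine ⟨?_, ?_, ?_⟩
    · rw [mem_sphere_zero_iff_norm]
      exact CellStructure.norm_inv_smul (norm_pos_iff.1 h0)
    · simp only [ρ]
      rw [← div_eq_mul_inv, sub_nonneg, div_le_iff₀ h0]
      linarith
    · simp only [ρ]
      rw [← div_eq_mul_inv, sub_le_comm, le_div_iff₀ h0]
      linarith
  refine ⟨fun q => if ‖q.1‖ + q.2 / 2 ≤ 1 then g (σ' q) else v (ρ q), ?_, ?_, ?_, ?_⟩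
  · refine continuousOn_ite_le (by fun_prop) (hg.comp ?_ hσ) (hv.comp ?_ hρ) ?_
    · refine ((continuousOn_const.mul (ContinuousOn.inv₀ (by fun_prop) ?_)).smul continuousOn_fst)
      rintro ⟨z, t⟩ ⟨⟨hz, ht0, ht1⟩, h⟩
      simp only at ht1 ⊢
      linarith
    · have hi : ContinuousOn (fun q : F × ℝ => ‖q.1‖⁻¹)
          {q ∈ Metric.closedBall (0 : F) 1 ×ˢ Icc (0 : ℝ) 1 | 1 ≤ ‖q.1‖ + q.2 / 2} :=
        ContinuousOn.inv₀ (by fun_prop) fun q hq => (hne q hq).ne'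
      exact (hi.smul continuousOn_fst).prodMk
        (continuousOn_const.sub ((continuousOn_const.sub continuousOn_snd).mul hi))
    · rintro ⟨z, t⟩ hq h
      have hq' : (z, t) ∈ {q ∈ Metric.closedBall (0 : F) 1 ×ˢ Icc (0 : ℝ) 1 | 1 ≤ ‖q.1‖ + q.2 /
        2} :=
        ⟨hq, h.ge⟩
      have h0 := hne _ hq'
      have h1 := (hρ _ hq').1
      simp only at h h0
      have h2 : 2 - t = 2 * ‖z‖ := by linarith
      have h3 : ρ (z, t) = (‖z‖⁻¹ • z, 0) := by
        simp only [ρ, h2]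
        rw [mul_assoc, mul_inv_cancel₀ h0.ne']
        norm_num
      have h4 : σ' (z, t) = ‖z‖⁻¹ • z := by
        simp only [σ', h2]
        rw [mul_inv, ← mul_assoc, mul_inv_cancel₀ two_ne_zero, one_mul]
      rw [h3, h4, hvg]
      rwa [h3] at h1
  · rintro ⟨z, t⟩ ⟨hz, ht0, ht1⟩
    rw [mem_sphere_zero_iff_norm] at hz
    simp only at hz ht0 ht1
    by_cases ht : t = 0
    · subst ht
      simp only [hz, σ']
      norm_num
      exact (hvg z (mem_sphere_zero_iff_norm.2 hz)).symm
    · have h1 : ¬ (1 + t / 2 ≤ 1) := by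
        have := lt_of_le_of_ne ht0 (Ne.symm ht)
        linarith
      simp only [hz, if_neg h1, ρ]
      norm_num
  · intro z hz
    rw [mem_closedBall_zero_iff] at hz
    simp [σ', hz]
  · intro q hq
    by_cases h : ‖q.1‖ + q.2 / 2 ≤ 1
    · simp only [if_pos h]
      exact .inl ⟨_, hσ q ⟨hq, h⟩, rfl⟩
    · simp only [if_neg h]
      exact .inr ⟨_, hρ q ⟨hq, (not_le.1 h).le⟩, rfl⟩

/-! ### Cellular deformations -/

section Cylinder

variable {B E : Type*} [MetricSpace B] [ProperSpace B] [TopologicalSpace E] [ContractibleSpace E]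
  {p : E → B} (hp : IsCoveringMap p) (hB : IsGeodesicSpace B) {L : Set E} (hL : IsCompact L)

include hp hB hL

/-- Controlled filling of a cylinder with given maps on the bottom, the top and the sides. -/
theorem exists_extension_cylinder_near (K : CellStructure B) (r : ℝ) :
    ∃ r' : ℝ, ∀ y ∈ deckOrbit p L, ∀ {d k : ℕ}, d + 1 < k →
      ∀ {v : (Fin d → ℝ) × ℝ → E} {g₀ g₁ : (Fin d → ℝ) → E},
      ContinuousOn v (Metric.sphere 0 1 ×ˢ Icc 0 1) → ContinuousOn g₀ (Metric.closedBall 0 1) →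
      ContinuousOn g₁ (Metric.closedBall 0 1) → (∀ z ∈ Metric.sphere 0 1, v (z, 0) = g₀ z) →
      (∀ z ∈ Metric.sphere 0 1, v (z, 1) = g₁ z) →
      MapsTo v (Metric.sphere 0 1 ×ˢ Icc 0 1)
        {q | q ∈ (K.lift hp).skel k ∧ liftEDist p y q ≤ ENNReal.ofReal r} →
      MapsTo g₀ (Metric.closedBall 0 1)
        {q | q ∈ (K.lift hp).skel k ∧ liftEDist p y q ≤ ENNReal.ofReal r} →
      MapsTo g₁ (Metric.closedBall 0 1)
        {q | q ∈ (K.lift hp).skel k ∧ liftEDist p y q ≤ ENNReal.ofReal r} →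
      ∃ u : (Fin d → ℝ) × ℝ → E, ContinuousOn u (Metric.closedBall 0 1 ×ˢ Icc 0 1) ∧
        EqOn u v (Metric.sphere 0 1 ×ˢ Icc 0 1) ∧ (∀ z ∈ Metric.closedBall 0 1, u (z, 0) = g₀ z) ∧
        (∀ z ∈ Metric.closedBall 0 1, u (z, 1) = g₁ z) ∧
        MapsTo u (Metric.closedBall 0 1 ×ˢ Icc 0 1)
          {q | q ∈ (K.lift hp).skel k ∧ liftEDist p y q ≤ ENNReal.ofReal r'} := by
  obtain ⟨r', hr'⟩ := exists_extension_near hp hB hL K r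
  refine ⟨r', fun y hy d k hdk v g₀ g₁ hv hg₀ hg₁ hv₀ hv₁ hvm hg₀m hg₁m => ?_⟩
  let w : (Fin d → ℝ) × ℝ → E := fun q =>
    if q.2 ≤ 0 then g₀ q.1 else if 1 ≤ q.2 then g₁ q.1 else v q
  have hw₀ : ∀ z, w (z, 0) = g₀ z := fun z => if_pos le_rfl
  have hw₁ : ∀ z, w (z, 1) = g₁ z := fun z => by simp [w, not_le.2 (zero_lt_one (α := ℝ))]
  have hwv : EqOn w v (Metric.sphere 0 1 ×ˢ Icc 0 1) := by
    rintro ⟨z, t⟩ ⟨hz, ht0, ht1⟩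
    simp only at ht0 ht1
    rcases ht0.lt_or_eq with h0 | rfl
    · rcases ht1.lt_or_eq with h1 | rfl
      · simp [w, not_le.2 h0, not_le.2 h1]
      · rw [hw₁, hv₁ z hz]
    · rw [hw₀, hv₀ z hz]
  have hbd : cylinderBoundary d ⊆ Metric.sphere 0 1 ×ˢ Icc 0 1 ∪
      (Metric.closedBall 0 1 ×ˢ {0} ∪ Metric.closedBall 0 1 ×ˢ {1}) := by
    rw [← prod_union]
    exact subset_rfl
  have hcb : ∀ a : ℝ, IsClosed (Metric.closedBall (0 : Fin d → ℝ) 1 ×ˢ ({a} : Set ℝ)) :=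
    fun a => Metric.isClosed_closedBall.prod isClosed_singleton
  have hwc : ContinuousOn w (cylinderBoundary d) := by
    refine ContinuousOn.mono ((hv.congr hwv).union_of_isClosed (ContinuousOn.union_of_isClosed
      ?_ ?_ (hcb 0) (hcb 1)) (Metric.isClosed_sphere.prod isClosed_Icc) ((hcb 0).union (hcb 1))) hbd
    · refine (hg₀.comp continuousOn_fst fun q hq => hq.1).congr ?_
      rintro ⟨z, _⟩ ⟨-, rfl⟩
      exact hw₀ z
    · refine (hg₁.comp continuousOn_fst fun q hq => hq.1).congr ?_
      rintro ⟨z, _⟩ ⟨-, rfl⟩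
      exact hw₁ z
  have hwm : MapsTo w (cylinderBoundary d)
      {q | q ∈ (K.lift hp).skel k ∧ liftEDist p y q ≤ ENNReal.ofReal r} := by
    rintro ⟨z, t⟩ hq
    rcases hbd hq with hq | ⟨hz, ht⟩ | ⟨hz, ht⟩
    · rw [hwv hq]
      exact hvm hq
    · obtain rfl : t = 0 := ht
      rw [hw₀]
      exact hg₀m hz
    · obtain rfl : t = 1 := ht
      rw [hw₁]
      exact hg₁m hz
  obtain ⟨u, hu, huw, huk, hur⟩ := (hr' y hy (isDiscPair_cylinder d) hwc
    fun q hq => (hwm hq).2).2 k hdk fun q hq => (hwm hq).1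
  exact ⟨u, hu, fun q hq => (huw (.inl hq)).trans (hwv hq),
    fun z hz => (huw (.inr ⟨hz, .inl rfl⟩)).trans (hw₀ z),
    fun z hz => (huw (.inr ⟨hz, .inr (mem_singleton 1)⟩)).trans (hw₁ z), fun q hq =>
      ⟨huk hq, hur q hq⟩⟩

end Cylinder

/-- A covering space of a compact complex is finite-dimensional. -/
theorem CellStructure.exists_skel_lift_eq_univ {M X : Type*} [TopologicalSpace M] [T2Space M]
    [CompactSpace M] [TopologicalSpace X] {pM : X → M} (hpM : IsCoveringMap pM)
    (K : CellStructure M) : ∃ N, (K.lift hpM).skel N = univ := by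
  have hfin : Finite K.ι := by
    refine finite_univ_iff.1 ((K.finite_inter_nonempty isCompact_univ).subset fun c _ => ?_)
    exact ⟨K.map c 0, ⟨0, Metric.mem_closedBall_self zero_le_one, rfl⟩, mem_univ _⟩
  obtain ⟨N, hN⟩ := (finite_range K.dim).bddAbove
  refine ⟨N + 1, ?_⟩
  rw [K.skel_lift hpM, preimage_eq_univ_iff]
  intro y _
  obtain ⟨c, hc⟩ := K.exists_mem_openCell y
  exact ⟨c, Nat.lt_succ_of_le (hN ⟨c, rfl⟩), hc⟩

section Cellular

variable {M B : Type*} {X : Type u} {E : Type*} [TopologicalSpace X]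
  [TopologicalSpace E] {pM : X → M} {p : E → B} [MetricSpace M] [CompactSpace M] [MetricSpace B]
  [SimplyConnectedSpace X] [ContractibleSpace E] (hM : IsGeodesicSpace M)
  (hB : IsGeodesicSpace B) (hpM : IsCoveringMap pM) (hp : IsCoveringMap p) {f : M → B}
  {f' : C(X, E)} (hf' : ∀ x, p (f' x) = f (pM x))

include hM hB hp hf' in
/-- The images of the closed cells of `X` are uniformly bounded. -/
theorem exists_liftEDist_le_closedCell (KM : CellStructure M) : ∃ b : ℝ, ∀ c : (KM.lift hpM).ι,
    ∀ z ∈ Metric.closedBall 0 1, ∀ z' ∈ Metric.closedBall 0 1,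
      liftEDist p (f' ((KM.lift hpM).map c z)) (f' ((KM.lift hpM).map c z')) ≤
        ENNReal.ofReal b := by
  have := hM.locallyPathConnectedSpace
  have := locallyPathConnectedSpace_of_isLocalHomeomorph hpM.isLocalHomeomorph
  have := hB.locallyPathConnectedSpace
  have := locallyPathConnectedSpace_of_isLocalHomeomorph hp.isLocalHomeomorph
  obtain ⟨D, hD, hDM⟩ := exists_isCompact_image_eq_univ hM hpM
  let C := ⋃ c ∈ {c | ((KM.lift hpM).closedCell c ∩ D).Nonempty}, (KM.lift hpM).closedCell c
  have hC : IsCompact C := ((KM.lift hpM).finite_inter_nonempty hD).isCompact_biUnion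
    fun c _ => (KM.lift hpM).isCompact_closedCell c
  obtain ⟨b, hb⟩ := exists_liftEDist_le hp hB (hC.image f'.continuous) (hC.image f'.continuous)
  refine ⟨b, fun c z hz z' hz' => ?_⟩
  obtain ⟨x', hx', hxx⟩ := hDM (pM ((KM.lift hpM).map c z))
  obtain ⟨τ, hτ, hτx⟩ := exists_deck hpM hxx.symm
  obtain ⟨θ, hθ, hθf⟩ := exists_deck_comp_eq hp f' hf' hτ
  obtain ⟨c, F, hF⟩ := c
  let c' : (KM.lift hpM).ι := ⟨c, (τ : C(X, X)).comp F, by rw [← hF]; ext z; exact hτ _⟩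
  have hmem : ∀ z ∈ Metric.closedBall (0 : Fin (KM.dim c) → ℝ) 1, τ (F z) ∈ C := fun w hw =>
    mem_biUnion (show c' ∈ {c | ((KM.lift hpM).closedCell c ∩ D).Nonempty} from
      ⟨τ (F z), ⟨z, hz, rfl⟩, by rw [show τ (F z) = x' from hτx]; exact hx'⟩) ⟨w, hw, rfl⟩
  rw [← liftEDist_deck p hθ, ← hθf, ← hθf]
  exact hb _ ⟨_, hmem z hz, rfl⟩ _ ⟨_, hmem z' hz', rfl⟩

include hM hB hf' in
/-- A map into the skeleton of dimension less than `n` at a bounded distance from `f'` can be made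
cellular. On the cells of dimension less than `n - 1`, the homotopy to a cellular map is constructed
by controlled extension; on the other cells, the homotopy extension property suffices. -/
theorem exists_cellular_map_near [ProperSpace B] (K : CellStructure B) (KM : CellStructure M)
    {n : ℕ} {φ : C(X, E)}
    {b : ℝ} (hφ : ∀ x, φ x ∈ (K.lift hp).skel n ∧ liftEDist p (f' x) (φ x) ≤ ENNReal.ofReal b) :
    ∃ (G : C(X, E)) (b : ℝ), ∀ x, G x ∈ (K.lift hp).skel n ∧
      liftEDist p (f' x) (G x) ≤ ENNReal.ofReal b ∧
      ∀ k, x ∈ (KM.lift hpM).skel k → G x ∈ (K.lift hp).skel k := by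
  have := t2Space_of_isCoveringMap hpM
  obtain ⟨L, hL, hfL⟩ := exists_isCompact_mem_deckOrbit hM hB hpM hp hf'
  obtain ⟨β, hβ⟩ := exists_liftEDist_le_closedCell hM hB hpM hp hf' KM
  obtain ⟨N, hN⟩ := KM.exists_skel_lift_eq_univ hpM
  set KX := KM.lift hpM
  let R : ℕ → ℝ → Set (X × ℝ × E) := fun k r => {q | q.2.2 ∈ (K.lift hp).skel n ∧
    (q.2.1 = 0 → q.2.2 = φ q.1) ∧ (q.2.1 = 1 → q.2.2 ∈ (K.lift hp).skel k) ∧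
    liftEDist p (f' q.1) q.2.2 ≤ ENNReal.ofReal r}
  obtain ⟨r, H, hH, hHR⟩ := KX.exists_homotopy_of_step (R := R)
    (fun hkl hrs q hq => ⟨hq.1, hq.2.1, fun h => (K.lift hp).skel_mono hkl (hq.2.2.1 h),
      liftEDist_le_of_le hq.2.2.2 hrs⟩) (by
    intro k r
    let s := |β| + (|r| + |b|)
    obtain ⟨ρ₁, hρ₁⟩ := exists_extension_near hp hB hL K s
    obtain ⟨ρ₂, hρ₂⟩ := exists_extension_cylinder_near hp hB hL K (max s ρ₁)
    refine ⟨|r| + (|β| + (|s| + |ρ₂|)), (le_abs_self r).trans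
      (le_add_of_nonneg_right (by positivity)), fun c hc v hv hvR => ?_⟩
    have h0 : (0 : Fin (KX.dim c) → ℝ) ∈ Metric.closedBall 0 1 :=
      Metric.mem_closedBall_self zero_le_one
    let y := f' (KX.map c 0)
    have hvs : ∀ z ∈ Metric.sphere 0 1, ∀ t ∈ Icc (0 : ℝ) 1,
        liftEDist p y (v (z, t)) ≤ ENNReal.ofReal s := fun z hz t ht =>
      liftEDist_le_of_le (liftEDist_le_add (hβ c 0 h0 z (Metric.sphere_subset_closedBall hz))
        (hvR z hz t ht).2.2.2) (by simp only [s]; linarith [abs_nonneg b])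
    have hφs : ∀ z ∈ Metric.closedBall 0 1,
        liftEDist p y (φ (KX.map c z)) ≤ ENNReal.ofReal s := fun z hz =>
      liftEDist_le_of_le (liftEDist_le_add (hβ c 0 h0 z hz) (hφ _).2)
        (by simp only [s]; linarith [abs_nonneg r])
    have hback : ∀ ρ, |ρ| ≤ |s| + |ρ₂| → ∀ z ∈ Metric.closedBall 0 1, ∀ q,
        liftEDist p y q ≤ ENNReal.ofReal ρ →
        liftEDist p (f' (KX.map c z)) q ≤ ENNReal.ofReal (|r| + (|β| + (|s| + |ρ₂|))) :=
      fun ρ hρ z hz q hq => liftEDist_le_of_le (liftEDist_le_add (hβ c z hz 0 h0) hq)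
        (by linarith [abs_nonneg r])
    have hφc : ContinuousOn (fun z => φ (KX.map c z)) (Metric.closedBall 0 1) :=
      φ.continuous.comp_continuousOn (KX.continuousOn c)
    have hvφ : ∀ z ∈ Metric.sphere 0 1, v (z, 0) = φ (KX.map c z) := fun z hz =>
      (hvR z hz 0 ⟨le_rfl, zero_le_one⟩).2.1 rfl
    have h1I : (1 : ℝ) ∈ Icc (0 : ℝ) 1 := ⟨zero_le_one, le_rfl⟩
    by_cases hkn : k + 1 < n
    · obtain ⟨g, hg, hgv, hgk, hgr⟩ := (hρ₁ y (hfL _) (isDiscPair_closedBall (KX.dim c))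
        (u₀ := fun z => v (z, 1)) (hv.comp (by fun_prop) fun z hz => ⟨hz, h1I⟩)
        fun z hz => hvs z hz 1 h1I).2 (k + 1) (by omega) fun z hz =>
          (K.lift hp).skel_mono (Nat.le_succ k) ((hvR z hz 1 h1I).2.2.1 rfl)
      obtain ⟨u, hu, huv, hu0, hu1, hur⟩ := hρ₂ y (hfL _) (d := KX.dim c) (k := n) (by omega) hv
        hφc hg hvφ (fun z hz => (hgv hz).symm)
        (fun q hq => ⟨(hvR q.1 hq.1 q.2 hq.2).1,
          liftEDist_le_of_le (hvs q.1 hq.1 q.2 hq.2) (le_max_left _ _)⟩)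
        (fun z hz => ⟨(hφ _).1, liftEDist_le_of_le (hφs z hz) (le_max_left _ _)⟩)
        (fun z hz => ⟨(K.lift hp).skel_mono hkn.le (hgk hz),
          liftEDist_le_of_le (hgr z hz) (le_max_right _ _)⟩)
      refine ⟨u, hu, huv, fun z hz t ht => ?_⟩
      obtain ⟨h1, h2⟩ := hur (show (z, t) ∈ _ from ⟨hz, ht⟩)
      refine ⟨h1, ?_, ?_, hback ρ₂ (le_add_of_nonneg_left (abs_nonneg s)) z hz _ h2⟩
      · intro h
        obtain rfl : t = 0 := h
        exact hu0 z hz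
      · intro h
        obtain rfl : t = 1 := h
        change u (z, 1) ∈ _
        rw [hu1 z hz]
        exact hgk hz
    · obtain ⟨u, hu, huv, hu0, hum⟩ := exists_extension_cylinder hv hφc hvφ
      refine ⟨u, hu, huv, fun z hz t ht => ?_⟩
      have h1 : u (z, t) ∈ (K.lift hp).skel n ∧ liftEDist p y (u (z, t)) ≤ ENNReal.ofReal s := by
        rcases hum (show (z, t) ∈ _ from ⟨hz, ht⟩) with ⟨z', hz', h⟩ | ⟨⟨z', t'⟩, ⟨hz', ht'⟩, h⟩
        · rw [← h]
          exact ⟨(hφ _).1, hφs z' hz'⟩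
        · rw [← h]
          exact ⟨(hvR z' hz' t' ht').1, hvs z' hz' t' ht'⟩
      refine ⟨h1.1, ?_, fun _ => (K.lift hp).skel_mono (by omega) h1.1,
        hback s (le_add_of_nonneg_right (abs_nonneg ρ₂)) z hz _ h1.2⟩
      intro h
      obtain rfl : t = 0 := h
      exact hu0 z hz) N
  rw [hN] at hH
  have hmem : ∀ x, x ∈ KX.skel N := fun x => hN ▸ mem_univ x
  have h1I : (1 : ℝ) ∈ Icc (0 : ℝ) 1 := ⟨zero_le_one, le_rfl⟩
  refine ⟨⟨fun x => H (x, 1), hH.comp_continuous (by fun_prop) fun x => ⟨mem_univ x, h1I⟩⟩, r,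
    fun x => ⟨(hHR N le_rfl x (hmem x) 1 h1I).1, (hHR N le_rfl x (hmem x) 1 h1I).2.2.2,
      fun k hk => ?_⟩⟩
  rcases le_total k N with h | h
  · exact (hHR k h x hk 1 h1I).2.2.1 rfl
  · exact (K.lift hp).skel_mono h ((hHR N le_rfl x (hmem x) 1 h1I).2.2.1 rfl)

include hM hB hf' in
/-- A cellular homotopy between cellular maps at a bounded distance. -/
theorem exists_cellular_homotopy_near [ProperSpace B] (K : CellStructure B)
    (KM : CellStructure M) {G : C(X, E)} {b : ℝ} (hG : ∀ x,
      liftEDist p (f' x) (G x) ≤ ENNReal.ofReal b)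
    (hf'k : ∀ k, MapsTo f' ((KM.lift hpM).skel k) ((K.lift hp).skel k))
    (hGk : ∀ k, MapsTo G ((KM.lift hpM).skel k) ((K.lift hp).skel k)) :
    ∃ (H : C(X × I, E)) (b : ℝ), (∀ x, H (x, 0) = f' x) ∧ (∀ x, H (x, 1) = G x) ∧
      (∀ x t, liftEDist p (f' x) (H (x, t)) ≤ ENNReal.ofReal b) ∧
      ∀ k, ∀ x ∈ (KM.lift hpM).skel k, ∀ t, H (x, t) ∈ (K.lift hp).skel (k + 1) := by
  have := t2Space_of_isCoveringMap hpM
  obtain ⟨L, hL, hfL⟩ := exists_isCompact_mem_deckOrbit hM hB hpM hp hf'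
  obtain ⟨β, hβ⟩ := exists_liftEDist_le_closedCell hM hB hpM hp hf' KM
  obtain ⟨N, hN⟩ := KM.exists_skel_lift_eq_univ hpM
  set KX := KM.lift hpM
  let R : ℕ → ℝ → Set (X × ℝ × E) := fun k r => {q | q.2.2 ∈ (K.lift hp).skel (k + 1) ∧
    (q.2.1 = 0 → q.2.2 = f' q.1) ∧ (q.2.1 = 1 → q.2.2 = G q.1) ∧
    liftEDist p (f' q.1) q.2.2 ≤ ENNReal.ofReal r}
  obtain ⟨r, H, hH, hHR⟩ := KX.exists_homotopy_of_step (R := R)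
    (fun hkl hrs q hq => ⟨(K.lift hp).skel_mono (by omega) hq.1, hq.2.1, hq.2.2.1,
      liftEDist_le_of_le hq.2.2.2 hrs⟩) (by
    intro k r
    let s := |β| + (|r| + |b|)
    obtain ⟨ρ, hρ⟩ := exists_extension_cylinder_near hp hB hL K s
    refine ⟨|r| + (|β| + |ρ|), (le_abs_self r).trans
      (le_add_of_nonneg_right (by positivity)), fun c hc v hv hvR => ?_⟩
    have h0 : (0 : Fin (KX.dim c) → ℝ) ∈ Metric.closedBall 0 1 :=
      Metric.mem_closedBall_self zero_le_one
    have hck : ∀ z ∈ Metric.closedBall 0 1, KX.map c z ∈ KX.skel (k + 1) := fun z hz =>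
      KX.closedCell_subset_skel (by omega) ⟨z, hz, rfl⟩
    obtain ⟨u, hu, huv, hu0, hu1, hur⟩ := hρ (f' (KX.map c 0)) (hfL _) (d := KX.dim c)
      (k := k + 1 + 1) (by omega) hv (g₀ := fun z => f' (KX.map c z))
      (g₁ := fun z => G (KX.map c z)) (f'.continuous.comp_continuousOn (KX.continuousOn c))
      (G.continuous.comp_continuousOn (KX.continuousOn c))
      (fun z hz => (hvR z hz 0 ⟨le_rfl, zero_le_one⟩).2.1 rfl)
      (fun z hz => (hvR z hz 1 ⟨zero_le_one, le_rfl⟩).2.2.1 rfl)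
      (fun q hq => ⟨(K.lift hp).skel_mono (Nat.le_succ _) (hvR q.1 hq.1 q.2 hq.2).1,
        liftEDist_le_of_le (liftEDist_le_add
          (hβ c 0 h0 q.1 (Metric.sphere_subset_closedBall hq.1)) (hvR q.1 hq.1 q.2 hq.2).2.2.2)
          (by simp only [s]; linarith [abs_nonneg b])⟩)
      (fun z hz => ⟨(K.lift hp).skel_mono (Nat.le_succ _) (hf'k _ (hck z hz)),
        liftEDist_le_of_le (hβ c 0 h0 z hz)
          (by simp only [s]; linarith [abs_nonneg b, abs_nonneg r, le_abs_self β])⟩)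
      (fun z hz => ⟨(K.lift hp).skel_mono (Nat.le_succ _) (hGk _ (hck z hz)),
        liftEDist_le_of_le (liftEDist_le_add (hβ c 0 h0 z hz) (hG _))
          (by simp only [s]; linarith [abs_nonneg r])⟩)
    refine ⟨u, hu, huv, fun z hz t ht => ?_⟩
    obtain ⟨h1, h2⟩ := hur (show (z, t) ∈ _ from ⟨hz, ht⟩)
    refine ⟨h1, ?_, ?_, liftEDist_le_of_le (liftEDist_le_add (hβ c z hz 0 h0) h2)
      (le_add_of_nonneg_left (abs_nonneg r))⟩
    · intro h
      obtain rfl : t = 0 := h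
      exact hu0 z hz
    · intro h
      obtain rfl : t = 1 := h
      exact hu1 z hz) N
  rw [hN] at hH
  have hmem : ∀ x, x ∈ KX.skel N := fun x => hN ▸ mem_univ x
  have hHN : ∀ (x : X) (t : I), (x, (t : ℝ), H (x, t)) ∈ R N r :=
    fun x t => hHR N le_rfl x (hmem x) t t.2
  refine ⟨⟨fun q => H (q.1, q.2), hH.comp_continuous (by fun_prop) fun q => ⟨mem_univ _, q.2.2⟩⟩,
    r, fun x => (hHN x 0).2.1 rfl, fun x => (hHN x 1).2.2.1 rfl, fun x t => (hHN x t).2.2.2,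
    fun k x hk t => ?_⟩
  rcases le_total k N with h | h
  · exact (hHR k h x hk t t.2).1
  · exact (K.lift hp).skel_mono (by omega) (hHN x t).1

end Cellular

/-! ### Independence of the metric -/

namespace ProperGeodesicMetric

variable {B : Type*} [t : TopologicalSpace B] (d : ProperGeodesicMetric B)

/-- The metric, with its topology replaced by the given one, so that it can serve as an instance. -/
abbrev toMetricSpace : MetricSpace B := d.metric.replaceTopology d.topology_eq.symm

theorem lift_eq {E : Type*} [TopologicalSpace E] (p : E → B) :
    d.lift p = @liftEDist E B _ d.toMetricSpace.toPseudoMetricSpace.toPseudoEMetricSpace p := rfl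

theorem properSpace : @ProperSpace B d.toMetricSpace.toPseudoMetricSpace := by
  refine @ProperSpace.mk B d.toMetricSpace.toPseudoMetricSpace fun x r => ?_
  exact d.isCompact_closedBall x r

theorem isGeodesicSpace : @IsGeodesicSpace B d.toMetricSpace := d.geodesic

end ProperGeodesicMetric

/-- Tracks that are moved into one compact set by deck transformations are bounded with respect to
every metric. -/
theorem isBoundedHomotopy_of_isCompact {X B E : Type*} [TopologicalSpace X] [TopologicalSpace B]
    [TopologicalSpace E] [PathConnectedSpace E] {p : E → B} (hp : IsCoveringMap p) {C : Set E}
    (hC : IsCompact C) {H : C(X × I, E)}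
    (hH : ∀ x, ∃ θ : E ≃ₜ E, (∀ z, p (θ z) = p z) ∧ ∀ t, θ (H (x, t)) ∈ C)
    (d : ProperGeodesicMetric B) : IsBoundedHomotopy (d.lift p) H := by
  let := d.toMetricSpace
  obtain ⟨b, hb⟩ := exists_liftEDist_le hp d.isGeodesicSpace hC hC
  refine ⟨b, fun x s t => ?_⟩
  obtain ⟨θ, hθ, hx⟩ := hH x
  rw [d.lift_eq, ← liftEDist_deck p hθ]
  exact hb _ (hx s) _ (hx t)

section Bounded

variable {M B : Type*} {X : Type u} {E : Type*} [TopologicalSpace X]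
  [TopologicalSpace E] {pM : X → M} {p : E → B} [MetricSpace M] [CompactSpace M] [MetricSpace B]
  [ProperSpace B] [SimplyConnectedSpace X] [SimplyConnectedSpace E] (hM : IsGeodesicSpace M)
  (hB : IsGeodesicSpace B) (hpM : IsCoveringMap pM) (hp : IsCoveringMap p) {f : M → B}
  {f' : C(X, E)} (hf' : ∀ x, p (f' x) = f (pM x))

include hM hB hpM hp hf' in
theorem exists_isCompact_of_forall_liftEDist_le {H : C(X × I, E)} {b : ℝ}
    (hH : ∀ x t, liftEDist p (f' x) (H (x, t)) ≤ ENNReal.ofReal b) :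
    ∃ C, IsCompact C ∧ ∀ x, ∃ θ : E ≃ₜ E, (∀ z, p (θ z) = p z) ∧ ∀ t, θ (H (x, t)) ∈ C := by
  obtain ⟨L, hL, hfL⟩ := exists_isCompact_mem_deckOrbit hM hB hpM hp hf'
  obtain ⟨C, hC, hCb⟩ := exists_isCompact_of_liftEDist_le hp hB hL b
  refine ⟨C, hC, fun x => ?_⟩
  obtain ⟨θ, hθ, hx⟩ := hfL x
  exact ⟨θ, hθ, fun t => hCb hθ hx (hH x t)⟩

end Bounded

end MacroDim

open MacroDim in
theorem mainTheorem3
    -- a closed connected `n`-manifold `M` with a geodesic metric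
    (n : ℕ) {M : Type*} [TopologicalSpace M] [T2Space M] [CompactSpace M] [ConnectedSpace M]
    [ChartedSpace (EuclideanSpace ℝ (Fin n)) M] (dM : ProperGeodesicMetric M)
    -- the universal covering of `M`
    {X : Type*} [TopologicalSpace X] [SimplyConnectedSpace X] (pM : X → M) (hpM : IsCoveringMap pM)
    -- the locally finite CW complex `Bπ`, with contractible universal covering space `Eπ`
    {B : Type*} [TopologicalSpace B] [T2Space B] (cB : CWComplex (univ : Set B))
    (hcB : IsLocallyFiniteCW cB) [Nonempty (ProperGeodesicMetric B)]
    {E : Type*} [TopologicalSpace E] [ContractibleSpace E] (p : E → B) (hp : IsCoveringMap p)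
    -- the classifying map of `M` and a lift of it to the universal coverings
    (f : C(M, B)) (hf : ∀ x : M, Function.Bijective (FundamentalGroup.map f x))
    (f' : C(X, E)) (hf' : ∀ x : X, p (f' x) = f (pM x)) :
    List.TFAE [
      macroDim X (dM.lift pM) < n,
      ∃ H : C(X × I, E), IsDeformationInto f' (liftedSkel p cB n) H ∧
        ∀ d : ProperGeodesicMetric B, IsBoundedHomotopy (d.lift p) H,
      ∀ d : ProperGeodesicMetric B, ∃ H : C(X × I, E),
        IsDeformationInto f' (liftedSkel p cB n) H ∧ IsBoundedHomotopy (d.lift p) H,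
      ∃ d : ProperGeodesicMetric B, ∃ H : C(X × I, E),
        IsDeformationInto f' (liftedSkel p cB n) H ∧ IsBoundedHomotopy (d.lift p) H] ∧
    (macroDim X (dM.lift pM) < n →
      ∀ cM : CWComplex (univ : Set M), IsCellularMap cM cB f →
        ∃ H : C(X × I, E), IsDeformationInto f' (liftedSkel p cB n) H ∧
          (∀ d : ProperGeodesicMetric B, IsBoundedHomotopy (d.lift p) H) ∧
          IsCellularHomotopy pM p cM cB H) := by
  classical
  obtain ⟨d₀⟩ := (inferInstance : Nonempty (ProperGeodesicMetric B))
  let := dM.toMetricSpace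
  let := d₀.toMetricSpace
  have hM : IsGeodesicSpace M := dM.isGeodesicSpace
  have hB : IsGeodesicSpace B := d₀.isGeodesicSpace
  have : ProperSpace B := d₀.properSpace
  let K := cellStructureOfCW cB hcB
  have hK : ∀ k, (K.lift hp).skel k = liftedSkel p cB k := fun k => by
    rw [K.skel_lift hp, skel_cellStructureOfCW]; rfl
  rw [dM.lift_eq]
  have hbdd : ∀ {H : C(X × I, E)} {b : ℝ},
      (∀ x t, liftEDist p (f' x) (H (x, t)) ≤ ENNReal.ofReal b) →
      ∀ d : ProperGeodesicMetric B, IsBoundedHomotopy (d.lift p) H := fun hH => by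
    obtain ⟨C, hC, hCH⟩ := exists_isCompact_of_forall_liftEDist_le hM hB hpM hp hf' hH
    exact isBoundedHomotopy_of_isCompact hp hC hCH
  constructor
  · tfae_have 1 → 2 := fun hdim => by
      obtain ⟨H, b, hH0, hH1, hHb⟩ := exists_deformation_near hM hB hpM hp hf' hdim K
      exact ⟨H, ⟨hH0, fun x => hK n ▸ hH1 x⟩, hbdd hHb⟩
    tfae_have 2 → 3 := fun ⟨H, hH, hHb⟩ d => ⟨H, hH, hHb d⟩
    tfae_have 3 → 4 := fun h => ⟨d₀, h d₀⟩
    tfae_have 4 → 1 := fun ⟨d, H, hH, b, hb⟩ => by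
      let := d.toMetricSpace
      have : ProperSpace B := d.properSpace
      refine macroDim_lt_of_bounded hM d.isGeodesicSpace hpM hp hf' (fun m => (hf m).1) K
        (h := ⟨fun x => H (x, 1), by fun_prop⟩) (fun x => ?_) (b := b) fun x => ?_
      · rw [hK n]
        exact hH.2 x
      · rw [← hH.1 x]
        exact hb x 0 1
    tfae_finish
  · intro hdim cM hfc
    let KM := cellStructureOfCW cM (isLocallyFiniteCW_of_compactSpace cM)
    have hKM : ∀ k, (KM.lift hpM).skel k = liftedSkel pM cM k := fun k => by
      rw [KM.skel_lift hpM, skel_cellStructureOfCW]; rfl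
    obtain ⟨φ, b, hφ⟩ := exists_map_skel_near hM hB hpM hp hf' hdim K
    obtain ⟨G, b', hG⟩ := exists_cellular_map_near hM hB hpM hp hf' K KM hφ
    have hf'k : ∀ k, MapsTo f' ((KM.lift hpM).skel k) ((K.lift hp).skel k) := fun k x hx => by
      rw [hKM] at hx
      rw [hK]
      change p (f' x) ∈ skel cB k
      rw [hf']
      exact hfc k hx
    have hGk : ∀ k, MapsTo G ((KM.lift hpM).skel k) ((K.lift hp).skel k) :=
      fun k x hx => (hG x).2.2 k hx
    obtain ⟨H, b'', hH0, hH1, hHb, hHk⟩ := exists_cellular_homotopy_near hM hB hpM hp hf' K KM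
      (fun x => (hG x).2.1) hf'k hGk
    refine ⟨H, ⟨hH0, fun x => ?_⟩, hbdd hHb, fun k => ?_⟩
    · rw [hH1, ← hK]
      exact (hG x).1
    · have hend : ∀ k, MapsTo H (liftedSkel pM cM k ×ˢ {0, 1}) (liftedSkel p cB k) := by
        rintro k ⟨x, t⟩ ⟨hx, ht⟩
        rw [← hKM] at hx
        rw [← hK]
        rcases ht with ht | ht
        · obtain rfl : t = 0 := ht
          rw [hH0]
          exact hf'k k hx
        · obtain rfl : t = 1 := ht
          rw [hH1]
          exact hGk k hx
      cases k with
      | zero => exact hend 0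
      | succ k =>
        rintro ⟨x, t⟩ (hx | ⟨hx, -⟩)
        · exact hend (k + 1) hx
        · rw [← hK]
          exact hHk k x (by rw [hKM]; exact hx) t
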